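/- The rendezvous game is played on a finite simple connected graph $G$. Facilitator has two agents, starting at given vertices $s$ and $t$; Divider has $k$ agents, which he first places on vertices of $V(G)\setminus\{s,t\}$ (several agents may share a vertex). Then the players move alternately, Facilitator first. In a move, each agent of the player stays put or moves to an adjacent vertex, and no agent may move to a vertex occupied by an agent of the adversary. Facilitator wins if her two agents are ever at the same vertex; Divider wins if this never happens. A strategy is a function of the current position (and, for Divider, also a choice of the initial placement). The problem Rendezvous asks, given $G$, $s$, $t$ and a positive integer $k$, whether Facilitator has a winning strategy against Divider with $k$ agents. The dynamic separation number $d_G(s,t)$ is the smallest number of agents with which Divider has a winning strategy ($+\infty$ if there is none, as when $s=t$ or $s,t$ are adjacent). The static separation number $\lambda_G(s,t)$ is the smallest size of a set $S\subseteq V(G)\setminus\{s,t\}$ that meets every $s$–$t$ path ($+\infty$ if there is none). The $M\times N$ grid has the vertex set $[M]\times[N]$, with $(i,j)$ and $(i',j')$ adjacent iff $|i-i'|+|j-j'|=1$. **Theorem.** Rendezvous can be solved in polynomial time on connected graphs of treewidth at most two, and on grids (the graph being given by its adjacency matrix and $k$ in binary). Moreover: 1. If $G$ is a finite connected graph of treewidth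 at most two, then $d_G(s,t)=\lambda_G(s,t)$ for all $s,t\in V(G)$; and for distinct non-adjacent $s,t$ in such a graph this number can be computed in polynomial time. 2. If $G$ is an $M\times N$ grid with $M,N\ge 2$, then $d_G(s,t)=2$ for every pair of distinct non-adjacent vertices $s,t$ of $G$. -/

import Mathlib

namespace Rendezvous

/-! ### The rendezvous game -/

/-- Two multisets of vertices are adjacent if there is a bijection between them moving every
element to itself or to a neighbour: every agent stays put or moves along an edge. -/
def MoveAdj {V : Type*} (G : SimpleGraph V) (X Y : Multiset V) : Prop :=
  Multiset.Rel (fun x y => x = y ∨ G.Adj x y) X Y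

/-- A position of the game: a placement `F` of the two agents of Facilitator and a placement `D`
of the `k` agents of Divider, with no vertex in common. -/
structure Position (V : Type*) (k : ℕ) where
  F : Sym V 2
  D : Sym V k
  compatible : Disjoint (F : Multiset V) (D : Multiset V)

/-- A strategy of Facilitator maps every position to a new placement of her two agents. -/
structure FacilitatorStrategy {V : Type*} (G : SimpleGraph V) (k : ℕ) where
  move : Position V k → Sym V 2
  move_adj : ∀ P, MoveAdj G (P.F : Multiset V) (move P : Multiset V)
  move_compatible : ∀ P, Disjoint (move P : Multiset V) (P.D : Multiset V)

/-- A strategy of Divider consists of an initial placement of his `k` agents, outside the initial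
vertices `s`, `t` of Facilitator's agents, and of a map from positions to new placements. -/
structure DividerStrategy {V : Type*} (G : SimpleGraph V) (s t : V) (k : ℕ) where
  init : Sym V k
  init_compatible : Disjoint ({s, t} : Multiset V) (init : Multiset V)
  move : Position V k → Sym V k
  move_adj : ∀ P, MoveAdj G (P.D : Multiset V) (move P : Multiset V)
  move_compatible : ∀ P, Disjoint (P.F : Multiset V) (move P : Multiset V)

/-- The play determined by two strategies: `play f d i` is the position after `i` moves of each
player. Facilitator moves first in every round. -/
def play {V : Type*} {G : SimpleGraph V} {s t : V} {k : ℕ}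
    (f : FacilitatorStrategy G k) (d : DividerStrategy G s t k) : ℕ → Position V k
  | 0 => ⟨⟨{s, t}, rfl⟩, d.init, d.init_compatible⟩
  | i + 1 =>
    let Q : Position V k :=
      ⟨f.move (play f d i), (play f d i).D, f.move_compatible (play f d i)⟩
    ⟨Q.F, d.move Q, d.move_compatible Q⟩

/-- Facilitator's two agents meet at some time: they occupy the same vertex. (A move of Divider
does not change the placement of Facilitator's agents.) -/
def Meets {V : Type*} {G : SimpleGraph V} {s t : V} {k : ℕ}
    (f : FacilitatorStrategy G k) (d : DividerStrategy G s t k) : Prop :=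
  ∃ (i : ℕ) (v : V), ((play f d i).F : Multiset V) = {v, v}

/-- Facilitator has a winning strategy against Divider with `k` agents. -/
def FacilitatorWins {V : Type*} (G : SimpleGraph V) (s t : V) (k : ℕ) : Prop :=
  ∃ f : FacilitatorStrategy G k, ∀ d : DividerStrategy G s t k, Meets f d

/-- Divider with `k` agents has a winning strategy. -/
def DividerWins {V : Type*} (G : SimpleGraph V) (s t : V) (k : ℕ) : Prop :=
  ∃ d : DividerStrategy G s t k, ∀ f : FacilitatorStrategy G k, ¬ Meets f d

/-- The dynamic separation number `d_G(s,t)`: the smallest number of agents with which Divider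
wins, and `⊤` if there is none (as when `s = t` or `s`, `t` are adjacent). -/
noncomputable def dynSep {V : Type*} (G : SimpleGraph V) (s t : V) : ℕ∞ :=
  ⨅ (k : ℕ) (_ : DividerWins G s t k), (k : ℕ∞)

/-! ### Separators, tree decompositions, grids -/

/-- `S` is a vertex `(s,t)`-separator: it avoids `s` and `t` and meets every walk from `s` to `t`,
that is, its removal disconnects `s` from `t`. -/
def IsSeparator {V : Type*} (G : SimpleGraph V) (s t : V) (S : Finset V) : Prop :=
  s ∉ S ∧ t ∉ S ∧ ∀ p : G.Walk s t, ∃ v ∈ p.support, v ∈ S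

/-- The static separation number `λ_G(s,t)`: the smallest size of an `(s,t)`-separator, and `⊤`
if there is none (exactly when `s = t` or `s`, `t` are adjacent). -/
noncomputable def statSep {V : Type*} (G : SimpleGraph V) (s t : V) : ℕ∞ :=
  ⨅ (S : Finset V) (_ : IsSeparator G s t S), (S.card : ℕ∞)

/-- A tree decomposition of a graph, with a finite tree on the nodes `Fin m`. -/
structure TreeDecomposition {V : Type*} (G : SimpleGraph V) where
  m : ℕ
  tree : SimpleGraph (Fin m)
  isTree : tree.IsTree
  bag : Fin m → Finset V
  vertex_covered : ∀ v, ∃ i, v ∈ bag i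
  edge_covered : ∀ u v, G.Adj u v → ∃ i, u ∈ bag i ∧ v ∈ bag i
  connected : ∀ v, (tree.induce {i | v ∈ bag i}).Connected

/-- The treewidth of a finite nonempty graph: the least `w` such that some tree decomposition has
all bags of size at most `w + 1`. (The decomposition with one bag shows that there is one.) -/
noncomputable def treewidth {V : Type*} (G : SimpleGraph V) : ℕ :=
  sInf {w : ℕ | ∃ T : TreeDecomposition G, ∀ i, (T.bag i).card ≤ w + 1}

/-- The `M × N` grid. -/
def grid (M N : ℕ) : SimpleGraph (Fin M × Fin N) where
  Adj u v := |((u.1 : ℕ) : ℤ) - ((v.1 : ℕ) : ℤ)| + |((u.2 : ℕ) : ℤ) - ((v.2 : ℕ) : ℤ)| = 1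
  symm := ⟨fun u v h => by
    rw [abs_sub_comm ((v.1 : ℕ) : ℤ), abs_sub_comm ((v.2 : ℕ) : ℤ)]; exact h⟩
  loopless := ⟨fun u h => by simp at h⟩

/-- A graph is a grid if it is, up to the names of the vertices, an `M × N` grid. -/
def IsGrid {V : Type*} (G : SimpleGraph V) : Prop :=
  ∃ M N : ℕ, Nonempty (G ≃g grid M N)

/-! ### The machine model

A random access machine with registers `r₀, r₁, …` (a program mentions finitely many of them) and
a memory of cells `0, 1, …`, all holding natural numbers. Its programs are structured programs
whose only arithmetic operations are addition and truncated subtraction, each elementary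
instruction and each test costing one unit of time. As there is no multiplication, the length of
the numbers grows by at most one bit per time unit, so this machine and the Turing machine
simulate each other with polynomial overhead. -/

/-- Programs of the machine. -/
inductive Cmd : Type
  /-- do nothing -/
  | skip : Cmd
  /-- `r := c` -/
  | const (r c : ℕ) : Cmd
  /-- `r := a + b`, for registers `a`, `b` -/
  | add (r a b : ℕ) : Cmd
  /-- `r := a - b`, truncated at `0`, for registers `a`, `b` -/
  | sub (r a b : ℕ) : Cmd
  /-- `r := mem[a]`, the address being the content of the register `a` -/
  | load (r a : ℕ) : Cmd
  /-- `mem[a] := b`, the address being the content of the register `a`, for a register `b` -/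
  | store (a b : ℕ) : Cmd
  /-- first `c₁`, then `c₂` -/
  | seq (c₁ c₂ : Cmd) : Cmd
  /-- `c₁` if the register `r` is nonzero, otherwise `c₂` -/
  | ite (r : ℕ) (c₁ c₂ : Cmd) : Cmd
  /-- repeat `c` as long as the register `r` is nonzero -/
  | while (r : ℕ) (c : Cmd) : Cmd

/-- The contents of the registers and of the memory. -/
structure State where
  reg : ℕ → ℕ
  mem : ℕ → ℕ

/-- Change the content of the register `r` to `x`. -/
def State.setReg (σ : State) (r x : ℕ) : State := ⟨Function.update σ.reg r x, σ.mem⟩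

/-- Change the content of the memory cell `a` to `x`. -/
def State.setMem (σ : State) (a x : ℕ) : State := ⟨σ.reg, Function.update σ.mem a x⟩

/-- `Exec c σ σ' T`: the program `c`, started in the state `σ`, halts in the state `σ'` after
exactly `T` time units. -/
inductive Exec : Cmd → State → State → ℕ → Prop
  | skip (σ : State) : Exec Cmd.skip σ σ 1
  | const (σ : State) (r c : ℕ) : Exec (Cmd.const r c) σ (σ.setReg r c) 1
  | add (σ : State) (r a b : ℕ) : Exec (Cmd.add r a b) σ (σ.setReg r (σ.reg a + σ.reg b)) 1
  | sub (σ : State) (r a b : ℕ) : Exec (Cmd.sub r a b) σ (σ.setReg r (σ.reg a - σ.reg b)) 1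
  | load (σ : State) (r a : ℕ) : Exec (Cmd.load r a) σ (σ.setReg r (σ.mem (σ.reg a))) 1
  | store (σ : State) (a b : ℕ) : Exec (Cmd.store a b) σ (σ.setMem (σ.reg a) (σ.reg b)) 1
  | seq {c₁ c₂ : Cmd} {σ σ' σ'' : State} {T₁ T₂ : ℕ} :
      Exec c₁ σ σ' T₁ → Exec c₂ σ' σ'' T₂ → Exec (Cmd.seq c₁ c₂) σ σ'' (T₁ + T₂)
  | ite_true {r : ℕ} {c₁ c₂ : Cmd} {σ σ' : State} {T : ℕ} :
      σ.reg r ≠ 0 → Exec c₁ σ σ' T → Exec (Cmd.ite r c₁ c₂) σ σ' (T + 1)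
  | ite_false {r : ℕ} {c₁ c₂ : Cmd} {σ σ' : State} {T : ℕ} :
      σ.reg r = 0 → Exec c₂ σ σ' T → Exec (Cmd.ite r c₁ c₂) σ σ' (T + 1)
  | while_false {r : ℕ} {c : Cmd} {σ : State} :
      σ.reg r = 0 → Exec (Cmd.while r c) σ σ 1
  | while_true {r : ℕ} {c : Cmd} {σ σ' σ'' : State} {T₁ T₂ : ℕ} :
      σ.reg r ≠ 0 → Exec c σ σ' T₁ → Exec (Cmd.while r c) σ' σ'' T₂ →
      Exec (Cmd.while r c) σ σ'' (T₁ + T₂ + 1)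

/-- The initial state: the input, a bit string, is in the memory cells `0, 1, …`, its length is in
the register `0`; all other registers and cells hold `0`. -/
def initState (w : List Bool) : State where
  reg r := if r = 0 then w.length else 0
  mem i := if w[i]? = some true then 1 else 0

/-- A function `f` is computable in polynomial time on the inputs from the class `C`, given by
their encoding `enc`: a program halts on every input from `C` with the value of `f` in the register
`0`, within a time bounded by a polynomial in the length of the encoding. -/
def PolyTimeComputableOn {α : Type} (enc : α → List Bool) (C : α → Prop) (f : α → ℕ∞) : Prop :=
  ∃ (c : Cmd) (p : Polynomial ℕ), ∀ a, C a → ∃ (σ : State) (T : ℕ),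
    Exec c (initState (enc a)) σ T ∧ T ≤ p.eval (enc a).length ∧ (σ.reg 0 : ℕ∞) = f a

open Classical in
/-- The problem `P` is decidable in polynomial time on the inputs from the class `C`: its
characteristic function is computable in polynomial time there. -/
def PolyTimeDecidableOn {α : Type} (enc : α → List Bool) (C : α → Prop) (P : α → Prop) : Prop :=
  PolyTimeComputableOn enc C (fun a => if P a then 1 else 0)

/-! ### Instances and their encodings -/

/-- A finite graph with two given vertices. -/
structure GraphPair where
  n : ℕ
  graph : SimpleGraph (Fin n)
  s : Fin n
  t : Fin n

/-- An instance of the problem Rendezvous: a graph with two given vertices and a positive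
integer. -/
structure Instance extends GraphPair where
  k : ℕ
  k_pos : 0 < k

/-- The number `i` in unary, with an end mark. -/
def unary (i : ℕ) : List Bool := List.replicate i true ++ [false]

open Classical in
/-- The encoding of a graph with two given vertices: the number of vertices and the two vertices
in unary, then the adjacency matrix row by row. -/
noncomputable def encodeGraphPair (I : GraphPair) : List Bool :=
  unary I.n ++ unary I.s ++ unary I.t ++
    (List.finRange I.n).flatMap fun u =>
      (List.finRange I.n).map fun v => decide (I.graph.Adj u v)

/-- The encoding of an instance of Rendezvous: the graph with its two vertices, followed by the
number of agents in binary (least significant bit first). -/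
noncomputable def encodeInstance (I : Instance) : List Bool :=
  encodeGraphPair I.toGraphPair ++ Nat.bits I.k

/-- The question of Rendezvous: can Facilitator win starting from `s` and `t` against Divider with
`k` agents? -/
def Instance.IsYes (I : Instance) : Prop := FacilitatorWins I.graph I.s I.t I.k

end Rendezvous

namespace Rendezvous

/-! ### Winning regions -/

section Game

variable {V : Type*} {G : SimpleGraph V} {k : ℕ}

/-! Both halves of the theorem compare the game with one explicit number, `sepValue`: it is 1 if a
single vertex separates `s` from `t`, and otherwise the maximum of 2 and the number of components of
`G - {s, t}` attached to both `s` and `t`.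

Facilitator beats any positive number of agents below `sepValue`, in every finite graph. If some
attached component contains no agent of Divider, she runs along a shortest `s`–`t` route through it
while her other agent waits at `t`; an intruder would have to enter through `s` and comes too late
(`IsFull.not_safePair`). So Divider needs an agent in each attached component
(`facilitatorWins_of_lt_ncard`). Against one agent she wins unless a single vertex separates
(`IsSafeRel.exists_separating`): she can reach a position in which a common cycle carries both her
agents, and such a position is won by induction on the length of the cycle
(`IsSafeRel.not_on_cycle`).

Conversely, agents standing still on a nonempty separator win for Divider. In treewidth at most two
there is a separator of size at most `sepValue`. If no bag contains both `s` and `t`, an adhesion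
set of size two will do. Otherwise, by the Helly property of subtrees, every route through an
attached component uses a vertex sharing a bag with `s` and `t`, and as bags have three elements,
each component has only one such vertex. Hence the dynamic and static numbers both equal `sepValue`
for distinct non-adjacent `s`, `t` of a connected graph.

On a grid, two agents keep Facilitator's agents apart by shadowing them (`IsGridCoord.dividerWins`),
and no single vertex separates when both sides have length at least two (`IsGridCoord.avoid`).

So on both classes, for positive `k`, Facilitator wins iff `s = t`, or `s` and `t` are adjacent, or
`k < sepValue`. One program serves both: it finds `sepValue` by graph searches, testing every vertex
as a cut and counting attached components by their least vertices. -/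

/-- Facilitator's agents are at the same vertex. -/
def Position.Met (P : Position V k) : Prop := ∃ v, (P.F : Multiset V) = {v, v}

/-- Facilitator, to move, can force a meeting within `n` rounds. -/
def WinIn (G : SimpleGraph V) : ℕ → Position V k → Prop
  | 0, P => P.Met
  | n + 1, P => WinIn G n P ∨ ∃ F' : Sym V 2, MoveAdj G (P.F : Multiset V) (F' : Multiset V) ∧
      Disjoint (F' : Multiset V) (P.D : Multiset V) ∧
      ∀ (D' : Sym V k) (h : Disjoint (F' : Multiset V) (D' : Multiset V)),
        MoveAdj G (P.D : Multiset V) (D' : Multiset V) → WinIn G n ⟨F', D', h⟩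

/-- Facilitator, to move, cannot force a meeting. -/
def Safe (G : SimpleGraph V) (P : Position V k) : Prop := ∀ n, ¬ WinIn G n P

theorem WinIn.mono {P : Position V k} {m n : ℕ} (h : m ≤ n) (hw : WinIn G m P) : WinIn G n P := by
  induction h with
  | refl => exact hw
  | step _ ih => exact Or.inl ih

theorem moveAdj_refl (X : Multiset V) : MoveAdj G X X :=
  Multiset.rel_refl_of_refl_on fun _ _ => Or.inl rfl

/-- Facilitator plays so that the least number of rounds needed to force a meeting drops in every
round. Where this rank is zero or undefined, she may stay put. -/
theorem facilitatorWins_of_winIn {s t : V}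
    (h : ∀ (D : Sym V k) (hD : Disjoint ({s, t} : Multiset V) (D : Multiset V)),
      ¬ Safe G (⟨⟨{s, t}, rfl⟩, D, hD⟩ : Position V k)) : FacilitatorWins G s t k := by
  classical
  have key : ∀ P : Position V k, ∃ F' : Sym V 2, MoveAdj G (P.F : Multiset V) (F' : Multiset V) ∧
      Disjoint (F' : Multiset V) (P.D : Multiset V) ∧
      ∀ n, WinIn G (n + 1) P → ¬ WinIn G n P →
      ∀ (D' : Sym V k) (h : Disjoint (F' : Multiset V) (D' : Multiset V)),
        MoveAdj G (P.D : Multiset V) (D' : Multiset V) → WinIn G n ⟨F', D', h⟩ := by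
    intro P
    by_cases hP : ∃ n, WinIn G (n + 1) P ∧ ¬ WinIn G n P
    · obtain ⟨n, hn, hn'⟩ := hP
      obtain ⟨F', h1, h2, h3⟩ := hn.resolve_left hn'
      refine ⟨F', h1, h2, fun m hm hm' D' h hD => ?_⟩
      have : m = n := by
        rcases lt_trichotomy m n with hlt | heq | hlt
        · exact absurd (hm.mono hlt) hn'
        · exact heq
        · exact absurd (hn.mono hlt) hm'
      exact this ▸ h3 D' h hD
    · push Not at hP
      exact ⟨P.F, moveAdj_refl _, P.compatible, fun n hn hn' => absurd (hP n hn) hn'⟩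
  choose f hf1 hf2 hf3 using key
  refine ⟨⟨f, hf1, hf2⟩, fun d => ?_⟩
  have hwin : ∀ n i, WinIn G n (play ⟨f, hf1, hf2⟩ d i) → Meets ⟨f, hf1, hf2⟩ d := by
    intro n
    induction n with
    | zero => rintro i ⟨v, hv⟩; exact ⟨i, v, hv⟩
    | succ n ih =>
      intro i hi
      by_cases hn : WinIn G n (play ⟨f, hf1, hf2⟩ d i)
      · exact ih i hn
      · exact ih (i + 1) (hf3 _ n hi hn _ _ (d.move_adj ⟨_, _, hf2 _⟩))
  have h0 := h d.init d.init_compatible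
  simp only [Safe, not_forall, not_not] at h0
  obtain ⟨n, hn⟩ := h0
  exact hwin n 0 hn

theorem Safe.not_met {P : Position V k} (h : Safe G P) : ¬ P.Met := h 0

/-- Divider has finitely many replies. If each one lost within some number of rounds, the maximum of
these numbers would bound a forced win from `P`. -/
theorem Safe.exists_response [Finite V] {P : Position V k} (h : Safe G P) (F' : Sym V 2)
    (h1 : MoveAdj G (P.F : Multiset V) (F' : Multiset V))
    (h2 : Disjoint (F' : Multiset V) (P.D : Multiset V)) :
    ∃ (D' : Sym V k) (h : Disjoint (F' : Multiset V) (D' : Multiset V)),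
      MoveAdj G (P.D : Multiset V) (D' : Multiset V) ∧ Safe G ⟨F', D', h⟩ := by
  classical
  by_contra hcon
  push Not at hcon
  have key : ∀ D' : Sym V k, ∃ n, ∀ (h : Disjoint (F' : Multiset V) (D' : Multiset V)),
      MoveAdj G (P.D : Multiset V) (D' : Multiset V) → WinIn G n ⟨F', D', h⟩ := by
    intro D'
    by_cases hD : ∃ (h : Disjoint (F' : Multiset V) (D' : Multiset V)),
      MoveAdj G (P.D : Multiset V) (D' : Multiset V)
    · obtain ⟨h, hm⟩ := hD
      have := hcon D' h hm
      simp only [Safe, not_forall, not_not] at this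
      obtain ⟨n, hn⟩ := this
      exact ⟨n, fun _ _ => hn⟩
    · exact ⟨0, fun h hm => absurd ⟨h, hm⟩ hD⟩
  choose n hn using key
  have := Fintype.ofFinite V
  refine h (Finset.univ.sup n + 1) (Or.inr ⟨F', h1, h2, fun D' hd hm => ?_⟩)
  exact (hn D' hd hm).mono (Finset.le_sup (Finset.mem_univ D'))

/-- A strategy sees only the current position, so it is defined everywhere: restore the invariant if
some move does, otherwise stay put. -/
theorem dividerWins_of_invariant {s t : V} (I : Position V k → Prop) (D : Sym V k)
    (hD : Disjoint ({s, t} : Multiset V) (D : Multiset V)) (hI : I ⟨⟨{s, t}, rfl⟩, D, hD⟩)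
    (hmet : ∀ P, I P → ¬ P.Met)
    (hstep : ∀ P, I P → ∀ F' : Sym V 2, MoveAdj G (P.F : Multiset V) (F' : Multiset V) →
      Disjoint (F' : Multiset V) (P.D : Multiset V) →
      ∃ (D' : Sym V k) (h : Disjoint (F' : Multiset V) (D' : Multiset V)),
        MoveAdj G (P.D : Multiset V) (D' : Multiset V) ∧ I ⟨F', D', h⟩) :
    DividerWins G s t k := by
  classical
  have key : ∀ Q : Position V k, ∃ D' : Sym V k, MoveAdj G (Q.D : Multiset V) (D' : Multiset V) ∧
      ∃ h : Disjoint (Q.F : Multiset V) (D' : Multiset V),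
      ((∃ (D' : Sym V k) (h : Disjoint (Q.F : Multiset V) (D' : Multiset V)),
        MoveAdj G (Q.D : Multiset V) (D' : Multiset V) ∧ I ⟨Q.F, D', h⟩) → I ⟨Q.F, D', h⟩) := by
    intro Q
    by_cases hQ : ∃ (D' : Sym V k) (h : Disjoint (Q.F : Multiset V) (D' : Multiset V)),
        MoveAdj G (Q.D : Multiset V) (D' : Multiset V) ∧ I ⟨Q.F, D', h⟩
    · obtain ⟨D', h, hm, hi⟩ := hQ
      exact ⟨D', hm, h, fun _ => hi⟩
    · exact ⟨Q.D, moveAdj_refl _, Q.compatible, fun h => absurd h hQ⟩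
  choose d hd1 hd2 hd3 using key
  refine ⟨⟨D, hD, d, hd1, hd2⟩, fun f => ?_⟩
  have hinv : ∀ i, I (play f ⟨D, hD, d, hd1, hd2⟩ i) := by
    intro i
    induction i with
    | zero => exact hI
    | succ i ih => exact hd3 _ (hstep _ ih _ (f.move_adj _) (f.move_compatible _))
  rintro ⟨i, hi⟩
  exact hmet _ (hinv i) hi

theorem FacilitatorWins.not_dividerWins {s t : V} (h : FacilitatorWins G s t k) :
    ¬ DividerWins G s t k := by
  obtain ⟨f, hf⟩ := h
  rintro ⟨d, hd⟩
  exact hd f (hf d)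

/-- A vertex of the walks of an agent: stay put or move to a neighbour. -/
def Step (G : SimpleGraph V) (x y : V) : Prop := x = y ∨ G.Adj x y

theorem Step.refl (x : V) : Step G x x := Or.inl rfl

theorem Step.adj {x y : V} (h : G.Adj x y) : Step G x y := Or.inr h

theorem moveAdj_pair {a b a' b' : V} (ha : Step G a a') (hb : Step G b b') :
    MoveAdj G {a, b} {a', b'} :=
  Multiset.Rel.cons ha (Multiset.Rel.cons hb Multiset.Rel.zero)

theorem moveAdj_pair_left {a b : V} {M : Multiset V} (h : MoveAdj G {a, b} M) :
    ∃ a' b', M = {a', b'} ∧ Step G a a' ∧ Step G b b' := by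
  rw [MoveAdj, Multiset.insert_eq_cons, Multiset.rel_cons_left] at h
  obtain ⟨a', M', ha, hM', rfl⟩ := h
  rw [← Multiset.cons_zero b, Multiset.rel_cons_left] at hM'
  obtain ⟨b', M'', hb, hM'', rfl⟩ := hM'
  rw [Multiset.rel_zero_left] at hM''
  subst hM''
  exact ⟨a', b', rfl, ha, hb⟩

/-- The set of safe placements, with Facilitator's agents named. -/
def SafePair (G : SimpleGraph V) (a b : V) (D : Sym V k) : Prop :=
  ∃ h : Disjoint ({a, b} : Multiset V) (D : Multiset V),
    Safe G (⟨⟨{a, b}, rfl⟩, D, h⟩ : Position V k)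

theorem disjoint_pair {a b : V} {D : Multiset V} :
    Disjoint ({a, b} : Multiset V) D ↔ a ∉ D ∧ b ∉ D := by
  simp [Multiset.insert_eq_cons]

theorem SafePair.left_notMem {a b : V} {D : Sym V k} (h : SafePair G a b D) : a ∉ D :=
  (disjoint_pair.1 h.1).1

theorem SafePair.right_notMem {a b : V} {D : Sym V k} (h : SafePair G a b D) : b ∉ D :=
  (disjoint_pair.1 h.1).2

theorem SafePair.ne {a b : V} {D : Sym V k} (h : SafePair G a b D) : a ≠ b := by
  rintro rfl
  exact h.2.not_met ⟨a, rfl⟩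

theorem SafePair.symm {a b : V} {D : Sym V k} (h : SafePair G a b D) : SafePair G b a D := by
  obtain ⟨h1, h2⟩ := h
  refine ⟨disjoint_pair.2 (disjoint_pair.1 h1).symm, ?_⟩
  have : (⟨{b, a}, rfl⟩ : Sym V 2) = ⟨{a, b}, rfl⟩ := Subtype.ext (Multiset.pair_comm b a)
  have key : ∀ (F F' : Sym V 2) (h : Disjoint (F : Multiset V) D) (h' : Disjoint (F' : Multiset V) D),
      F = F' → Safe G (⟨F', D, h'⟩ : Position V k) → Safe G (⟨F, D, h⟩ : Position V k) := by
    rintro F _ h h' rfl hs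
    exact hs
  exact key _ _ _ _ this h2

theorem SafePair.step [Finite V] {a b a' b' : V} {D : Sym V k} (h : SafePair G a b D)
    (ha : Step G a a') (hb : Step G b b') (ha' : a' ∉ D) (hb' : b' ∉ D) :
    ∃ D' : Sym V k, MoveAdj G (D : Multiset V) (D' : Multiset V) ∧ SafePair G a' b' D' := by
  obtain ⟨h1, h2⟩ := h
  obtain ⟨D', hd, hm, hs⟩ := h2.exists_response ⟨{a', b'}, rfl⟩ (moveAdj_pair ha hb)
    (disjoint_pair.2 ⟨ha', hb'⟩)
  exact ⟨D', hm, hd, hs⟩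

theorem SafePair.not_adj [Finite V] {a b : V} {D : Sym V k} (h : SafePair G a b D) :
    ¬ G.Adj a b := by
  intro hab
  obtain ⟨D', -, hs⟩ := h.step (Step.adj hab) (Step.refl b) h.right_notMem h.right_notMem
  exact hs.ne rfl

theorem facilitatorWins_of_not_safePair {s t : V}
    (h : ∀ D : Sym V k, ¬ SafePair G s t D) : FacilitatorWins G s t k :=
  facilitatorWins_of_winIn fun D hD hs => h D ⟨hD, hs⟩

theorem facilitatorWins_of_eq_or_adj [Finite V] {s t : V} (h : s = t ∨ G.Adj s t) :
    FacilitatorWins G s t k :=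
  facilitatorWins_of_not_safePair fun _ hD => h.elim hD.ne hD.not_adj

/-- Divider wins if he can maintain an invariant, stated with Facilitator's agents named. -/
theorem dividerWins_of_pair_invariant {s t : V} (I : V → V → Multiset V → Prop) (D : Sym V k)
    (hst : I s t D) (hdisj : ∀ a b D, I a b D → a ∉ D ∧ b ∉ D)
    (hne : ∀ a D, ¬ I a a D)
    (hstep : ∀ a b (D : Multiset V), D.card = k → I a b D →
      ∀ a' b', Step G a a' → Step G b b' → a' ∉ D → b' ∉ D →
      ∃ D' : Multiset V, MoveAdj G D D' ∧ I a' b' D') : DividerWins G s t k := by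
  refine dividerWins_of_invariant
    (fun P => ∃ a b, (P.F : Multiset V) = {a, b} ∧ I a b (P.D : Multiset V)) D
    (disjoint_pair.2 (hdisj _ _ _ hst)) ⟨s, t, rfl, hst⟩ ?_ ?_
  · rintro P ⟨a, b, hF, hI⟩ ⟨v, hv⟩
    have hmem : ∀ x ∈ (P.F : Multiset V), x = v := by rw [hv]; simp
    rw [hF] at hmem
    have ha : a = v := hmem a (by simp)
    have hb : b = v := hmem b (by simp)
    subst ha
    subst hb
    exact hne _ _ hI
  · rintro P ⟨a, b, hF, hI⟩ F' hm hd
    rw [hF] at hm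
    obtain ⟨a', b', hF', ha, hb⟩ := moveAdj_pair_left hm
    rw [hF', disjoint_pair] at hd
    obtain ⟨D', hD', hI'⟩ := hstep a b _ P.D.2 hI a' b' ha hb hd.1 hd.2
    have hc : D'.card = k := (Multiset.card_eq_card_of_rel hD').symm.trans P.D.2
    refine ⟨⟨D', hc⟩, ?_, hD', a', b', hF', hI'⟩
    rw [hF', disjoint_pair]
    exact hdisj _ _ _ hI'

/-- Divider wins if some of his agents can maintain an invariant: the others stay put. -/
theorem dividerWins_of_invariant_of_le {s t : V} {l : ℕ} (hl : 0 < l) (hlk : l ≤ k)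
    (I : V → V → Multiset V → Prop) (D : Multiset V) (hD : D.card = l)
    (hst : I s t D) (hdisj : ∀ a b D, I a b D → a ∉ D ∧ b ∉ D)
    (hne : ∀ a D, ¬ I a a D)
    (hstep : ∀ a b (D : Multiset V), D.card = l → I a b D →
      ∀ a' b', Step G a a' → Step G b b' → a' ∉ D → b' ∉ D →
      ∃ D' : Multiset V, MoveAdj G D D' ∧ I a' b' D') : DividerWins G s t k := by
  obtain ⟨x, hx⟩ := Multiset.card_pos_iff_exists_mem.1 (hD ▸ hl)
  -- The `k - l` spare agents, collected in `R`, are parked on a vertex `x` of `D`, which is where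
  -- `0 < l` is needed. They never have to move, since Facilitator cannot enter an occupied vertex.
  refine dividerWins_of_pair_invariant
    (fun a b E => ∃ D R, E = D + R ∧ D.card = l ∧ I a b D ∧ a ∉ R ∧ b ∉ R)
    ⟨D + Multiset.replicate (k - l) x, by simp [hD]; omega⟩
    ⟨D, Multiset.replicate (k - l) x, rfl, hD, hst, ?_, ?_⟩ ?_ ?_ ?_
  · exact fun h => (hdisj _ _ _ hst).1 (Multiset.eq_of_mem_replicate h ▸ hx)
  · exact fun h => (hdisj _ _ _ hst).2 (Multiset.eq_of_mem_replicate h ▸ hx)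
  · rintro a b _ ⟨D, R, rfl, -, hI, ha, hb⟩
    have := hdisj _ _ _ hI
    simp [ha, hb, this]
  · rintro a _ ⟨D, R, rfl, -, hI, ha, hb⟩
    exact hne _ _ hI
  · rintro a b _ - ⟨D, R, rfl, hD, hI, -, -⟩ a' b' ha hb ha' hb'
    simp only [Multiset.mem_add, not_or] at ha' hb'
    obtain ⟨D', hD', hI'⟩ := hstep a b D hD hI a' b' ha hb ha'.1 hb'.1
    exact ⟨D' + R, hD'.add (moveAdj_refl R), D', R, rfl,
      (Multiset.card_eq_card_of_rel hD').symm.trans hD, hI', ha'.2, hb'.2⟩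

end Game

/-! ### One agent of Divider -/

section OneAgent

variable {V : Type*} {G : SimpleGraph V}

/-- The vertices `u` and `v` are joined by a walk that avoids `B`. -/
def Avoid (G : SimpleGraph V) (B : Set V) (u v : V) : Prop :=
  ∃ p : G.Walk u v, ∀ x ∈ p.support, x ∉ B

theorem Avoid.refl {B : Set V} {u : V} (h : u ∉ B) : Avoid G B u u :=
  ⟨.nil, by simpa using h⟩

theorem Avoid.symm {B : Set V} {u v : V} (h : Avoid G B u v) : Avoid G B v u := by
  obtain ⟨p, hp⟩ := h
  exact ⟨p.reverse, by simpa using hp⟩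

theorem Avoid.trans {B : Set V} {u v w : V} (h : Avoid G B u v) (h' : Avoid G B v w) :
    Avoid G B u w := by
  obtain ⟨p, hp⟩ := h
  obtain ⟨q, hq⟩ := h'
  refine ⟨p.append q, fun x hx => ?_⟩
  rw [SimpleGraph.Walk.mem_support_append_iff] at hx
  exact hx.elim (hp x) (hq x)

theorem Avoid.left {B : Set V} {u v : V} (h : Avoid G B u v) : u ∉ B :=
  h.choose_spec _ (SimpleGraph.Walk.start_mem_support _)

theorem Avoid.right {B : Set V} {u v : V} (h : Avoid G B u v) : v ∉ B := h.symm.left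

theorem Avoid.of_adj {B : Set V} {u v : V} (h : G.Adj u v) (hu : u ∉ B) (hv : v ∉ B) :
    Avoid G B u v :=
  ⟨h.toWalk, by simp [hu, hv]⟩

theorem Avoid.of_step {B : Set V} {u v : V} (h : Step G u v) (hu : u ∉ B) (hv : v ∉ B) :
    Avoid G B u v := by
  rcases h with rfl | h
  · exact Avoid.refl hu
  · exact Avoid.of_adj h hu hv

/-- The infinite walk `z` runs around a cycle of length `L`. -/
structure IsCyclic (G : SimpleGraph V) (L : ℕ) (z : ℕ → V) : Prop where
  adj : ∀ i, G.Adj (z i) (z (i + 1))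
  ne : ∀ i j, i < j → j < i + L → z i ≠ z j
  periodic : ∀ i, z (i + L) = z i

theorem IsCyclic.shift {L : ℕ} {z : ℕ → V} (h : IsCyclic G L z) (c : ℕ) :
    IsCyclic G L fun i => z (c + i) :=
  ⟨fun i => h.adj (c + i), fun i j hij hj => h.ne _ _ (by omega) (by omega),
    fun i => by rw [← add_assoc]; exact h.periodic (c + i)⟩

theorem IsCyclic.exists_walk {L : ℕ} {z : ℕ → V} (h : IsCyclic G L z) (n i : ℕ) :
    ∃ p : G.Walk (z i) (z (i + n)), p.length = n ∧
      ∀ x ∈ p.support, ∃ j, i ≤ j ∧ j ≤ i + n ∧ x = z j := by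
  induction n with
  | zero => exact ⟨.nil, rfl, fun x hx => ⟨i, le_rfl, le_rfl, by simpa using hx⟩⟩
  | succ n ih =>
    obtain ⟨p, hp, hs⟩ := ih
    refine ⟨p.concat (h.adj (i + n)), by simp [hp], fun x hx => ?_⟩
    rw [SimpleGraph.Walk.support_concat, List.mem_append, List.mem_singleton] at hx
    rcases hx with hx | rfl
    · obtain ⟨j, h1, h2, h3⟩ := hs x hx
      exact ⟨j, h1, by omega, h3⟩
    · exact ⟨i + n + 1, by omega, by omega, rfl⟩

/-- A path avoiding `v` between two neighbours of `v` closes up to a cycle. -/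
theorem exists_isCyclic_of_isPath {v x y : V} (p : G.Walk x y) (hp : p.IsPath)
    (hv : v ∉ p.support) (hx : G.Adj v x) (hy : G.Adj y v) :
    ∃ z : ℕ → V, IsCyclic G (p.length + 2) z ∧ z 0 = v ∧ ∀ u ∈ p.support, ∃ i, z i = u := by
  set L := p.length + 2 with hL
  have hv' : ∀ i, p.getVert i ≠ v := fun i h => hv (h ▸ p.getVert_mem_support i)
  -- One period of the cycle: `v`, followed by the `p.length + 1` vertices of `p`.
  let y : ℕ → V := fun r => if r = 0 then v else p.getVert (r - 1)
  have hy0 : y 0 = v := rfl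
  have hyS : ∀ r, y (r + 1) = p.getVert r := fun r => rfl
  have hyne : ∀ r r', r < L → r' < L → r ≠ r' → y r ≠ y r' := by
    intro r r' hr hr' hne
    rcases r with _ | r <;> rcases r' with _ | r'
    · exact absurd rfl hne
    · exact fun h => hv' r' h.symm
    · exact fun h => hv' r h
    · rw [hyS, hyS]
      intro h
      have := hp.getVert_injOn (by simp; omega) (by simp; omega) h
      omega
  have hLpos : 0 < L := by omega
  refine ⟨fun i => y (i % L), ⟨fun i => ?_, fun i j hij hj => ?_, fun i => ?_⟩, ?_, ?_⟩
  · have hlt := Nat.mod_lt i hLpos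
    rcases Nat.lt_or_ge (i % L + 1) L with h | h
    · have e : (i + 1) % L = i % L + 1 := by
        rw [Nat.add_mod, Nat.mod_eq_of_lt (show 1 < L by omega), Nat.mod_eq_of_lt h]
      simp only [e]
      generalize i % L = r at *
      rcases r with _ | r
      · simpa [hy0, hyS] using hx
      · rw [hyS, hyS]
        exact p.adj_getVert_succ (by omega)
    · have e : (i + 1) % L = 0 := by
        have : i % L + 1 = L := by omega
        rw [Nat.add_mod, Nat.mod_eq_of_lt (show 1 < L by omega), this, Nat.mod_self]
      have e' : i % L = p.length + 1 := by omega
      simp only [e, e', hy0, hyS, SimpleGraph.Walk.getVert_length]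
      exact hy
  · refine hyne _ _ (Nat.mod_lt _ hLpos) (Nat.mod_lt _ hLpos) fun h => ?_
    have h' : L ∣ j - i := (Nat.modEq_iff_dvd' hij.le).1 h
    exact absurd (Nat.le_of_dvd (by omega) h') (by omega)
  · simp
  · simp [hy0]
  · intro u hu
    obtain ⟨i, hi, hi'⟩ := SimpleGraph.Walk.mem_support_iff_exists_getVert.1 hu
    refine ⟨i + 1, ?_⟩
    simp only [Nat.mod_eq_of_lt (show i + 1 < L by omega), hyS]
    exact hi

/-- `S a b x` is meant to say that Facilitator, with agents at `a` and `b`, to move, cannot force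
a meeting against one agent at `x`. -/
structure IsSafeRel (G : SimpleGraph V) (S : V → V → V → Prop) : Prop where
  symm : ∀ {a b x}, S a b x → S b a x
  ne : ∀ {a b x}, S a b x → a ≠ b
  left : ∀ {a b x}, S a b x → x ≠ a
  step : ∀ {a b x a' b'}, S a b x → Step G a a' → Step G b b' → x ≠ a' → x ≠ b' →
    ∃ x', Step G x x' ∧ S a' b' x'

variable {S : V → V → V → Prop}

theorem IsSafeRel.right (hS : IsSafeRel G S) {a b x : V} (h : S a b x) : x ≠ b :=
  hS.left (hS.symm h)

theorem IsSafeRel.not_adj (hS : IsSafeRel G S) {a b x : V} (h : S a b x) : ¬ G.Adj a b := by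
  intro hab
  obtain ⟨x', -, hs⟩ := hS.step h (Step.adj hab) (Step.refl b) (hS.right h) (hS.right h)
  exact hS.ne hs rfl

/-- While one agent waits at `b`, the other one must not reach a neighbour of `b` faster than
Divider's agent. -/
theorem IsSafeRel.race (hS : IsSafeRel G S) {a b y : V} (p : G.Walk a y) (hb : b ∉ p.support)
    (hy : G.Adj y b) {x : V} (hx : x ≠ b) (h : ∃ x', Step G x x' ∧ S a b x') :
    ∃ q : G.Walk x y, q.length ≤ p.length ∧ b ∉ q.support := by
  induction p generalizing x with
  | nil =>
    obtain ⟨x', -, h⟩ := h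
    exact absurd hy (hS.not_adj h)
  | @cons a a₁ y hadj p ih =>
    obtain ⟨x', hxx, h⟩ := h
    simp only [SimpleGraph.Walk.support_cons, List.mem_cons, not_or] at hb
    have hx' : x' ≠ b := hS.right h
    -- If Divider's agent blocks the next vertex, the rest of `p` is itself the required walk.
    -- Otherwise Facilitator advances and the race goes on from there.
    have hq : ∃ q : G.Walk x' y, q.length ≤ p.length ∧ b ∉ q.support := by
      by_cases hxa : x' = a₁
      · subst hxa
        exact ⟨p, le_rfl, hb.2⟩
      · exact ih hb.2 hy hx' (hS.step h (Step.adj hadj) (Step.refl b) hxa hx')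
    obtain ⟨q, hq1, hq2⟩ := hq
    rcases hxx with rfl | hxx
    · exact ⟨q, by simp; omega, hq2⟩
    · refine ⟨q.cons hxx, by simpa using hq1, ?_⟩
      simp only [SimpleGraph.Walk.support_cons, List.mem_cons, not_or]
      exact ⟨hx.symm, hq2⟩

/-- One agent of Divider loses if Facilitator's agents are on a common cycle. -/
theorem IsSafeRel.not_on_cycle (hS : IsSafeRel G S) (L : ℕ) (hL : 0 < L) (z : ℕ → V)
    (hz : IsCyclic G L z) (i j : ℕ) (x : V) : ¬ S (z i) (z j) x := by
  classical
  -- A shorter cycle carrying both agents is already won. Divider's agent is squeezed at a vertex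
  -- between Facilitator's agents, then forced to leave it for some `w`. To survive this it must
  -- have short walks from `w` to both cycle neighbours of the vertex it left; each closes up to a
  -- shorter cycle, and the two cycles together refute the squeezed position.
  induction L using Nat.strong_induction_on generalizing z i j x with
  | _ L IH =>
  intro hs
  have onpath : ∀ {v x y : V} (p : G.Walk x y), v ∉ p.support → G.Adj v x → G.Adj y v →
      p.IsPath → p.length + 2 < L → ∀ a ∈ p.support, ∀ b ∈ v :: p.support, ∀ d, ¬ S a b d := by
    intro v x y p hv hx hy hp hl a ha b hb d
    obtain ⟨z', hz', h0, hsup⟩ := exists_isCyclic_of_isPath p hp hv hx hy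
    obtain ⟨i, rfl⟩ := hsup a ha
    have : ∃ j, z' j = b := by
      rcases List.mem_cons.1 hb with rfl | hb
      · exact ⟨0, h0⟩
      · exact hsup b hb
    obtain ⟨j, rfl⟩ := this
    exact IH _ hl (by omega) z' hz' i j d
  -- squeeze Divider's agent between Facilitator's agents
  have hex : ∃ k, 0 < k ∧ ∃ c x, S (z c) (z (c + k)) x := by
    rcases lt_trichotomy i j with h | h | h
    · exact ⟨j - i, by omega, i, x, by rwa [Nat.add_sub_cancel' h.le]⟩
    · exact absurd (congrArg z h) (hS.ne hs)
    · exact ⟨i - j, by omega, j, x, by rw [Nat.add_sub_cancel' h.le]; exact hS.symm hs⟩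
  obtain ⟨hk0, c, x, hs⟩ := Nat.find_spec hex
  have hmin := fun m => Nat.find_min hex (m := m)
  set k := Nat.find hex
  -- An arc of length `L` would join a vertex to itself, and a longer one could be shortened by a
  -- full period.
  have hkL : k < L := by
    by_contra hcon
    rcases Nat.eq_or_lt_of_le (not_lt.1 hcon) with h | h
    · exact hS.ne hs (by rw [← h, hz.periodic])
    · refine hmin (k - L) (by omega) ⟨by omega, c, x, ?_⟩
      rw [← hz.periodic (c + (k - L))]
      convert hs using 2
      omega
  have hk1 : k ≠ 1 := by
    intro h
    rw [h] at hs
    exact hS.not_adj hs (hz.adj c)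
  -- By minimality of the arc, neither agent can advance along it. So Divider's agent blocks both
  -- its second and its penultimate vertex, which must coincide: the arc has length two.
  have hx1 : x = z (c + k - 1) := by
    by_contra hne
    have hadj : G.Adj (z (c + k)) (z (c + k - 1)) := by
      have := (hz.adj (c + k - 1)).symm
      rwa [Nat.sub_add_cancel (by omega)] at this
    obtain ⟨x', -, h⟩ := hS.step hs (Step.refl _) (Step.adj hadj) (hS.left hs) hne
    exact hmin (k - 1) (by omega) ⟨by omega, c, x', by rwa [← Nat.add_sub_assoc hk0]⟩
  have hx2 : x = z (c + 1) := by
    by_contra hne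
    obtain ⟨x', -, h⟩ := hS.step hs (Step.adj (hz.adj c)) (Step.refl _) hne (hS.right hs)
    refine hmin (k - 1) (by omega) ⟨by omega, c + 1, x', ?_⟩
    convert h using 2
    omega
  have hk2 : k = 2 := by
    by_contra hne
    exact hz.ne (c + 1) (c + k - 1) (by omega) (by omega) (hx2.symm.trans hx1)
  subst hx2
  rw [hk2] at hs hkL
  clear hmin hx1
  clear_value k
  subst hk2
  -- rename the vertices of the cycle
  have hy := hz.shift c
  set y : ℕ → V := fun i => z (c + i) with hydef
  have hs0 : S (y 0) (y 2) (y 1) := hs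
  have hyL : y L = y 0 := by simpa using hy.periodic 0
  have hyL1 : y (L + 1) = y 1 := by rw [add_comm]; exact hy.periodic 1
  clear_value y
  -- one of Facilitator's agents runs around the cycle until Divider's agent leaves
  have hleave : ∃ k, 2 ≤ k ∧ k + 1 < L ∧ S (y 0) (y k) (y 1) ∧ ¬ S (y 0) (y (k + 1)) (y 1) := by
    by_contra hcon
    push Not at hcon
    have hall : ∀ k, 2 ≤ k → k < L → S (y 0) (y k) (y 1) := by
      intro k hk
      induction k, hk using Nat.le_induction with
      | base => exact fun _ => hs0
      | succ k hk ih => exact fun hkL => hcon k hk hkL (ih (by omega))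
    refine hS.not_adj (hall (L - 1) (by omega) (by omega)) ?_
    have := (hy.adj (L - 1)).symm
    rwa [Nat.sub_add_cancel hL, hyL] at this
  obtain ⟨k, hk2, hk1L, hsk, hnsk⟩ := hleave
  obtain ⟨w, hw, hsw⟩ := hS.step hsk (Step.refl _) (Step.adj (hy.adj k)) (hS.left hsk)
    (hy.ne 1 (k + 1) (by omega) (by omega))
  have hw1 : w ≠ y 1 := by rintro rfl; exact hnsk hsw
  have hwadj : G.Adj (y 1) w := hw.resolve_left hw1.symm
  -- The agent from `y 0` takes the vacated `y 1` and waits there. The other one, at `y (k + 1)`,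
  -- threatens both neighbours `y 2` and `y 0` of `y 1`, so Divider's agent must win both races.
  have hresp := hS.step (hS.symm hsw) (Step.refl _) (Step.adj (hy.adj 0)) (hS.right hsw) hw1
  -- the short paths from `w`
  obtain ⟨p₂, hp₂, hp₂s⟩ := hy.exists_walk (k - 1) 2
  obtain ⟨q₂, hq₂, hq₂s⟩ := hS.race (p₂.reverse.copy (by congr 1; omega) rfl)
    (by
      simp only [SimpleGraph.Walk.support_copy, SimpleGraph.Walk.support_reverse, List.mem_reverse]
      intro h
      obtain ⟨j, hj1, hj2, hj⟩ := hp₂s _ h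
      exact hy.ne 1 j (by omega) (by omega) hj) (hy.adj 1).symm hw1 hresp
  obtain ⟨p₀, hp₀, hp₀s⟩ := hy.exists_walk (L - k - 1) (k + 1)
  obtain ⟨q₀, hq₀, hq₀s⟩ := hS.race (p₀.copy rfl (show _ = y 0 by rw [← hyL]; congr 1; omega))
    (by
      simp only [SimpleGraph.Walk.support_copy]
      intro h
      obtain ⟨j, hj1, hj2, hj⟩ := hp₀s _ h
      exact hy.ne 1 j (by omega) (by omega) hj) (hy.adj 0) hw1 hresp
  simp only [SimpleGraph.Walk.length_copy, SimpleGraph.Walk.length_reverse, hp₂, hp₀] at hq₂ hq₀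
  -- Closed up through `y 1`, the two paths give cycles of length at most `k + 1` and `L - k + 1`;
  -- both are below `L` because `2 ≤ k` and `k + 1 < L`.
  have hb₂ := onpath q₂.bypass (fun h => hq₂s (q₂.support_bypass_subset_support h)) hwadj
    (hy.adj 1).symm q₂.bypass_isPath (by have := q₂.length_bypass_le_length; omega)
  have hb₀ := onpath q₀.bypass (fun h => hq₀s (q₀.support_bypass_subset_support h)) hwadj
    (hy.adj 0) q₀.bypass_isPath (by have := q₀.length_bypass_le_length; omega)
  -- the agent at `y 0` walks to `w`, Divider's agent being pinned
  have hpin : ∀ (u u' : V) (r : G.Walk u u'), (∀ v ∈ r.support, v ∈ q₀.bypass.support) →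
      S u (y 2) (y 1) → S u' (y 2) (y 1) := by
    intro u u' r
    induction r with
    | nil => exact fun _ h => h
    | @cons u u₁ u' hadj r ih =>
      intro hr h
      have hu₁ : u₁ ∈ q₀.bypass.support := hr _ (by simp)
      refine ih (fun v hv => hr v (by simp [hv])) ?_
      have hne : y 1 ≠ u₁ := by
        rintro rfl
        exact hq₀s (q₀.support_bypass_subset_support hu₁)
      obtain ⟨x', hx', hs'⟩ := hS.step h (Step.adj hadj) (Step.refl _) hne (hS.right h)
      -- If Divider's agent leaves `y 1`, the agent at `y 2` steps onto it, and both of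
      -- Facilitator's agents are on the shorter cycle through `q₀`.
      by_cases hxy : x' = y 1
      · rwa [← hxy]
      · obtain ⟨x'', -, hs''⟩ := hS.step hs' (Step.refl _) (Step.adj (hy.adj 1).symm)
          (hS.left hs') hxy
        exact absurd hs'' (hb₀ u₁ hu₁ (y 1) (by simp) x'')
  have hfin := hpin _ _ q₀.bypass.reverse (by simp) hs0
  -- Once the walker has reached `w`, her agents at `w` and `y 2` are on the shorter cycle through
  -- `q₂`.
  exact hb₂ w (by simp) (y 2) (by simp) _ hfin

/-- One agent of Divider loses if no single vertex separates Facilitator's agents. -/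
theorem IsSafeRel.exists_separating (hS : IsSafeRel G S) {a b x : V} (h : S a b x) :
    ∃ v, v ≠ a ∧ v ≠ b ∧ ¬ Avoid G {v} a b := by
  classical
  by_contra hcon
  push Not at hcon
  obtain ⟨p, -⟩ := hcon x (hS.left h) (hS.right h)
  suffices H : ∀ n, ∀ {a b x : V} (p : G.Walk a b), p.IsPath → p.length = n →
      (∀ v, v ≠ a → v ≠ b → Avoid G {v} a b) → ¬ S a b x from
    H _ p.bypass p.bypass_isPath rfl hcon h
  intro n
  induction n with
  | zero =>
    intro a b x p _ hl _ h
    exact hS.ne h (SimpleGraph.Walk.eq_of_length_eq_zero hl)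
  | succ n ih =>
    -- Unless Divider's agent occupies the next vertex `a₁` of the path, Facilitator advances to it.
    -- No vertex separates `a₁` from `b`: the rest of the path avoids `a`, and any other vertex is
    -- bypassed by way of `a`.
    have adv : ∀ {a b x : V} (p : G.Walk a b), p.IsPath → p.length = n + 1 →
        (∀ v, v ≠ a → v ≠ b → Avoid G {v} a b) → S a b x → G.Adj a x := by
      intro a b x p hp hl hun h
      cases p with
      | nil => simp at hl
      | @cons _ a₁ _ hadj p =>
        by_cases hx : x = a₁
        · rwa [hx]
        · rw [SimpleGraph.Walk.cons_isPath_iff] at hp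
          obtain ⟨x', -, hs⟩ := hS.step h (Step.adj hadj) (Step.refl b) hx (hS.right h)
          refine absurd hs (ih p hp.1 (by simpa using hl) fun v hv1 hvb => ?_)
          by_cases hva : v = a
          · subst hva
            exact ⟨p, fun u hu hua => hp.2 (hua ▸ hu)⟩
          · exact (Avoid.of_adj hadj.symm (by simpa using hv1.symm) (by simpa using Ne.symm hva)).trans
              (hun v hva hvb)
    intro a b x p hp hl hun h
    have hax := adv p hp hl hun h
    have hbx := adv p.reverse hp.reverse (by simpa using hl)
      (fun v h1 h2 => (hun v h2 h1).symm) (hS.symm h)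
    -- Now `x` is adjacent to both `a` and `b` and does not separate them, so an `a`–`b` path
    -- avoiding `x` closes up through `x` to a cycle.
    obtain ⟨q, hq⟩ := hun x (hS.left h) (hS.right h)
    obtain ⟨z, hz, -, hsup⟩ := exists_isCyclic_of_isPath q.bypass q.bypass_isPath
      (fun hx => hq x (q.support_bypass_subset_support hx) rfl) hax.symm hbx
    obtain ⟨i, rfl⟩ := hsup a (by simp)
    obtain ⟨j, rfl⟩ := hsup b (by simp)
    exact hS.not_on_cycle _ (by omega) z hz i j x h

theorem facilitatorWins_one [Finite V] {s t : V}
    (h : ∀ v, v ≠ s → v ≠ t → Avoid G {v} s t) : FacilitatorWins G s t 1 := by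
  let one : V → Sym V 1 := fun x => ⟨{x}, rfl⟩
  have hone : ∀ D : Sym V 1, ∃ x, D = one x := fun D => by
    obtain ⟨x, hx⟩ := Multiset.card_eq_one.1 D.2
    exact ⟨x, Subtype.ext hx⟩
  have hmem : ∀ x y, x ∉ one y ↔ y ≠ x := fun x y => by
    have : x ∈ one y ↔ x = y := Multiset.mem_singleton
    rw [this, eq_comm]
  have hS : IsSafeRel G fun a b x => SafePair G a b (one x) :=
    { symm := SafePair.symm
      ne := SafePair.ne
      left := fun h => (hmem _ _).1 h.left_notMem
      step := by
        intro a b x a' b' h ha hb ha' hb'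
        obtain ⟨D', hm, hs⟩ := h.step ha hb ((hmem _ _).2 ha') ((hmem _ _).2 hb')
        obtain ⟨x', rfl⟩ := hone D'
        refine ⟨x', ?_, hs⟩
        have : Multiset.Rel (fun x y => x = y ∨ G.Adj x y) {x} {x'} := hm
        simpa [Step, Multiset.rel_cons_left, Multiset.rel_zero_left, ← Multiset.cons_zero] using this }
  refine facilitatorWins_of_not_safePair fun D hD => ?_
  obtain ⟨x, rfl⟩ := hone D
  obtain ⟨v, h1, h2, h3⟩ := hS.exists_separating hD
  exact h3 (h v h1 h2)

end OneAgent

/-! ### Components between Facilitator's agents -/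

section Components

variable {V : Type*} {G : SimpleGraph V} {k : ℕ}

/-- While one agent of Facilitator waits at `t`, the other one runs along a walk that no agent of
Divider can reach in time. -/
theorem not_safePair_of_walk [Finite V] {a t : V} (q : G.Walk a t) (D : Sym V k)
    (h : ∀ x ∈ D, ∀ i < q.length, ∀ p : G.Walk x (q.getVert i), t ∉ p.support → i ≤ p.length) :
    ¬ SafePair G a t D := by
  induction q generalizing D with
  | nil => exact fun hs => hs.ne rfl
  | @cons a a₁ t hadj q ih =>
    intro hs
    have hne : a₁ ≠ t := by rintro rfl; exact hs.not_adj hadj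
    -- The trivial walk of an agent at `a₁` would violate the bound for `i = 1`. Facilitator moves
    -- first, so a Divider agent at distance exactly `i` from the `i`-th vertex arrives too late;
    -- this is why a weak inequality is enough.
    have ha₁ : a₁ ∉ D := by
      intro hmem
      have hq : q.length ≠ 0 := fun h0 => hne (SimpleGraph.Walk.eq_of_length_eq_zero h0)
      have h1 : ∀ y, (q.cons hadj).getVert 1 = y → ∀ p : G.Walk a₁ y, t ∉ p.support →
          1 ≤ p.length := by
        rintro _ rfl
        exact h a₁ hmem 1 (by simp; omega)
      have := h1 a₁ (by simp) .nil (by simpa using hne.symm)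
      simp at this
    obtain ⟨D', hm, hs'⟩ := hs.step (Step.adj hadj) (Step.refl t) ha₁ hs.right_notMem
    refine ih D' (fun x' hx' i hi p hp => ?_) hs'
    obtain ⟨x, hx, hxx⟩ := Multiset.exists_mem_of_rel_of_mem (Multiset.rel_flip.2 hm) hx'
    have hxt : x ≠ t := by rintro rfl; exact hs.right_notMem hx
    rcases (hxx : x = x' ∨ G.Adj x x') with rfl | hxx
    · exact (Nat.le_succ i).trans (h x hx (i + 1) (by simpa using hi) p hp)
    · have := h x hx (i + 1) (by simpa using hi) (p.cons hxx) (by simpa using ⟨hxt.symm, hp⟩)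
      simpa using this

theorem facilitatorWins_zero [Finite V] {s t : V} (h : G.Reachable s t) :
    FacilitatorWins G s t 0 := by
  obtain ⟨q⟩ := h
  refine facilitatorWins_of_not_safePair fun D => not_safePair_of_walk q D fun x hx => ?_
  rw [Sym.eq_nil_of_card_zero D] at hx
  exact absurd hx (Sym.notMem_nil x)

/-- The component of `v` in `G - {s, t}` is attached to both `s` and `t`. -/
def IsFull (G : SimpleGraph V) (s t v : V) : Prop :=
  (∃ u, Avoid G {s, t} v u ∧ G.Adj u s) ∧ ∃ u, Avoid G {s, t} v u ∧ G.Adj u t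

/-- The components of `G - {s, t}` that are attached to both `s` and `t`. -/
def fullComponents (G : SimpleGraph V) (s t : V) : Set (Set V) :=
  {C | ∃ v, IsFull G s t v ∧ C = {u | Avoid G {s, t} v u}}

/-- The run is along a shortest `s`–`t` walk with all other vertices in the component. Divider's
agents start outside and cannot pass `t`, so they can enter only through `s`; arriving early would
give a shortcut from `s`. -/
theorem IsFull.not_safePair [Finite V] {s t v : V} (hv : IsFull G s t v) {D : Sym V k}
    (hD : ∀ x ∈ D, ¬ Avoid G {s, t} v x) : ¬ SafePair G s t D := by
  classical
  intro hs
  have hex : ∃ n, ∃ q : G.Walk s t, q.length = n ∧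
      ∀ x ∈ q.support, x = s ∨ x = t ∨ Avoid G {s, t} v x := by
    obtain ⟨⟨u, hvu, hus⟩, w, hvw, hwt⟩ := hv
    obtain ⟨p, hp⟩ := hvu.symm.trans hvw
    refine ⟨_, (p.concat hwt).cons hus.symm, rfl, fun x hx => ?_⟩
    rw [SimpleGraph.Walk.support_cons, SimpleGraph.Walk.support_concat, List.mem_cons,
      List.mem_append, List.mem_singleton] at hx
    rcases hx with rfl | hx | rfl
    · exact Or.inl rfl
    · exact Or.inr (Or.inr (hvu.trans
        ⟨p.takeUntil x hx, fun y hy => hp y (p.support_takeUntil_subset_support hx hy)⟩))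
    · exact Or.inr (Or.inl rfl)
  obtain ⟨q, hqn, hq⟩ := Nat.find_spec hex
  have hmin : ∀ r : G.Walk s t, (∀ x ∈ r.support, x = s ∨ x = t ∨ Avoid G {s, t} v x) →
      q.length ≤ r.length := fun r hr => hqn ▸ Nat.find_min' hex ⟨r, rfl, hr⟩
  refine not_safePair_of_walk q D (fun x hx i hi => ?_) hs
  suffices H : ∀ y, q.getVert i = y → ∀ p : G.Walk x y, t ∉ p.support → i ≤ p.length from
    H _ rfl
  intro y hqy p hp
  by_contra! hlt
  have hdrop : ∀ y ∈ (q.drop i).support, y = s ∨ y = t ∨ Avoid G {s, t} v y := fun y hy =>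
    hq y ((q.isSubwalk_drop i).support_subset hy)
  have hi0 : q.getVert i ≠ s := by
    intro h
    have := hmin ((q.drop i).copy h rfl) (by simpa using hdrop)
    simp at this
    omega
  rw [hqy] at hi0
  have hvi : Avoid G {s, t} v y :=
    ((hq _ (hqy ▸ q.getVert_mem_support i)).resolve_left hi0).resolve_left
      fun h => hp (h ▸ p.end_mem_support)
  -- A walk missing both `s` and `t` would place the agent's starting vertex in the component.
  have hsp : s ∈ p.support := by
    by_contra hsp
    refine hD x hx (hvi.trans (Avoid.symm ⟨p, fun y hy hyst => ?_⟩))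
    rcases hyst with rfl | rfl
    · exact hsp hy
    · exact hp hy
  -- The part of the intruder's walk from `s` on, made a path, does not return to `s` and so stays
  -- in the component. Followed by the rest of `q` it would beat the shortest walk.
  have key : ∃ r : G.Walk s y, r.length ≤ p.length ∧
      ∀ y ∈ r.support, y = s ∨ Avoid G {s, t} v y := by
    have hsub : (p.dropUntil s hsp).bypass.support ⊆ p.support := fun y hy =>
      p.support_dropUntil_subset_support hsp
        ((p.dropUntil s hsp).support_bypass_subset_support hy)
    have hlen : (p.dropUntil s hsp).bypass.length ≤ p.length :=
      ((p.dropUntil s hsp).length_bypass_le_length).trans (p.length_dropUntil_le_length hsp)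
    have hpath := (p.dropUntil s hsp).bypass_isPath
    generalize (p.dropUntil s hsp).bypass = r at *
    refine ⟨r, hlen, fun y hy => ?_⟩
    by_cases hys : y = s
    · exact Or.inl hys
    · right
      cases r with
      | nil => exact absurd rfl hi0
      | cons hadj r =>
        rw [SimpleGraph.Walk.cons_isPath_iff] at hpath
        rw [SimpleGraph.Walk.support_cons, List.mem_cons] at hy
        have hy := hy.resolve_left hys
        refine hvi.trans (Avoid.symm ⟨r.dropUntil y hy, fun z hz hzst => ?_⟩)
        have hzr := r.support_dropUntil_subset_support hy hz
        rcases hzst with rfl | rfl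
        · exact hpath.2 hzr
        · exact hp (hsub (by simp [hzr]))
  obtain ⟨r, hr, hrs⟩ := key
  have := hmin (r.append ((q.drop i).copy hqy rfl)) (fun y hy => by
    rw [SimpleGraph.Walk.mem_support_append_iff] at hy
    rcases hy with hy | hy
    · exact (hrs y hy).imp_right Or.inr
    · exact hdrop y (by simpa using hy))
  simp at this
  omega

/-- Pigeonhole: `k` agents meet at most `k` components, so some attached component contains none of
them. -/
theorem facilitatorWins_of_lt_ncard [Finite V] {s t : V} (h : k < (fullComponents G s t).ncard) :
    FacilitatorWins G s t k := by
  classical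
  refine facilitatorWins_of_not_safePair fun D => ?_
  have hcard : ((D : Multiset V).toFinset.image fun x => {u | Avoid G {s, t} x u}).card ≤ k :=
    (Finset.card_image_le.trans (Multiset.toFinset_card_le _)).trans D.2.le
  have hnot : ¬ fullComponents G s t ⊆
      ((D : Multiset V).toFinset.image fun x => {u | Avoid G {s, t} x u} : Finset (Set V)) := by
    intro hsub
    have := Set.ncard_le_ncard hsub (Finset.finite_toSet _)
    rw [Set.ncard_coe_finset] at this
    omega
  obtain ⟨_, ⟨v, hv, rfl⟩, hC⟩ := Set.not_subset.1 hnot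
  refine hv.not_safePair fun x hx hvx => hC ?_
  simp only [Finset.coe_image, Set.mem_image]
  refine ⟨x, by simpa using hx, Set.ext fun u => ⟨hvx.trans, hvx.symm.trans⟩⟩

/-- The agents stand still on `S`, and Facilitator's agents stay on the sides of `s` and `t` in `G -
S`. -/
theorem IsSeparator.dividerWins {s t : V} {S : Finset V} (hS : IsSeparator G s t S)
    (hne : S.Nonempty) (hk : S.card ≤ k) : DividerWins G s t k := by
  obtain ⟨hs, ht, hsep⟩ := hS
  refine dividerWins_of_invariant_of_le hne.card_pos hk
    (fun a b D => D = S.val ∧ Avoid G S s a ∧ Avoid G S t b) S.val rfl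
    ⟨rfl, Avoid.refl hs, Avoid.refl ht⟩ ?_ ?_ ?_
  · rintro a b _ ⟨rfl, ha, hb⟩
    exact ⟨ha.right, hb.right⟩
  · rintro a _ ⟨rfl, ha, hb⟩
    obtain ⟨p, hp⟩ := ha.trans hb.symm
    obtain ⟨v, hv, hvS⟩ := hsep p
    exact hp v hv hvS
  · rintro a b _ - ⟨rfl, ha, hb⟩ a' b' haa hbb ha' hb'
    exact ⟨S.val, moveAdj_refl _, rfl, ha.trans (Avoid.of_step haa ha.right ha'),
      hb.trans (Avoid.of_step hbb hb.right hb')⟩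

end Components

/-! ### Separators in graphs of treewidth at most two -/

/-- Three pairwise intersecting subtrees of a tree have a common node. -/
theorem helly_three {N : Type*} {T : SimpleGraph N} (hconn : T.Preconnected) {A B C : Set N}
    (hA : ∀ i ∈ A, ∀ j ∈ A, ∀ r : T.Walk i j, r.IsPath → ∀ x ∈ r.support, x ∈ A)
    (hB : ∀ i ∈ B, ∀ j ∈ B, ∀ r : T.Walk i j, r.IsPath → ∀ x ∈ r.support, x ∈ B)
    (hC : ∀ i ∈ C, ∀ j ∈ C, ∀ r : T.Walk i j, r.IsPath → ∀ x ∈ r.support, x ∈ C)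
    (hAB : (A ∩ B).Nonempty) (hAC : (A ∩ C).Nonempty) (hBC : (B ∩ C).Nonempty) :
    (A ∩ B ∩ C).Nonempty := by
  classical
  -- Starting in `A` outside `C`, one step towards `C` stays in `A`: continue to `c` and then inside
  -- `C` to a node of `A ∩ C`. This avoids `i`, so it shortens to a path between nodes of `A` that
  -- begins with this step. Applied to `A` and `B` at once, it moves a common node along until it
  -- lies in `C`.
  have aux : ∀ A : Set N, (∀ i ∈ A, ∀ j ∈ A, ∀ r : T.Walk i j, r.IsPath → ∀ x ∈ r.support, x ∈ A) →
      (A ∩ C).Nonempty → ∀ i j c (h : T.Adj i j) (r : T.Walk j c), (r.cons h).IsPath → i ∈ A →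
      i ∉ C → c ∈ C → j ∈ A := by
    rintro A hA ⟨a, haA, haC⟩ i j c h r hr hiA hiC hc
    obtain ⟨r₂⟩ := hconn c a
    rw [SimpleGraph.Walk.cons_isPath_iff] at hr
    have hi : i ∉ (r.append r₂.bypass).bypass.support := fun hi => by
      have := SimpleGraph.Walk.support_bypass_subset_support _ hi
      rw [SimpleGraph.Walk.mem_support_append_iff] at this
      exact this.elim hr.2 fun h => hiC (hC c hc a haC _ r₂.bypass_isPath i h)
    exact hA i hiA a haA ((r.append r₂.bypass).bypass.cons h)
      ((SimpleGraph.Walk.bypass_isPath _).cons hi) j (by simp)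
  obtain ⟨i, hiA, hiB⟩ := hAB
  obtain ⟨c, -, hc⟩ := id hAC
  obtain ⟨r⟩ := hconn i c
  suffices H : ∀ n i (r : T.Walk i c), r.IsPath → r.length = n → i ∈ A → i ∈ B →
      (A ∩ B ∩ C).Nonempty from H _ i r.bypass r.bypass_isPath rfl hiA hiB
  intro n
  induction n with
  | zero =>
    intro i r _ hl hiA hiB
    exact ⟨i, ⟨hiA, hiB⟩, SimpleGraph.Walk.eq_of_length_eq_zero hl ▸ hc⟩
  | succ n ih =>
    intro i r hr hl hiA hiB
    by_cases hiC : i ∈ C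
    · exact ⟨i, ⟨hiA, hiB⟩, hiC⟩
    cases r with
    | nil => simp at hl
    | @cons _ j _ h r =>
      exact ih j r hr.of_cons (by simpa using hl) (aux A hA hAC i j c h r hr hiA hiC hc)
        (aux B hB hBC i j c h r hr hiB hiC hc)

namespace TreeDecomposition

variable {V : Type*} {G : SimpleGraph V}

theorem exists_walk_of_mem (T : TreeDecomposition G) {u : V} {i j : Fin T.m} (hi : u ∈ T.bag i)
    (hj : u ∈ T.bag j) : ∃ p : T.tree.Walk i j, ∀ x ∈ p.support, u ∈ T.bag x := by
  obtain ⟨p⟩ := (T.connected u).preconnected ⟨i, hi⟩ ⟨j, hj⟩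
  refine ⟨p.map (SimpleGraph.Embedding.induce _).toHom, fun x hx => ?_⟩
  have hx' : x ∈ (p.map (SimpleGraph.Embedding.induce _).toHom).support := hx
  rw [SimpleGraph.Walk.support_map, List.mem_map] at hx'
  obtain ⟨y, -, rfl⟩ := hx'
  exact y.2

/-- Concatenate walks inside the subtrees of the successive vertices of `q`, changing subtree at a
bag that covers the edge. Each tree edge used then lies in the subtree of a single vertex of `q`. -/
theorem exists_walk_of_walk (T : TreeDecomposition G) {u w : V} (q : G.Walk u w) {i j : Fin T.m}
    (hi : u ∈ T.bag i) (hj : w ∈ T.bag j) : ∃ p : T.tree.Walk i j,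
      (∀ d ∈ p.darts, ∃ v ∈ q.support, v ∈ T.bag d.fst ∧ v ∈ T.bag d.snd) ∧
      ∀ x ∈ p.support, ∃ v ∈ q.support, v ∈ T.bag x := by
  induction q generalizing i with
  | @nil u =>
    obtain ⟨p, hp⟩ := T.exists_walk_of_mem hi hj
    exact ⟨p, fun d hd => ⟨u, by simp, hp _ (p.dart_fst_mem_support_of_mem_darts hd),
      hp _ (p.dart_snd_mem_support_of_mem_darts hd)⟩, fun x hx => ⟨u, by simp, hp x hx⟩⟩
  | @cons u u₁ w h q ih =>
    obtain ⟨l, hl, hl₁⟩ := T.edge_covered u u₁ h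
    obtain ⟨p, hp⟩ := T.exists_walk_of_mem hi hl
    obtain ⟨p', hp', hps'⟩ := ih hl₁ hj
    refine ⟨p.append p', fun d hd => ?_, fun x hx => ?_⟩
    · rw [SimpleGraph.Walk.darts_append, List.mem_append] at hd
      rcases hd with hd | hd
      · exact ⟨u, by simp, hp _ (p.dart_fst_mem_support_of_mem_darts hd),
          hp _ (p.dart_snd_mem_support_of_mem_darts hd)⟩
      · obtain ⟨v, hv, hv'⟩ := hp' d hd
        exact ⟨v, by simp [hv], hv'⟩
    · rw [SimpleGraph.Walk.mem_support_append_iff] at hx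
      rcases hx with hx | hx
      · exact ⟨u, by simp, hp x hx⟩
      · obtain ⟨v, hv, hv'⟩ := hps' x hx
        exact ⟨v, by simp [hv], hv'⟩

/-- Tree paths are unique, so `r` is a shortcut of the walk lifted from `q`. Hence every adhesion
set along `r` meets `q`. -/
theorem darts_of_isPath (T : TreeDecomposition G) {u w : V} (q : G.Walk u w) {i j : Fin T.m}
    (hi : u ∈ T.bag i) (hj : w ∈ T.bag j) (r : T.tree.Walk i j) (hr : r.IsPath) :
    ∀ d ∈ r.darts, ∃ v ∈ q.support, v ∈ T.bag d.fst ∧ v ∈ T.bag d.snd := by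
  classical
  obtain ⟨p, hp, -⟩ := T.exists_walk_of_walk q hi hj
  have : r = p.bypass := congrArg Subtype.val
    ((T.isTree.isAcyclic.subsingleton_path i j).elim ⟨r, hr⟩ ⟨p.bypass, p.bypass_isPath⟩)
  exact fun d hd => hp d (p.darts_bypass_subset_darts (this ▸ hd))

theorem support_of_isPath (T : TreeDecomposition G) {u w : V} (q : G.Walk u w) {i j : Fin T.m}
    (hi : u ∈ T.bag i) (hj : w ∈ T.bag j) (r : T.tree.Walk i j) (hr : r.IsPath) :
    ∀ x ∈ r.support, ∃ v ∈ q.support, v ∈ T.bag x := by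
  classical
  obtain ⟨p, -, hp⟩ := T.exists_walk_of_walk q hi hj
  have : r = p.bypass := congrArg Subtype.val
    ((T.isTree.isAcyclic.subsingleton_path i j).elim ⟨r, hr⟩ ⟨p.bypass, p.bypass_isPath⟩)
  exact fun x hx => hp x (p.support_bypass_subset_support (this ▸ hx))

theorem mem_bag_of_isPath (T : TreeDecomposition G) {u : V} {i j : Fin T.m}
    (hi : u ∈ T.bag i) (hj : u ∈ T.bag j) (r : T.tree.Walk i j) (hr : r.IsPath) :
    ∀ x ∈ r.support, u ∈ T.bag x := fun x hx => by
  obtain ⟨v, hv, hvx⟩ := T.support_of_isPath (.nil : G.Walk u u) hi hj r hr x hx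
  rw [SimpleGraph.Walk.support_nil, List.mem_singleton] at hv
  exact hv ▸ hvx

variable (T : TreeDecomposition G) {s t : V}

/-- Vertices in no common bag are separated by an adhesion set. -/
theorem exists_isSeparator_of_no_common_bag {w : ℕ} (hw : ∀ i, (T.bag i).card ≤ w + 1)
    (hst : ∀ i, s ∈ T.bag i → t ∉ T.bag i) : ∃ S, IsSeparator G s t S ∧ S.card ≤ w := by
  classical
  obtain ⟨i, hi⟩ := T.vertex_covered s
  obtain ⟨j, hj⟩ := T.vertex_covered t
  obtain ⟨r⟩ := T.isTree.connected.preconnected i j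
  -- The separator comes from the tree edge where the path leaves the subtree of `s`. The adhesion
  -- set misses `s`, which also saves one from the bag size, and misses `t`, since the first bag
  -- contains `s`.
  obtain ⟨d, hd, hd1, hd2⟩ := r.bypass.exists_boundary_dart {l | s ∈ T.bag l} hi
    (fun h => hst j h hj)
  refine ⟨T.bag d.fst ∩ T.bag d.snd, ⟨?_, ?_, fun p => ?_⟩, ?_⟩
  · exact fun h => hd2 (Finset.mem_inter.1 h).2
  · exact fun h => hst _ hd1 (Finset.mem_inter.1 h).1
  · obtain ⟨v, hv, hv'⟩ := T.darts_of_isPath p hi hj _ r.bypass_isPath d hd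
    exact ⟨v, hv, Finset.mem_inter.2 hv'⟩
  · have hsub : T.bag d.fst ∩ T.bag d.snd ⊆ (T.bag d.fst).erase s := fun v hv =>
      Finset.mem_erase.2 ⟨fun h => hd2 (h ▸ (Finset.mem_inter.1 hv).2), (Finset.mem_inter.1 hv).1⟩
    have h1 := Finset.card_le_card hsub
    rw [Finset.card_erase_of_mem hd1] at h1
    have := hw d.fst
    omega

/-- The subtrees of `s`, of `t` and of the walk `q` intersect pairwise: in `i₀` and in bags covering
the edges at the two ends. The Helly property gives a common node. -/
theorem exists_mem_bag_of_walk {i₀ : Fin T.m} (hs : s ∈ T.bag i₀) (ht : t ∈ T.bag i₀) {u w : V}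
    (q : G.Walk u w) (hu : G.Adj u s) (hw : G.Adj w t) :
    ∃ v ∈ q.support, ∃ i, s ∈ T.bag i ∧ t ∈ T.bag i ∧ v ∈ T.bag i := by
  classical
  obtain ⟨i, ⟨hi1, hi2⟩, v, hv, hi3⟩ := helly_three T.isTree.connected.preconnected
    (A := {i | s ∈ T.bag i}) (B := {i | t ∈ T.bag i}) (C := {i | ∃ v ∈ q.support, v ∈ T.bag i})
    (fun i hi j hj r hr => T.mem_bag_of_isPath hi hj r hr)
    (fun i hi j hj r hr => T.mem_bag_of_isPath hi hj r hr)
    (by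
      rintro i ⟨v, hv, hi⟩ j ⟨v', hv', hj⟩ r hr x hx
      obtain ⟨y, hy, hyx⟩ := T.support_of_isPath
        ((q.takeUntil v hv).reverse.append (q.takeUntil v' hv')) hi hj r hr x hx
      refine ⟨y, ?_, hyx⟩
      rw [SimpleGraph.Walk.mem_support_append_iff, SimpleGraph.Walk.support_reverse,
        List.mem_reverse] at hy
      exact hy.elim (fun h => q.support_takeUntil_subset_support _ h)
        fun h => q.support_takeUntil_subset_support _ h)
    ⟨i₀, hs, ht⟩
    (by
      obtain ⟨i, h1, h2⟩ := T.edge_covered u s hu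
      exact ⟨i, h2, u, by simp, h1⟩)
    (by
      obtain ⟨i, h1, h2⟩ := T.edge_covered w t hw
      exact ⟨i, h2, w, by simp, h1⟩)
  exact ⟨v, hv, i, hi1, hi2, hi3⟩

theorem eq_of_mem_bag (hcard : ∀ i, (T.bag i).card ≤ 3) (hst : s ≠ t) {i : Fin T.m} {x y : V}
    (hs : s ∈ T.bag i) (ht : t ∈ T.bag i) (hx : x ∈ T.bag i) (hy : y ∈ T.bag i)
    (hx' : x ∉ ({s, t} : Set V)) (hy' : y ∉ ({s, t} : Set V)) : x = y := by
  classical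
  by_contra hne
  simp only [Set.mem_insert_iff, Set.mem_singleton_iff, not_or] at hx' hy'
  have hsub : ({x, y, s, t} : Finset V) ⊆ T.bag i := by
    intro z hz
    simp only [Finset.mem_insert, Finset.mem_singleton] at hz
    rcases hz with rfl | rfl | rfl | rfl <;> assumption
  have h4 : ({x, y, s, t} : Finset V).card = 4 := by
    rw [Finset.card_insert_of_notMem (by simp [hne, hx']),
      Finset.card_insert_of_notMem (by simp [hy']), Finset.card_pair hst]
  have := (Finset.card_le_card hsub).trans (hcard i)
  omega

/-- Each component of `G - {s, t}` has at most one vertex in a common bag with `s` and `t`. -/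
theorem eq_of_avoid (hcard : ∀ i, (T.bag i).card ≤ 3) (hst : s ≠ t) {i j : Fin T.m} {x y : V}
    (hi : s ∈ T.bag i ∧ t ∈ T.bag i ∧ x ∈ T.bag i) (hj : s ∈ T.bag j ∧ t ∈ T.bag j ∧ y ∈ T.bag j)
    (hxy : Avoid G {s, t} x y) : x = y := by
  classical
  have hx' := hxy.left
  obtain ⟨q, hq⟩ := hxy
  obtain ⟨r⟩ := T.isTree.connected.preconnected i j
  have hpath := r.bypass_isPath
  have hd := T.darts_of_isPath q hi.2.2 hj.2.2 _ hpath
  have hs := T.mem_bag_of_isPath hi.1 hj.1 _ hpath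
  have ht := T.mem_bag_of_isPath hi.2.1 hj.2.1 _ hpath
  generalize r.bypass = p at hd hs ht
  clear hpath r
  -- All bags on the tree path contain `s` and `t`, and consecutive ones share a further vertex, on
  -- `q`. With three places per bag this vertex is always `x`, which is thus carried along to `j`.
  have hxj : x ∈ T.bag j := by
    have hxi := hi.2.2
    clear hi hj
    induction p with
    | nil => exact hxi
    | @cons i l j h p ih =>
      obtain ⟨v, hv, hv1, hv2⟩ := hd ⟨(i, l), h⟩ (by simp)
      have : x = v := T.eq_of_mem_bag hcard hst (hs i (by simp)) (ht i (by simp)) hxi hv1 hx'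
        (hq v hv)
      exact ih (fun d hd' => hd d (by simp [hd'])) (fun z hz => hs z (by simp [hz]))
        (fun z hz => ht z (by simp [hz])) (this ▸ hv2)
  exact T.eq_of_mem_bag hcard hst hj.1 hj.2.1 hxj hj.2.2 hx' (hq y q.end_mem_support)

/-- The separator takes from each attached component its one vertex sharing a bag with `s` and `t`.
The interior of an `s`–`t` path lies in an attached component and must pass through that vertex. -/
theorem exists_isSeparator_of_common_bag [Finite V] (hcard : ∀ i, (T.bag i).card ≤ 3)
    (hst : s ≠ t) (hadj : ¬ G.Adj s t) {i₀ : Fin T.m} (hs : s ∈ T.bag i₀) (ht : t ∈ T.bag i₀) :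
    ∃ S, IsSeparator G s t S ∧ S.card ≤ (fullComponents G s t).ncard := by
  classical
  have key : ∀ C ∈ fullComponents G s t, ∃ x ∈ C, x ∉ ({s, t} : Set V) ∧
      ∃ i, s ∈ T.bag i ∧ t ∈ T.bag i ∧ x ∈ T.bag i := by
    rintro _ ⟨v, ⟨⟨u, hvu, hus⟩, w, hvw, hwt⟩, rfl⟩
    obtain ⟨q, hq⟩ := hvu.symm.trans hvw
    obtain ⟨x, hx, i, hi⟩ := T.exists_mem_bag_of_walk hs ht q hus hwt
    exact ⟨x, hvu.trans ⟨q.takeUntil x hx,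
      fun y hy => hq y (q.support_takeUntil_subset_support hx hy)⟩, hq x hx, i, hi⟩
  have : Nonempty V := ⟨s⟩
  choose! f hf1 hf2 hf3 using key
  have hfin : (fullComponents G s t).Finite := Set.toFinite _
  refine ⟨hfin.toFinset.image f, ⟨?_, ?_, fun p => ?_⟩, ?_⟩
  · simp only [Finset.mem_image, Set.Finite.mem_toFinset, not_exists, not_and]
    exact fun C hC h => hf2 C hC (by simp [h])
  · simp only [Finset.mem_image, Set.Finite.mem_toFinset, not_exists, not_and]
    exact fun C hC h => hf2 C hC (by simp [h])
  · have hsub := p.support_bypass_subset_support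
    have hpath := p.bypass_isPath
    generalize p.bypass = p' at hsub hpath
    cases p' with
    | nil => exact absurd rfl hst
    | @cons _ u _ h p₁ =>
      cases p₁ with
      | nil => exact absurd h hadj
      | @cons _ u' _ h' p₂ =>
        -- Here `q` is the interior of the path, running from the neighbour `u` of `s` to the
        -- neighbour `w` of `t`.
        obtain ⟨w, q, hwt, hq⟩ := SimpleGraph.Walk.exists_cons_eq_concat h' p₂
        rw [hq] at hpath hsub
        rw [SimpleGraph.Walk.cons_isPath_iff, SimpleGraph.Walk.concat_isPath_iff,
          SimpleGraph.Walk.support_concat] at hpath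
        have hqst : ∀ x ∈ q.support, x ∉ ({s, t} : Set V) := by
          rintro x hx (rfl | rfl)
          · exact hpath.2 (by simp [hx])
          · exact hpath.1.2 hx
        have hav : ∀ x ∈ q.support, Avoid G {s, t} u x := fun x hx =>
          ⟨q.takeUntil x hx, fun y hy => hqst y (q.support_takeUntil_subset_support hx hy)⟩
        obtain ⟨y, hy, j, hj⟩ := T.exists_mem_bag_of_walk hs ht q h.symm hwt
        have hC : {x | Avoid G {s, t} u x} ∈ fullComponents G s t :=
          ⟨u, ⟨⟨u, hav u (by simp), h.symm⟩, w, hav w (by simp), hwt⟩, rfl⟩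
        obtain ⟨i, hi⟩ := hf3 _ hC
        have hyf := T.eq_of_avoid hcard hst hj hi ((hav y hy).symm.trans (hf1 _ hC))
        refine ⟨y, hsub (by simp [hy]), ?_⟩
        rw [hyf]
        exact Finset.mem_image_of_mem _ (hfin.mem_toFinset.2 hC)
  · rw [Set.ncard_eq_toFinset_card _ hfin]
    exact Finset.card_image_le

end TreeDecomposition

section Treewidth

variable {V : Type*} {G : SimpleGraph V}

theorem exists_treeDecomposition [Finite V] (G : SimpleGraph V) :
    ∃ T : TreeDecomposition G, ∀ i, (T.bag i).card ≤ treewidth G + 1 := by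
  classical
  have := Fintype.ofFinite V
  have hne : {w : ℕ | ∃ T : TreeDecomposition G, ∀ i, (T.bag i).card ≤ w + 1}.Nonempty := by
    refine ⟨Fintype.card V, ⟨1, ⊥, ?_, fun _ => Finset.univ, by simp, by simp, fun v => ?_⟩, ?_⟩
    · exact SimpleGraph.IsTree.of_subsingleton
    · have : Nonempty {i : Fin 1 | v ∈ (Finset.univ : Finset V)} := ⟨⟨0, by simp⟩⟩
      exact SimpleGraph.IsTree.of_subsingleton.connected
    · exact fun i => (Finset.card_le_univ _).trans (Nat.le_succ _)
  exact Nat.sInf_mem hne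

theorem exists_isSeparator_of_treewidth_le_two [Finite V] (hG : treewidth G ≤ 2) {s t : V}
    (hst : s ≠ t) (hadj : ¬ G.Adj s t) :
    ∃ S, IsSeparator G s t S ∧ S.card ≤ max (fullComponents G s t).ncard 2 := by
  obtain ⟨T, hT⟩ := exists_treeDecomposition G
  by_cases h : ∃ i, s ∈ T.bag i ∧ t ∈ T.bag i
  · obtain ⟨i, hs, ht⟩ := h
    obtain ⟨S, h1, h2⟩ := T.exists_isSeparator_of_common_bag
      (fun i => (hT i).trans (by omega)) hst hadj hs ht
    exact ⟨S, h1, h2.trans (le_max_left _ _)⟩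
  · push Not at h
    obtain ⟨S, h1, h2⟩ := T.exists_isSeparator_of_no_common_bag
      (w := 2) (fun i => (hT i).trans (by omega)) h
    exact ⟨S, h1, h2.trans (le_max_right _ _)⟩

end Treewidth

/-! ### Grids -/

section Grid

variable {V : Type*} {G : SimpleGraph V}

/-- `r` and `c` are the coordinates of a rectangular grid. -/
structure IsGridCoord (G : SimpleGraph V) (r c : V → ℤ) : Prop where
  adj : ∀ u v, G.Adj u v ↔ (r v = r u + 1 ∧ c v = c u) ∨ (r v = r u - 1 ∧ c v = c u) ∨
    (c v = c u + 1 ∧ r v = r u) ∨ (c v = c u - 1 ∧ r v = r u)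
  inj : ∀ u v, r u = r v → c u = c v → u = v
  rect : ∀ u u' w w' i j, r u ≤ i → i ≤ r u' → c w ≤ j → j ≤ c w' → ∃ z, r z = i ∧ c z = j

variable {r c : V → ℤ}

/-- Transposition here and reflection below allow the positions in a grid to be treated up to
symmetry. -/
theorem IsGridCoord.swap (h : IsGridCoord G r c) : IsGridCoord G c r where
  adj u v := by rw [h.adj]; omega
  inj u v h1 h2 := h.inj u v h2 h1
  rect u u' w w' i j h1 h2 h3 h4 := by
    obtain ⟨z, hz⟩ := h.rect w w' u u' j i h3 h4 h1 h2
    exact ⟨z, hz.symm⟩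

theorem IsGridCoord.neg (h : IsGridCoord G r c) : IsGridCoord G (fun v => -r v) c where
  adj u v := by rw [h.adj]; omega
  inj u v h1 h2 := h.inj u v (by omega) h2
  rect u u' w w' i j h1 h2 h3 h4 := by
    obtain ⟨z, hz1, hz2⟩ := h.rect u' u w w' (-i) j (by omega) (by omega) h3 h4
    exact ⟨z, by omega, hz2⟩

theorem isGridCoord_of_iso {M N : ℕ} (e : G ≃g grid M N) :
    IsGridCoord G (fun v => ((e v).1 : ℕ)) (fun v => ((e v).2 : ℕ)) where
  adj u v := by
    rw [← e.map_adj_iff]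
    simp only [grid]
    rcases abs_cases ((((e u).1 : ℕ) : ℤ) - ((e v).1 : ℕ)) with h | h <;>
    rcases abs_cases ((((e u).2 : ℕ) : ℤ) - ((e v).2 : ℕ)) with h' | h' <;> omega
  inj u v h1 h2 := e.injective (Prod.ext (Fin.ext (by simpa using h1)) (Fin.ext (by simpa using h2)))
  rect u u' w w' i j h1 h2 h3 h4 := by
    have hi := (e u').1.isLt
    have hj := (e w').2.isLt
    refine ⟨e.symm (⟨i.toNat, by omega⟩, ⟨j.toNat, by omega⟩), ?_, ?_⟩ <;>
    simp <;> omega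

/-- Coordinates in which `s` is weakly below and left of `t`. -/
theorem IsGridCoord.exists_le (h : IsGridCoord G r c) (s t : V) :
    ∃ r c, IsGridCoord G r c ∧ r s ≤ r t ∧ c s ≤ c t := by
  obtain ⟨r', hr, hrst⟩ : ∃ r', IsGridCoord G r' c ∧ r' s ≤ r' t := by
    rcases le_total (r s) (r t) with h1 | h1
    · exact ⟨r, h, h1⟩
    · exact ⟨_, h.neg, neg_le_neg h1⟩
  rcases le_total (c s) (c t) with h2 | h2
  · exact ⟨r', c, hr, hrst, h2⟩
  · exact ⟨r', _, hr.swap.neg.swap, hrst, neg_le_neg h2⟩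

/-- Divider's agents `x` above `a` and `y` below `b` keep the rows of `a` and `b` apart. -/
def IsRowGuard (r c : V → ℤ) (a b x y : V) : Prop :=
  r x = r a + 1 ∧ c x = c a ∧ r y = r b - 1 ∧ c y = c b ∧ r a + 2 ≤ r b

/-- Facilitator's agents are at opposite corners of a square, those of Divider at the others. -/
def IsDiagGuard (r c : V → ℤ) (a b x y : V) : Prop :=
  r b = r a + 1 ∧ c b = c a + 1 ∧ r x = r b ∧ c x = c a ∧ r y = r a ∧ c y = c b

/-- The coordinates are part of the guard and may change during play: a diagonal guard can turn into
a guard of rows or of columns. -/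
def GridGuard (G : SimpleGraph V) (a b : V) (D : Multiset V) : Prop :=
  ∃ r c x y, IsGridCoord G r c ∧ D = {x, y} ∧ (IsRowGuard r c a b x y ∨ IsDiagGuard r c a b x y)

theorem IsGridCoord.step_iff (h : IsGridCoord G r c) {u v : V} :
    Step G u v ↔ (r v = r u ∧ c v = c u) ∨ (r v = r u + 1 ∧ c v = c u) ∨
      (r v = r u - 1 ∧ c v = c u) ∨ (c v = c u + 1 ∧ r v = r u) ∨
      (c v = c u - 1 ∧ r v = r u) := by
  rw [Step, h.adj]
  refine or_congr_left ⟨?_, fun h' => h.inj _ _ h'.1.symm h'.2.symm⟩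
  rintro rfl
  exact ⟨rfl, rfl⟩

/-- Divider's agents can reach a row guard from any guard. -/
theorem IsGridCoord.exists_rowGuard (h : IsGridCoord G r c) {a b a' b' x y : V}
    (hxy : (r x = r a + 1 ∧ c x = c a) ∧ r y = r b - 1 ∧ c y = c b)
    (ha : Step G a a') (hb : Step G b b') (hab : r a' + 2 ≤ r b') :
    ∃ D', MoveAdj G {x, y} D' ∧ GridGuard G a' b' D' := by
  obtain ⟨x', hx1, hx2⟩ := h.rect a' b' a' a' (r a' + 1) (c a') (by omega) (by omega) le_rfl le_rfl
  obtain ⟨y', hy1, hy2⟩ := h.rect a' b' b' b' (r b' - 1) (c b') (by omega) (by omega) le_rfl le_rfl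
  rw [h.step_iff] at ha hb
  exact ⟨{x', y'}, moveAdj_pair (h.step_iff.2 (by omega)) (h.step_iff.2 (by omega)),
    r, c, x', y', h, rfl, Or.inl ⟨hx1, hx2, hy1, hy2, hab⟩⟩

/-- Under a row guard `a` cannot go up and `b` cannot go down, so the row distance stays at least
two and the guards copy their opponents' moves. Under a diagonal guard any move leads outwards and
produces row or column distance at least two. -/
theorem IsGridCoord.dividerWins (h : IsGridCoord G r c) {s t : V} (hst : s ≠ t)
    (hadj : ¬ G.Adj s t) {k : ℕ} (hk : 2 ≤ k) : DividerWins G s t k := by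
  have hinit : ∃ D, GridGuard G s t D := by
    obtain ⟨r, c, h, hr, hc⟩ := h.exists_le s t
    have hrow : ∀ {r c : V → ℤ}, IsGridCoord G r c → r s + 2 ≤ r t → ∃ D, GridGuard G s t D := by
      intro r c h hr
      obtain ⟨x, hx1, hx2⟩ := h.rect s t s s (r s + 1) (c s) (by omega) (by omega) le_rfl le_rfl
      obtain ⟨y, hy1, hy2⟩ := h.rect s t t t (r t - 1) (c t) (by omega) (by omega) le_rfl le_rfl
      exact ⟨{x, y}, r, c, x, y, h, rfl, Or.inl ⟨hx1, hx2, hy1, hy2, hr⟩⟩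
    by_cases h1 : r s + 2 ≤ r t
    · exact hrow h h1
    by_cases h2 : c s + 2 ≤ c t
    · exact hrow h.swap h2
    have h3 : r t = r s + 1 ∧ c t = c s + 1 := by
      rw [h.adj] at hadj
      have : ¬ (r s = r t ∧ c s = c t) := fun h' => hst (h.inj _ _ h'.1 h'.2)
      omega
    obtain ⟨x, hx1, hx2⟩ := h.rect s t s s (r t) (c s) hr le_rfl le_rfl le_rfl
    obtain ⟨y, hy1, hy2⟩ := h.rect s t t t (r s) (c t) le_rfl hr le_rfl le_rfl
    exact ⟨{x, y}, r, c, x, y, h, rfl, Or.inr ⟨h3.1, h3.2, hx1, hx2, hy1, hy2⟩⟩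
  obtain ⟨D, hD⟩ := hinit
  have hcard : D.card = 2 := by
    obtain ⟨_, _, x, y, -, rfl, -⟩ := hD
    rfl
  refine dividerWins_of_invariant_of_le two_pos hk (GridGuard G) D hcard hD ?_ ?_ ?_
  · rintro a b _ ⟨r, c, x, y, h, rfl, hI⟩
    simp only [Multiset.insert_eq_cons, Multiset.mem_cons, Multiset.mem_singleton]
    unfold IsRowGuard IsDiagGuard at hI
    constructor <;> rintro (rfl | rfl) <;> omega
  · rintro a _ ⟨r, c, x, y, h, rfl, hI⟩
    unfold IsRowGuard IsDiagGuard at hI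
    omega
  · rintro a b _ - ⟨r, c, x, y, h, rfl, hI⟩ a' b' ha hb ha' hb'
    simp only [Multiset.insert_eq_cons, Multiset.mem_cons, Multiset.mem_singleton, not_or]
      at ha' hb'
    have hax : ¬ (r a' = r x ∧ c a' = c x) := fun h' => ha'.1 (h.inj _ _ h'.1 h'.2)
    have hay : ¬ (r a' = r y ∧ c a' = c y) := fun h' => ha'.2 (h.inj _ _ h'.1 h'.2)
    have hbx : ¬ (r b' = r x ∧ c b' = c x) := fun h' => hb'.1 (h.inj _ _ h'.1 h'.2)
    have hby : ¬ (r b' = r y ∧ c b' = c y) := fun h' => hb'.2 (h.inj _ _ h'.1 h'.2)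
    have ha₀ := h.step_iff.1 ha
    have hb₀ := h.step_iff.1 hb
    rcases hI with hI | hI
    · unfold IsRowGuard at hI
      exact h.exists_rowGuard (by omega) ha hb (by omega)
    · unfold IsDiagGuard at hI
      by_cases h1 : r a' + 2 ≤ r b'
      · exact h.exists_rowGuard (by omega) ha hb h1
      by_cases h2 : c a' + 2 ≤ c b'
      -- In the transposed coordinates it is `y` that stands next to `a` and `x` next to `b`, so the
      -- guards exchange roles.
      · rw [Multiset.pair_comm]
        exact h.swap.exists_rowGuard (by omega) ha hb h2
      have ha1 : a' = a := h.inj _ _ (by omega) (by omega)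
      have hb1 : b' = b := h.inj _ _ (by omega) (by omega)
      subst ha1
      subst hb1
      exact ⟨{x, y}, moveAdj_refl _, r, c, x, y, h, rfl, Or.inr hI⟩

theorem IsGridCoord.avoid_of_line (h : IsGridCoord G r c) {u w v : V} (hc : c u = c w)
    (hr : r u ≤ r w) (hv : ¬ (c v = c u ∧ r u ≤ r v ∧ r v ≤ r w)) : Avoid G {v} u w := by
  obtain ⟨n, hn⟩ : ∃ n : ℕ, r w = r u + n := ⟨(r w - r u).toNat, by omega⟩
  induction n generalizing u with
  | zero =>
    rw [h.inj u w (by omega) hc]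
    refine Avoid.refl ?_
    rintro rfl
    omega
  | succ n ih =>
    obtain ⟨u', h1, h2⟩ := h.rect u w u u (r u + 1) (c u) (by omega) (by omega) le_rfl le_rfl
    refine (Avoid.of_adj ((h.adj u u').2 (Or.inl ⟨h1, h2⟩)) ?_ ?_).trans
      (ih (h2.trans hc) (by omega) (by omega) (by omega))
    · rintro rfl
      omega
    · rintro rfl
      omega

/-- The two L-shaped routes between opposite corners of a rectangle share only these corners. If `s`
and `t` are on one line, the second route is a detour through a neighbouring line. -/
theorem IsGridCoord.avoid (h : IsGridCoord G r c) (hr : ∃ u u', r u ≠ r u')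
    (hc : ∃ u u', c u ≠ c u') {s t v : V} (hs : v ≠ s) (ht : v ≠ t) : Avoid G {v} s t := by
  -- two vertices in the same row
  have hrow : ∀ {r c : V → ℤ}, IsGridCoord G r c → (∃ u u', r u ≠ r u') → r s = r t →
      c s ≤ c t → Avoid G {v} s t := by
    intro r c h hr hst hcst
    -- After a reflection if necessary, there is a row above that of `s` and `t` for the detour.
    obtain ⟨r, h, hst, u, hu⟩ : ∃ r, IsGridCoord G r c ∧ r s = r t ∧ ∃ u, r s < r u := by
      obtain ⟨u, hu⟩ : ∃ u, r u ≠ r s := by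
        obtain ⟨u, u', hu⟩ := hr
        by_cases h1 : r u = r s
        · exact ⟨u', fun h2 => hu (h1.trans h2.symm)⟩
        · exact ⟨u, h1⟩
      rcases lt_or_gt_of_ne hu with h1 | h1
      · exact ⟨_, h.neg, congrArg _ hst, u, neg_lt_neg h1⟩
      · exact ⟨r, h, hst, u, h1⟩
    by_cases hv : r v = r s ∧ c s ≤ c v ∧ c v ≤ c t
    · have hs' : ¬ (r v = r s ∧ c v = c s) := fun h' => hs (h.inj _ _ h'.1 h'.2)
      have ht' : ¬ (r v = r t ∧ c v = c t) := fun h' => ht (h.inj _ _ h'.1 h'.2)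
      obtain ⟨s', hs1, hs2⟩ := h.rect s u s s (r s + 1) (c s) (by omega) (by omega) le_rfl le_rfl
      obtain ⟨t', ht1, ht2⟩ := h.rect s u t t (r s + 1) (c t) (by omega) (by omega) le_rfl le_rfl
      exact ((h.avoid_of_line (by omega) (by omega) (by omega) : Avoid G {v} s s').trans
        (h.swap.avoid_of_line (by omega) (by omega) (by omega) : Avoid G {v} s' t')).trans
        (h.avoid_of_line (by omega) (by omega) (by omega) : Avoid G {v} t t').symm
    · exact h.swap.avoid_of_line hst hcst (by omega)
  have hle : ∀ {r c : V → ℤ}, IsGridCoord G r c → (∃ u u', r u ≠ r u') → (∃ u u', c u ≠ c u') →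
      r s ≤ r t → c s ≤ c t → Avoid G {v} s t := by
    intro r c h hr hc hrst hcst
    rcases hrst.eq_or_lt with h1 | h1
    · exact hrow h hr h1 hcst
    rcases hcst.eq_or_lt with h2 | h2
    · exact hrow h.swap hc h2 hrst
    have hs' : ¬ (r v = r s ∧ c v = c s) := fun h' => hs (h.inj _ _ h'.1 h'.2)
    have ht' : ¬ (r v = r t ∧ c v = c t) := fun h' => ht (h.inj _ _ h'.1 h'.2)
    obtain ⟨p, hp1, hp2⟩ := h.rect s t s s (r t) (c s) hrst le_rfl le_rfl le_rfl
    obtain ⟨q, hq1, hq2⟩ := h.rect s t t t (r s) (c t) le_rfl hrst le_rfl le_rfl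
    by_cases hv : (r v = r s ∧ c s ≤ c v ∧ c v ≤ c t) ∨ (c v = c t ∧ r s ≤ r v ∧ r v ≤ r t)
    · exact (h.avoid_of_line (by omega) (by omega) (by omega) : Avoid G {v} s p).trans
        (h.swap.avoid_of_line (by omega) (by omega) (by omega) : Avoid G {v} p t)
    · exact (h.swap.avoid_of_line (by omega) (by omega) (by omega) : Avoid G {v} s q).trans
        (h.avoid_of_line (by omega) (by omega) (by omega) : Avoid G {v} q t)
  have hn : ∀ f : V → ℤ, (∃ u u', f u ≠ f u') → ∃ u u', -f u ≠ -f u' :=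
    fun f ⟨u, u', hu⟩ => ⟨u, u', fun h => hu (neg_injective h)⟩
  rcases le_total (r s) (r t) with h1 | h1 <;> rcases le_total (c s) (c t) with h2 | h2
  · exact hle h hr hc h1 h2
  · exact hle h.swap.neg.swap hr (hn c hc) h1 (neg_le_neg h2)
  · exact hle h.neg (hn r hr) hc (neg_le_neg h1) h2
  · exact hle h.neg.swap.neg.swap (hn r hr) (hn c hc) (neg_le_neg h1) (neg_le_neg h2)

theorem dynSep_grid {M N : ℕ} (hM : 2 ≤ M) (hN : 2 ≤ N) {s t : Fin M × Fin N} (hst : s ≠ t)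
    (hadj : ¬ (grid M N).Adj s t) : dynSep (grid M N) s t = 2 := by
  have h := isGridCoord_of_iso (SimpleGraph.Iso.refl : grid M N ≃g grid M N)
  have hav : ∀ v, v ≠ s → v ≠ t → Avoid (grid M N) {v} s t := fun v =>
    h.avoid ⟨(⟨0, by omega⟩, ⟨0, by omega⟩), (⟨1, by omega⟩, ⟨0, by omega⟩), by simp⟩
      ⟨(⟨0, by omega⟩, ⟨0, by omega⟩), (⟨0, by omega⟩, ⟨1, by omega⟩), by simp⟩
  have h2 := h.dividerWins hst hadj le_rfl
  refine le_antisymm (iInf₂_le 2 h2) (le_iInf₂ fun k hk => ?_)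
  by_contra! hlt
  have hk2 : k < 2 := by exact_mod_cast hlt
  interval_cases k
  · refine (facilitatorWins_zero ?_).not_dividerWins hk
    -- Reachability comes for free: an initial agent of the two-agent strategy sits on a vertex
    -- other than `s` and `t`, and some `s`–`t` walk avoids it.
    obtain ⟨d, -⟩ := h2
    obtain ⟨x, y, hxy⟩ := Multiset.card_eq_two.1 d.init.2
    have hd := disjoint_pair.1 d.init_compatible
    have hx : x ∈ (d.init : Multiset (Fin M × Fin N)) := by
      have : (d.init : Multiset (Fin M × Fin N)) = {x, y} := hxy
      rw [this]
      simp
    obtain ⟨p, -⟩ := hav x (fun h => hd.1 (h ▸ hx)) (fun h => hd.2 (h ▸ hx))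
    exact ⟨p⟩
  · exact (facilitatorWins_one hav).not_dividerWins hk

end Grid

/-! ### The separation number on the two graph classes -/

section SepValue

variable {V : Type*} {G : SimpleGraph V} {s t : V} {k : ℕ}

/-- A single vertex separates `s` from `t`. -/
def HasCut (G : SimpleGraph V) (s t : V) : Prop := ∃ v, v ≠ s ∧ v ≠ t ∧ ¬ Avoid G {v} s t

open Classical in
/-- The value of the dynamic separation number on the graph classes considered here, for distinct
non-adjacent `s` and `t`. -/
noncomputable def sepValue (G : SimpleGraph V) (s t : V) : ℕ :=
  if HasCut G s t then 1 else max (fullComponents G s t).ncard 2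

theorem facilitatorWins_of_lt_sepValue [Finite V] (hk : 0 < k ∨ G.Reachable s t)
    (h : k < sepValue G s t) : FacilitatorWins G s t k := by
  rcases Nat.eq_zero_or_pos k with rfl | hk0
  · exact facilitatorWins_zero (hk.resolve_left (lt_irrefl 0))
  rw [sepValue] at h
  split_ifs at h with hcut
  · omega
  · rcases lt_max_iff.1 h with h | h
    · exact facilitatorWins_of_lt_ncard h
    · obtain rfl : k = 1 := by omega
      refine facilitatorWins_one fun v h1 h2 => ?_
      by_contra h3
      exact hcut ⟨v, h1, h2, h3⟩

theorem HasCut.exists_isSeparator (h : HasCut G s t) :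
    ∃ S, IsSeparator G s t S ∧ S.card = 1 := by
  obtain ⟨v, h1, h2, h3⟩ := h
  refine ⟨{v}, ⟨by simpa using h1.symm, by simpa using h2.symm, fun p => ?_⟩, by simp⟩
  by_contra! hp
  exact h3 ⟨p, fun x hx => by simpa using hp x hx⟩

theorem dividerWins_of_hasCut (h : HasCut G s t) (hk : 0 < k) : DividerWins G s t k := by
  obtain ⟨S, hS, hcard⟩ := h.exists_isSeparator
  exact hS.dividerWins (Finset.card_pos.1 (by omega)) (by omega)

theorem IsSeparator.nonempty {S : Finset V} (hS : IsSeparator G s t S) (h : G.Reachable s t) :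
    S.Nonempty := by
  obtain ⟨p⟩ := h
  obtain ⟨v, -, hv⟩ := hS.2.2 p
  exact ⟨v, hv⟩

theorem exists_isSeparator_card_le_sepValue [Finite V] (htw : treewidth G ≤ 2)
    (hst : s ≠ t) (hadj : ¬ G.Adj s t) :
    ∃ S, IsSeparator G s t S ∧ S.card ≤ sepValue G s t := by
  rw [sepValue]
  split_ifs with hcut
  · obtain ⟨S, hS, hcard⟩ := hcut.exists_isSeparator
    exact ⟨S, hS, hcard.le⟩
  · exact exists_isSeparator_of_treewidth_le_two htw hst hadj

theorem dynSep_le_statSep (hG : G.Connected) : dynSep G s t ≤ statSep G s t :=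
  le_iInf₂ fun S hS => iInf₂_le S.card
    (hS.dividerWins (hS.nonempty (hG.preconnected s t)) le_rfl)

theorem sepValue_le_dynSep [Finite V] (hG : G.Connected) : (sepValue G s t : ℕ∞) ≤ dynSep G s t :=
  le_iInf₂ fun k hk => by
    by_contra! hlt
    exact (facilitatorWins_of_lt_sepValue (Or.inr (hG.preconnected s t))
      (by exact_mod_cast hlt)).not_dividerWins hk

theorem statSep_le_sepValue [Finite V] (htw : treewidth G ≤ 2) (hst : s ≠ t)
    (hadj : ¬ G.Adj s t) : statSep G s t ≤ sepValue G s t := by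
  obtain ⟨S, hS, hcard⟩ := exists_isSeparator_card_le_sepValue htw hst hadj
  exact (iInf₂_le S hS).trans (by exact_mod_cast hcard)

theorem statSep_eq_sepValue [Finite V] (hG : G.Connected) (htw : treewidth G ≤ 2) (hst : s ≠ t)
    (hadj : ¬ G.Adj s t) : statSep G s t = sepValue G s t :=
  (statSep_le_sepValue htw hst hadj).antisymm ((sepValue_le_dynSep hG).trans (dynSep_le_statSep hG))

/-- For distinct non-adjacent vertices both numbers are squeezed at `sepValue`; otherwise
Facilitator wins at once and both are infinite. -/
theorem dynSep_eq_statSep [Finite V] (hG : G.Connected) (htw : treewidth G ≤ 2) (s t : V) :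
    dynSep G s t = statSep G s t := by
  refine (dynSep_le_statSep hG).antisymm ?_
  by_cases h : s = t ∨ G.Adj s t
  · exact le_iInf₂ fun k hk => absurd hk (facilitatorWins_of_eq_or_adj h).not_dividerWins
  · rw [not_or] at h
    exact (statSep_le_sepValue htw h.1 h.2).trans (sepValue_le_dynSep hG)

theorem facilitatorWins_iff_of_dividerWins [Finite V] (hk : 0 < k)
    (h : s ≠ t → ¬ G.Adj s t → sepValue G s t ≤ k → DividerWins G s t k) :
    FacilitatorWins G s t k ↔ s = t ∨ G.Adj s t ∨ k < sepValue G s t := by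
  constructor
  · intro hf
    by_contra! hcon
    exact hf.not_dividerWins (h hcon.1 hcon.2.1 hcon.2.2)
  · rintro (h1 | h1 | h1)
    · exact facilitatorWins_of_eq_or_adj (Or.inl h1)
    · exact facilitatorWins_of_eq_or_adj (Or.inr h1)
    · exact facilitatorWins_of_lt_sepValue (Or.inl hk) h1

theorem facilitatorWins_iff_of_treewidth [Finite V] (hG : G.Connected) (htw : treewidth G ≤ 2)
    (hk : 0 < k) : FacilitatorWins G s t k ↔ s = t ∨ G.Adj s t ∨ k < sepValue G s t := by
  refine facilitatorWins_iff_of_dividerWins hk fun hst hadj hle => ?_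
  obtain ⟨S, hS, hcard⟩ := exists_isSeparator_card_le_sepValue htw hst hadj
  exact hS.dividerWins (hS.nonempty (hG.preconnected s t)) (hcard.trans hle)

/-- Degenerate grids are included: if a cut vertex exists, one agent on it suffices, and otherwise
`sepValue` is at least two and the grid guard applies for any side lengths. -/
theorem facilitatorWins_iff_of_isGrid [Finite V] (hG : IsGrid G) (hk : 0 < k) :
    FacilitatorWins G s t k ↔ s = t ∨ G.Adj s t ∨ k < sepValue G s t := by
  refine facilitatorWins_iff_of_dividerWins hk fun hst hadj hle => ?_
  obtain ⟨M, N, ⟨e⟩⟩ := hG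
  rw [sepValue] at hle
  split_ifs at hle with hcut
  · exact dividerWins_of_hasCut hcut hk
  · exact (isGridCoord_of_iso e).dividerWins hst hadj ((le_max_right _ _).trans hle)

end SepValue

/-! ### Reasoning about programs -/

section Programs

/-- The program `c`, started in `σ`, halts within `T` time units in a state with `Q`. -/
def Runs (c : Cmd) (σ : State) (Q : State → Prop) (T : ℕ) : Prop :=
  ∃ σ' T', Exec c σ σ' T' ∧ T' ≤ T ∧ Q σ'

infixr:60 " ;; " => Cmd.seq

variable {c c₁ c₂ : Cmd} {σ : State} {Q Q' : State → Prop} {T T₁ T₂ : ℕ} {r a b : ℕ}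

@[simp] theorem State.setReg_reg (σ : State) (r x r' : ℕ) :
    (σ.setReg r x).reg r' = if r' = r then x else σ.reg r' := Function.update_apply ..

@[simp] theorem State.setReg_mem (σ : State) (r x : ℕ) : (σ.setReg r x).mem = σ.mem := rfl

@[simp] theorem State.setMem_reg (σ : State) (a x : ℕ) : (σ.setMem a x).reg = σ.reg := rfl

@[simp] theorem State.setMem_mem (σ : State) (a x a' : ℕ) :
    (σ.setMem a x).mem a' = if a' = a then x else σ.mem a' := Function.update_apply ..

theorem Runs.mono (h : Runs c σ Q T₁) (hT : T₁ ≤ T₂) (hQ : ∀ σ', Q σ' → Q' σ') :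
    Runs c σ Q' T₂ := by
  obtain ⟨σ', T', h1, h2, h3⟩ := h
  exact ⟨σ', T', h1, h2.trans hT, hQ _ h3⟩

theorem Runs.mono_time (h : Runs c σ Q T₁) (hT : T₁ ≤ T₂) : Runs c σ Q T₂ :=
  h.mono hT fun _ => id

theorem Runs.skip (h : Q σ) : Runs .skip σ Q 1 := ⟨_, _, .skip σ, le_rfl, h⟩

theorem Runs.const {x : ℕ} (h : Q (σ.setReg r x)) : Runs (.const r x) σ Q 1 :=
  ⟨_, _, .const σ r x, le_rfl, h⟩

theorem Runs.add (h : Q (σ.setReg r (σ.reg a + σ.reg b))) : Runs (.add r a b) σ Q 1 :=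
  ⟨_, _, .add σ r a b, le_rfl, h⟩

theorem Runs.sub (h : Q (σ.setReg r (σ.reg a - σ.reg b))) : Runs (.sub r a b) σ Q 1 :=
  ⟨_, _, .sub σ r a b, le_rfl, h⟩

theorem Runs.load (h : Q (σ.setReg r (σ.mem (σ.reg a)))) : Runs (.load r a) σ Q 1 :=
  ⟨_, _, .load σ r a, le_rfl, h⟩

theorem Runs.store (h : Q (σ.setMem (σ.reg a) (σ.reg b))) : Runs (.store a b) σ Q 1 :=
  ⟨_, _, .store σ a b, le_rfl, h⟩

theorem Runs.seq (h : Runs c₁ σ (fun σ' => Runs c₂ σ' Q T₂) T₁) :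
    Runs (c₁ ;; c₂) σ Q (T₁ + T₂) := by
  obtain ⟨σ', T', h1, h2, σ'', T'', h3, h4, h5⟩ := h
  exact ⟨σ'', _, h1.seq h3, add_le_add h2 h4, h5⟩

theorem Runs.ite (h₁ : σ.reg r ≠ 0 → Runs c₁ σ Q T) (h₂ : σ.reg r = 0 → Runs c₂ σ Q T) :
    Runs (.ite r c₁ c₂) σ Q (T + 1) := by
  by_cases hr : σ.reg r = 0
  · obtain ⟨σ', T', h1, h2, h3⟩ := h₂ hr
    exact ⟨σ', _, h1.ite_false hr, Nat.succ_le_succ h2, h3⟩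
  · obtain ⟨σ', T', h1, h2, h3⟩ := h₁ hr
    exact ⟨σ', _, h1.ite_true hr, Nat.succ_le_succ h2, h3⟩

/-- The registers that a program may change. -/
def Cmd.writes : Cmd → List ℕ
  | .skip => []
  | .const r _ => [r]
  | .add r _ _ => [r]
  | .sub r _ _ => [r]
  | .load r _ => [r]
  | .store _ _ => []
  | .seq c₁ c₂ => c₁.writes ++ c₂.writes
  | .ite _ c₁ c₂ => c₁.writes ++ c₂.writes
  | .while _ c => c.writes

theorem Exec.reg_eq {σ' : State} (h : Exec c σ σ' T) : ∀ r, r ∉ c.writes → σ'.reg r = σ.reg r := by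
  induction h with
  | skip | store => exact fun _ _ => rfl
  | const | add | sub | load =>
    intro r hr
    simp only [Cmd.writes, List.mem_singleton] at hr
    simp [hr]
  | seq _ _ ih₁ ih₂ =>
    intro r hr
    simp only [Cmd.writes, List.mem_append, not_or] at hr
    rw [ih₂ r hr.2, ih₁ r hr.1]
  | ite_true _ _ ih =>
    intro r hr
    simp only [Cmd.writes, List.mem_append, not_or] at hr
    exact ih r hr.1
  | ite_false _ _ ih =>
    intro r hr
    simp only [Cmd.writes, List.mem_append, not_or] at hr
    exact ih r hr.2
  | while_false => exact fun _ _ => rfl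
  | while_true _ _ _ ih₁ ih₂ =>
    intro r hr
    rw [ih₂ r hr, ih₁ r hr]

/-- Postconditions need not mention untouched registers: that they are preserved follows from the
program text, through decidable membership in `writes`. -/
theorem Runs.frame (h : Runs c σ Q T) :
    Runs c σ (fun σ' => Q σ' ∧ ∀ r, r ∉ c.writes → σ'.reg r = σ.reg r) T := by
  obtain ⟨σ', T', h1, h2, h3⟩ := h
  exact ⟨σ', T', h1, h2, h3, h1.reg_eq⟩

theorem Runs.while_false (hr : σ.reg r = 0) (h : Q σ) : Runs (.while r c) σ Q 1 :=
  ⟨_, _, .while_false hr, le_rfl, h⟩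

theorem Runs.while_true (hr : σ.reg r ≠ 0)
    (h : Runs c σ (fun σ' => Runs (.while r c) σ' Q T₂) T₁) :
    Runs (.while r c) σ Q (T₁ + T₂ + 1) := by
  obtain ⟨σ', T', h1, h2, σ'', T'', h3, h4, h5⟩ := h
  exact ⟨σ'', _, .while_true hr h1 h3, by omega, h5⟩

/-- `for i = 0, …, (content of N) - 1 do c`, where the register `m` counts down and the register
`1` holds the number one. -/
def forLoop (i m N : ℕ) (c : Cmd) : Cmd :=
  .const i 0 ;; .const m 0 ;; .add m m N ;; .while m (c ;; .add i i 1 ;; .sub m m 1)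

/-- Two states agree except for the registers `i` and `m`. -/
def EqExcept (i m : ℕ) (σ σ' : State) : Prop :=
  σ'.mem = σ.mem ∧ ∀ r, r ≠ i → r ≠ m → σ'.reg r = σ.reg r

/-- The invariant is required in every state agreeing with the current one up to the two counters,
so that it survives their update. A round costs `T + 3`: the body, two counter updates and the test.
-/
theorem Runs.forLoop {i m N : ℕ} {I : ℕ → State → Prop}
    (hreg : [i, m, 1].Nodup ∧ N ≠ i ∧ N ≠ m ∧ i ∉ c.writes ∧ m ∉ c.writes ∧ 1 ∉ c.writes)
    (h1 : σ.reg 1 = 1) (h0 : ∀ σ', EqExcept i m σ σ' → I 0 σ')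
    (hstep : ∀ j < σ.reg N, ∀ σ₁, (∀ r, r ∉ i :: m :: c.writes → σ₁.reg r = σ.reg r) →
      σ₁.reg i = j → I j σ₁ →
      Runs c σ₁ (fun σ₂ => ∀ σ₃, EqExcept i m σ₂ σ₃ → I (j + 1) σ₃) T) :
    Runs (Rendezvous.forLoop i m N c) σ (I (σ.reg N)) (σ.reg N * (T + 3) + 4) := by
  obtain ⟨hnd, hNi, hNm, hi, hm, h1w⟩ := hreg
  simp only [List.nodup_cons, List.mem_cons, List.not_mem_nil, or_false, not_or] at hnd
  obtain ⟨⟨him, hi1⟩, hm1, -⟩ := hnd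
  have loop : ∀ d j, j + d = σ.reg N → ∀ σ₁, (∀ r, r ∉ i :: m :: c.writes → σ₁.reg r = σ.reg r) →
      σ₁.reg i = j → σ₁.reg m = d → I j σ₁ →
      Runs (.while m (c ;; .add i i 1 ;; .sub m m 1)) σ₁ (I (σ.reg N)) (d * (T + 3) + 1) := by
    intro d
    induction d with
    | zero =>
      intro j hj σ₁ _ _ hmz hI
      rw [← hj]
      exact (Runs.while_false hmz hI).mono_time (by omega)
    | succ d ih =>
      intro j hj σ₁ hf hij hmd hI
      refine Runs.mono_time (Runs.while_true (by omega) (Runs.seq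
        (Runs.mono (hstep j (by omega) σ₁ hf hij hI).frame le_rfl ?_)))
        (show T + (1 + 1) + (d * (T + 3) + 1) + 1 ≤ _ by ring_nf; omega)
      rintro σ₂ ⟨hI₂, hf₂⟩
      refine Runs.seq (Runs.add (Runs.sub ?_))
      have hone : σ₂.reg 1 = 1 := by
        rw [hf₂ 1 h1w, hf 1 (by simp [h1w, Ne.symm hi1, Ne.symm hm1]), h1]
      refine ih (j + 1) (by omega) _ (fun r hr => ?_) ?_ ?_ (hI₂ _ ⟨rfl, fun r hri hrm => ?_⟩)
      · simp only [List.mem_cons, not_or] at hr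
        simp only [State.setReg_reg, hr.1, hr.2.1, if_false]
        rw [hf₂ r hr.2.2]
        exact hf r (by simp [hr])
      · simp [him, hone, hf₂ i hi, hij]
      · simp [Ne.symm him, Ne.symm hi1, hone, hf₂ m hm, hmd]
      · simp [hri, hrm]
  refine Runs.mono_time (Runs.seq (Runs.const (Runs.seq (Runs.const (Runs.seq (Runs.add
    (loop (σ.reg N) 0 (by omega) _ ?_ ?_ ?_ (h0 _ ⟨rfl, ?_⟩)))))))) (by omega)
  · intro r hr
    simp only [List.mem_cons, not_or] at hr
    simp [hr]
  · simp [him]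
  · simp [hNi, hNm]
  · intro r h1 h2
    simp [h1, h2]

end Programs

/-! ### Graph search -/

section Search

/-- What the programs know about their input: a graph with two given vertices, whose adjacency
matrix is in the memory from the address `base`, the input ending before the address `len`. -/
structure Setup where
  n : ℕ
  s : ℕ
  t : ℕ
  base : ℕ
  len : ℕ
  A : ℕ → ℕ → Prop
  w : ℕ → ℕ
  le_len : base + n * n ≤ len
  lt_of_A : ∀ u v, A u v → u < n ∧ v < n
  w_ne_zero : ∀ u < n, ∀ v < n, (w (base + u * n + v) ≠ 0 ↔ A u v)
  s_lt : s < n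
  t_lt : t < n

variable (S : Setup)

/-- The registers that hold the parameters of the input. -/
structure Setup.Regs (σ : State) : Prop where
  len : σ.reg 0 = S.len
  one : σ.reg 1 = 1
  n : σ.reg 2 = S.n
  s : σ.reg 3 = S.s
  t : σ.reg 4 = S.t
  base : σ.reg 5 = S.base

variable {S} in
theorem Setup.Regs.congr {σ σ' : State} (h : S.Regs σ) (h' : ∀ r < 6, σ'.reg r = σ.reg r) :
    S.Regs σ' where
  len := by rw [h' 0 (by norm_num), h.len]
  one := by rw [h' 1 (by norm_num), h.one]
  n := by rw [h' 2 (by norm_num), h.n]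
  s := by rw [h' 3 (by norm_num), h.s]
  t := by rw [h' 4 (by norm_num), h.t]
  base := by rw [h' 5 (by norm_num), h.base]

/-- The input is still in the memory. -/
def Setup.Low (σ : State) : Prop := ∀ a < S.len, σ.mem a = S.w a

/-- The marked vertices are those in `M`. -/
def Setup.Marks (σ : State) (M : Set ℕ) : Prop := ∀ v < S.n, (σ.mem (S.len + v) ≠ 0 ↔ v ∈ M)

/-- The vertices reachable from `r` by walks that leave neither `x` nor `y`. -/
def Setup.reach (r x y : ℕ) : Set ℕ :=
  {v | Relation.ReflTransGen (fun u v => (u ≠ x ∧ u ≠ y) ∧ S.A u v) r v}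

/-- Mark the neighbours of a vertex if the register `22` is nonzero, its row of the matrix being
found at the address in register `19`. -/
def markRow : Cmd :=
  forLoop 25 26 2 (.ite 22 (.load 24 19 ;; .ite 24 (.add 15 0 25 ;; .store 15 1) .skip) .skip ;;
    .add 19 19 1)

/-- Mark the neighbours of the vertex in register `20` if it is marked and not in the registers
`11`, `12`. -/
def markFrom : Cmd :=
  .add 15 0 20 ;; .load 22 15 ;;
  .sub 23 20 11 ;; .sub 24 11 20 ;; .add 23 23 24 ;; .ite 23 .skip (.const 22 0) ;;
  .sub 23 20 12 ;; .sub 24 12 20 ;; .add 23 23 24 ;; .ite 23 .skip (.const 22 0) ;; markRow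

/-- Mark the neighbours of all marked vertices. -/
def markRound : Cmd := .const 19 0 ;; .add 19 19 5 ;; forLoop 20 21 2 markFrom

/-- Mark the vertices reachable from the vertex in register `10` by walks that do not leave the
vertices in the registers `11`, `12`. -/
def search : Cmd :=
  forLoop 13 14 2 (.const 16 0 ;; .add 15 0 13 ;; .store 15 16) ;;
  .add 15 0 10 ;; .store 15 1 ;; forLoop 17 18 2 markRound

variable {S} {σ : State}

theorem runs_markRow (hσ : S.Regs σ) (hlow : S.Low σ) {M : Set ℕ} (hM : S.Marks σ M) {u : ℕ}
    (hu : u < S.n) (hptr : σ.reg 19 = S.base + u * S.n) :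
    Runs markRow σ (fun σ' => S.Low σ' ∧ σ'.reg 19 = S.base + (u + 1) * S.n ∧
      S.Marks σ' (M ∪ {v | σ.reg 22 ≠ 0 ∧ S.A u v})) (S.n * 9 + 4) := by
  have hrow : u * S.n + S.n ≤ S.n * S.n := by
    rw [← Nat.succ_mul]
    exact Nat.mul_le_mul_right _ hu
  have hle := S.le_len
  let I : ℕ → State → Prop := fun j σ' => S.Low σ' ∧ σ'.reg 19 = S.base + u * S.n + j ∧
    S.Marks σ' (M ∪ {v | v < j ∧ σ.reg 22 ≠ 0 ∧ S.A u v})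
  have hloop := Runs.forLoop (i := 25) (m := 26) (N := 2) (I := I) (T := 6) (σ := σ)
    (c := .ite 22 (.load 24 19 ;; .ite 24 (.add 15 0 25 ;; .store 15 1) .skip) .skip ;;
      .add 19 19 1) (by decide) hσ.one ?_ ?_
  · rw [hσ.n] at hloop
    refine Runs.mono hloop (by omega) ?_
    rintro σ' ⟨h1, h2, h3⟩
    refine ⟨h1, by rw [h2]; ring, fun v hv => ?_⟩
    rw [h3 v hv]
    simp [hv]
  · rintro σ' ⟨hmem, hreg⟩
    refine ⟨fun a ha => by rw [hmem, hlow a ha], by simp [hreg, hptr], fun v hv => ?_⟩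
    rw [hmem, hM v hv]
    simp
  · rintro j hj σ₁ hf hj₁ ⟨hl, hp, hm⟩
    rw [hσ.n] at hj
    have h22 : σ₁.reg 22 = σ.reg 22 := hf 22 (by decide)
    have h1 : σ₁.reg 1 = 1 := (hf 1 (by decide)).trans hσ.one
    have h0 : σ₁.reg 0 = S.len := (hf 0 (by decide)).trans hσ.len
    have hw : σ₁.mem (σ₁.reg 19) ≠ 0 ↔ S.A u j := by
      rw [hp, hl _ (by omega)]
      exact S.w_ne_zero u hu j hj
    -- nothing is marked in this step
    have hno : ¬ (σ.reg 22 ≠ 0 ∧ S.A u j) → ∀ σ₃ : State, σ₃.mem = σ₁.mem →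
        σ₃.reg 19 = σ₁.reg 19 + 1 → I (j + 1) σ₃ := by
      intro hn σ₃ hmem h19
      refine ⟨fun a ha => by rw [hmem, hl a ha], by rw [h19, hp]; ring, fun v hv => ?_⟩
      rw [hmem, hm v hv]
      refine or_congr_right (and_congr_left fun hA => ?_)
      have : v ≠ j := by rintro rfl; exact hn hA
      omega
    refine Runs.seq (T₁ := 5) (T₂ := 1) (Runs.ite (fun hr => ?_) fun hr => ?_)
    · refine Runs.seq (T₁ := 1) (T₂ := 3) (Runs.load (Runs.ite (T := 2) (fun hr' => ?_) fun hr' => ?_))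
      · simp only [State.setReg_reg, if_true] at hr'
        refine Runs.seq (T₁ := 1) (T₂ := 1) (Runs.add (Runs.store (Runs.add ?_)))
        rintro σ₃ ⟨hmem, hreg⟩
        refine ⟨fun a ha => ?_, by simp [hreg, hp, h1]; ring, fun v hv => ?_⟩
        · have : a ≠ S.len + j := by omega
          simp [hmem, h0, hj₁, this, hl a ha]
        · have h := hm v hv
          simp only [hmem, State.setReg_mem, State.setMem_mem, State.setReg_reg]
          by_cases hvj : v = j
          · subst hvj
            simpa [h0, hj₁, h1] using Or.inr ⟨h22 ▸ hr, hw.1 hr'⟩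
          · have : S.len + v ≠ S.len + j := by omega
            simp only [h0, hj₁]
            simp only [reduceIte, Nat.reduceEqDiff, this, if_false]
            rw [h]
            refine or_congr_right (and_congr_left fun _ => ?_)
            omega
      · simp only [State.setReg_reg, if_true] at hr'
        refine (Runs.skip (Runs.add ?_)).mono_time (by norm_num)
        rintro σ₃ ⟨hmem, hreg⟩
        exact hno (fun h => hw.2 h.2 hr') σ₃ (by simp [hmem]) (by simp [hreg, h1])
    · refine (Runs.skip (Runs.add ?_)).mono_time (by norm_num)
      rintro σ₃ ⟨hmem, hreg⟩
      exact hno (fun h => h.1 (h22 ▸ hr)) σ₃ (by simp [hmem]) (by simp [hreg, h1])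

/-- With truncated subtraction, `(u - x) + (x - u)` vanishes exactly when `u = x`. Register 19 is
advanced past each row, so row addresses need no multiplication. -/
theorem runs_markFrom (hσ : S.Regs σ) (hlow : S.Low σ) {M : Set ℕ} (hM : S.Marks σ M) {u x y : ℕ}
    (hu : u < S.n) (hptr : σ.reg 19 = S.base + u * S.n) (h20 : σ.reg 20 = u) (hx : σ.reg 11 = x)
    (hy : σ.reg 12 = y) :
    Runs markFrom σ (fun σ' => S.Low σ' ∧ σ'.reg 19 = S.base + (u + 1) * S.n ∧
      S.Marks σ' (M ∪ {v | u ∈ M ∧ (u ≠ x ∧ u ≠ y) ∧ S.A u v})) (S.n * 9 + 16) := by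
  have hMu := hM u hu
  have fin : ∀ σ' : State, (∀ r, r ∉ [15, 22, 23, 24] → σ'.reg r = σ.reg r) → σ'.mem = σ.mem →
      (σ'.reg 22 ≠ 0 ↔ u ∈ M ∧ u ≠ x ∧ u ≠ y) →
      Runs markRow σ' (fun σ' => S.Low σ' ∧ σ'.reg 19 = S.base + (u + 1) * S.n ∧
      S.Marks σ' (M ∪ {v | u ∈ M ∧ (u ≠ x ∧ u ≠ y) ∧ S.A u v})) (S.n * 9 + 4) := by
    intro σ' hreg hmem h22
    refine Runs.mono (runs_markRow (hσ.congr fun r hr => hreg r (by simp; omega))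
      (M := M) (fun a ha => by rw [hmem, hlow a ha])
      (fun v hv => by rw [hmem, hM v hv]) hu (by rw [hreg 19 (by decide), hptr])) le_rfl ?_
    rintro σ₂ ⟨h1, h2, h3⟩
    refine ⟨h1, h2, ?_⟩
    simp only [h22] at h3
    simpa only [and_assoc] using h3
  refine Runs.mono_time (Runs.seq (Runs.add (Runs.seq (Runs.load (Runs.seq (Runs.sub (Runs.seq
    (Runs.sub (Runs.seq (Runs.add (Runs.seq (T₁ := 2) (T₂ := 5 + (S.n * 9 + 4))
      (Runs.ite (T := 1) (fun h1 => Runs.skip ?_) (fun h1 => Runs.const ?_))))))))))))) (by omega)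
  all_goals
    refine Runs.mono_time (Runs.seq (Runs.sub (Runs.seq
      (Runs.sub (Runs.seq (Runs.add (Runs.seq (T₁ := 2) (T₂ := S.n * 9 + 4)
      (Runs.ite (T := 1) (fun h2 => Runs.skip (fin _ ?_ ?_ ?_))
        (fun h2 => Runs.const (fin _ ?_ ?_ ?_)))))))))) (by omega)
  all_goals
    first
    | rfl
    | (intro r hr
       simp only [List.mem_cons, List.not_mem_nil, or_false, not_or] at hr
       simp [hr])
    | skip
  all_goals
    clear fin
    simp [h20, hx, hy, hσ.len] at h1 h2 ⊢
    first
    | (simp_all; done)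
    | (simp_all; intro _; omega)

/-- Vertices marked during the round may be expanded in the same round, so the new set is not
determined exactly. It suffices that it contains all permitted successors of `M` and nothing
unreachable. -/
theorem runs_markRound (hσ : S.Regs σ) (hlow : S.Low σ) {M : Set ℕ} (hM : S.Marks σ M) {x y : ℕ}
    (hx : σ.reg 11 = x) (hy : σ.reg 12 = y) :
    Runs markRound σ (fun σ' => S.Low σ' ∧ ∃ M', S.Marks σ' M' ∧ M ⊆ M' ∧
      (∀ u ∈ M, u ≠ x ∧ u ≠ y → ∀ v, S.A u v → v ∈ M') ∧
      ∀ r, M ⊆ S.reach r x y → M' ⊆ S.reach r x y) (S.n * (S.n * 9 + 19) + 6) := by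
  let I : ℕ → State → Prop := fun j σ' => S.Low σ' ∧ σ'.reg 19 = S.base + j * S.n ∧
    ∃ M', S.Marks σ' M' ∧ M ⊆ M' ∧
      (∀ u ∈ M, u < j → u ≠ x ∧ u ≠ y → ∀ v, S.A u v → v ∈ M') ∧
      ∀ r, M ⊆ S.reach r x y → M' ⊆ S.reach r x y
  refine Runs.mono_time (T₁ := 1 + (1 + (S.n * (S.n * 9 + 16 + 3) + 4))) ?_ (by ring_nf; omega)
  refine Runs.seq (Runs.const (Runs.seq (Runs.add ?_)))
  set σ₀ := (σ.setReg 19 0).setReg 19 ((σ.setReg 19 0).reg 19 + (σ.setReg 19 0).reg 5) with hσ₀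
  have hr0 : ∀ r, r ≠ 19 → σ₀.reg r = σ.reg r := fun r hr => by simp [hσ₀, hr]
  have hσ' : S.Regs σ₀ := hσ.congr fun r hr => hr0 r (by omega)
  have hloop := Runs.forLoop (i := 20) (m := 21) (N := 2) (I := I) (T := S.n * 9 + 16) (σ := σ₀)
    (c := markFrom) (by decide) hσ'.one ?_ ?_
  · rw [hσ'.n] at hloop
    refine Runs.mono hloop le_rfl ?_
    rintro σ' ⟨h1, -, M', h2, h3, h4, h5⟩
    exact ⟨h1, M', h2, h3, fun u hu hB v hA => h4 u hu (S.lt_of_A u v hA).1 hB v hA, h5⟩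
  · rintro σ' ⟨hmem, hreg⟩
    refine ⟨fun a ha => by rw [hmem]; exact hlow a ha, ?_, M, fun v hv => by rw [hmem]; exact hM v hv,
      subset_rfl, fun u _ hu => absurd hu (by omega), fun _ => id⟩
    rw [hreg 19 (by decide) (by decide)]
    simp [hσ₀, hσ.base]
  · rintro j hj σ₁ hf hj₁ ⟨hl, hp, M', hm, hMM, hcl, hre⟩
    rw [hσ'.n] at hj
    have hregs : S.Regs σ₁ := hσ'.congr fun r hr => hf r (by
      revert r
      decide)
    refine Runs.mono (runs_markFrom hregs hl hm hj hp hj₁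
      (by rw [hf 11 (by decide), hr0 11 (by decide), hx])
      (by rw [hf 12 (by decide), hr0 12 (by decide), hy])) le_rfl ?_
    rintro σ₂ ⟨h1, h2, h3⟩ σ₃ ⟨hmem, hreg⟩
    refine ⟨fun a ha => by rw [hmem, h1 a ha], by rw [hreg 19 (by decide) (by decide), h2],
      _, fun v hv => by rw [hmem]; exact h3 v hv, hMM.trans Set.subset_union_left, ?_, ?_⟩
    · intro u hu huj hB v hA
      rcases Nat.lt_succ_iff_lt_or_eq.1 huj with h | rfl
      · exact Or.inl (hcl u hu h hB v hA)
      · exact Or.inr ⟨hMM hu, hB, hA⟩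
    · intro r hr
      refine Set.union_subset (hre r hr) ?_
      rintro v ⟨hj, hB, hA⟩
      exact (hre r hr hj).tail ⟨hB, hA⟩

theorem runs_search (hσ : S.Regs σ) (hlow : S.Low σ) {r x y : ℕ} (hr : σ.reg 10 = r)
    (hrn : r < S.n) (hx : σ.reg 11 = x) (hy : σ.reg 12 = y) :
    Runs search σ (fun σ' => S.Low σ' ∧ S.Marks σ' (S.reach r x y))
      (S.n * (S.n * (S.n * 9 + 19) + 9) + S.n * 6 + 10) := by
  classical
  have hle := S.le_len
  -- clear the marks
  let I₁ : ℕ → State → Prop := fun j σ' => S.Low σ' ∧ ∀ v < j, σ'.mem (S.len + v) = 0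
  have hclear := Runs.forLoop (i := 13) (m := 14) (N := 2) (I := I₁) (T := 3) (σ := σ)
    (c := .const 16 0 ;; .add 15 0 13 ;; .store 15 16) (by decide) hσ.one
    (by
      rintro σ' ⟨hmem, -⟩
      exact ⟨fun a ha => by rw [hmem, hlow a ha], fun v hv => absurd hv (by omega)⟩)
    (by
      rintro j hj σ₁ hf hj₁ ⟨hl, hm⟩
      have h0 : σ₁.reg 0 = S.len := (hf 0 (by decide)).trans hσ.len
      refine Runs.seq (T₁ := 1) (T₂ := 2) (Runs.const (Runs.seq (T₁ := 1) (T₂ := 1)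
        (Runs.add (Runs.store ?_))))
      rintro σ₃ ⟨hmem, -⟩
      refine ⟨fun a ha => ?_, fun v hv => ?_⟩
      · have : a ≠ S.len + j := by omega
        simp [hmem, h0, hj₁, this, hl a ha]
      · by_cases hvj : v = j
        · simp [hmem, h0, hj₁, hvj]
        · simp [hmem, h0, hj₁, hvj, hm v (by omega)])
  rw [hσ.n] at hclear
  refine Runs.mono_time (T₁ := S.n * (3 + 3) + 4 + (1 + (1 +
    (S.n * (S.n * (S.n * 9 + 19) + 6 + 3) + 4)))) ?_ (by ring_nf; omega)
  refine Runs.seq (Runs.mono hclear.frame le_rfl ?_)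
  rintro σ₁ ⟨⟨hl₁, hm₁⟩, hf₁⟩
  have hσ₁ : S.Regs σ₁ := hσ.congr fun i hi => hf₁ i (by revert i; decide)
  have h10 : σ₁.reg 10 = r := by rw [hf₁ 10 (by decide), hr]
  refine Runs.seq (Runs.add (Runs.seq (Runs.store ?_)))
  set σ₂ := (σ₁.setReg 15 (σ₁.reg 0 + σ₁.reg 10)).setMem
    ((σ₁.setReg 15 (σ₁.reg 0 + σ₁.reg 10)).reg 15)
    ((σ₁.setReg 15 (σ₁.reg 0 + σ₁.reg 10)).reg 1) with hσ₂
  have hreg₂ : ∀ i, i ≠ 15 → σ₂.reg i = σ₁.reg i := fun i hi => by simp [hσ₂, hi]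
  have hmem₂ : ∀ a, σ₂.mem a = if a = S.len + r then 1 else σ₁.mem a := fun a => by
    simp [hσ₂, hσ₁.len, h10, hσ₁.one]
  have hσ₂' : S.Regs σ₂ := hσ₁.congr fun i hi => hreg₂ i (by omega)
  -- Each round marks a new vertex unless the marked set is already closed. There are only `n`
  -- vertices, so after `n` rounds it is closed and equals the reachable set.
  let I : ℕ → State → Prop := fun j σ' => S.Low σ' ∧ ∃ M : Set ℕ, S.Marks σ' M ∧ r ∈ M ∧
    M ⊆ S.reach r x y ∧
    ((∀ u ∈ M, u ≠ x ∧ u ≠ y → ∀ v, S.A u v → v ∈ M) ∨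
      j < ((Finset.range S.n).filter (· ∈ M)).card)
  have hloop := Runs.forLoop (i := 17) (m := 18) (N := 2) (I := I)
    (T := S.n * (S.n * 9 + 19) + 6) (σ := σ₂) (c := markRound) (by decide) hσ₂'.one ?_ ?_
  · rw [hσ₂'.n] at hloop
    refine Runs.mono hloop le_rfl ?_
    rintro σ' ⟨h1, M, h2, h3, h4, h5⟩
    have h5 := h5.resolve_right (by
      have := Finset.card_filter_le (Finset.range S.n) (· ∈ M)
      rw [Finset.card_range] at this
      omega)
    have : M = S.reach r x y := by
      refine h4.antisymm fun v hv => ?_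
      induction hv with
      | refl => exact h3
      | tail _ h ih => exact h5 _ ih h.1 _ h.2
    exact ⟨h1, this ▸ h2⟩
  · rintro σ' ⟨hmem, -⟩
    refine ⟨fun a ha => ?_, {r}, fun v hv => ?_, rfl, ?_, Or.inr ?_⟩
    · rw [hmem, hmem₂, if_neg (by omega), hl₁ a ha]
    · rw [hmem, hmem₂]
      by_cases hvr : v = r
      · simp [hvr]
      · simp [hvr, hm₁ v hv]
    · rintro _ rfl
      exact Relation.ReflTransGen.refl
    · exact Finset.card_pos.2 ⟨r, by simp [hrn]⟩
  · rintro j hj σ₃ hf hj₁ ⟨hl, M, hm, hrM, hMr, hdone⟩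
    have hregs : S.Regs σ₃ := hσ₂'.congr fun i hi => hf i (by revert i; decide)
    have h11 : σ₃.reg 11 = x := by
      rw [hf 11 (by decide), hreg₂ 11 (by decide), hf₁ 11 (by decide), hx]
    have h12 : σ₃.reg 12 = y := by
      rw [hf 12 (by decide), hreg₂ 12 (by decide), hf₁ 12 (by decide), hy]
    refine Runs.mono (runs_markRound hregs hl hm h11 h12) le_rfl ?_
    rintro σ₄ ⟨h1, M', h2, h3, h4, h5⟩ σ₅ ⟨hmem, -⟩
    refine ⟨fun a ha => by rw [hmem, h1 a ha], M', fun v hv => by rw [hmem]; exact h2 v hv,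
      h3 hrM, h5 r hMr, ?_⟩
    have hsub : (Finset.range S.n).filter (· ∈ M) ⊆ (Finset.range S.n).filter (· ∈ M') :=
      Finset.monotone_filter_right _ fun v _ hv => h3 hv
    by_cases hc : ∀ u ∈ M, u ≠ x ∧ u ≠ y → ∀ v, S.A u v → v ∈ M
    · left
      have hreach : S.reach r x y ⊆ M := fun v hv => by
        induction hv with
        | refl => exact hrM
        | tail _ h ih => exact hc _ ih h.1 _ h.2
      exact fun u hu hB v hA => h3 (hc u (hreach (h5 r hMr hu)) hB v hA)
    · right
      have hj' := hdone.resolve_left hc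
      push Not at hc
      obtain ⟨u, hu, hB, v, hA, hv⟩ := hc
      refine lt_of_le_of_lt hj' (Finset.card_lt_card ⟨hsub, fun hsup => hv ?_⟩)
      have := hsup (Finset.mem_filter.2 ⟨Finset.mem_range.2 (S.lt_of_A u v hA).2, h4 u hu hB v hA⟩)
      exact (Finset.mem_filter.1 this).2

end Search

/-! ### Computing the separation number -/

section Separation

variable {S : Setup} {σ : State}

/-- `v` separates `s` from `t`, in terms of the search. -/
def Setup.IsCut (S : Setup) (v : ℕ) : Prop := v ≠ S.s ∧ v ≠ S.t ∧ S.t ∉ S.reach S.s v v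

/-- `v` is the least vertex of a component attached to `s` and `t`, in terms of the search. -/
def Setup.IsLeast (S : Setup) (v : ℕ) : Prop :=
  v ≠ S.s ∧ v ≠ S.t ∧ (S.s ∈ S.reach v S.s S.t ∧ S.t ∈ S.reach v S.s S.t) ∧
    ∀ u < v, u ≠ S.s → u ≠ S.t → u ∉ S.reach v S.s S.t

open Classical in
/-- The separation number, in terms of the search. -/
noncomputable def Setup.value (S : Setup) : ℕ :=
  if ∃ v < S.n, S.IsCut v then 1 else max ((Finset.range S.n).filter S.IsLeast).card 2

/-- Run `c` if the register `27` is different from the registers `3` and `4`. -/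
def unlessTerminal (c : Cmd) : Cmd :=
  .sub 29 27 3 ;; .sub 30 3 27 ;; .add 29 29 30 ;; .ite 29
    (.sub 29 27 4 ;; .sub 30 4 27 ;; .add 29 29 30 ;; .ite 29 c .skip) .skip

/-- Test whether the vertex in the register `27` is a cut vertex. -/
def testCut : Cmd :=
  .const 10 0 ;; .add 10 10 3 ;; .const 11 0 ;; .add 11 11 27 ;; .const 12 0 ;; .add 12 12 27 ;;
  search ;; .add 15 0 4 ;; .load 22 15 ;; .ite 22 .skip (.const 6 1)

/-- Count the vertex in the register `27` if it is the least one of a full component. -/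
def testLeast : Cmd :=
  .const 10 0 ;; .add 10 10 27 ;; .const 11 0 ;; .add 11 11 3 ;; .const 12 0 ;; .add 12 12 4 ;;
  search ;; .add 15 0 3 ;; .load 31 15 ;; .add 30 0 4 ;; .load 32 30 ;;
  .const 16 0 ;; .store 15 16 ;; .store 30 16 ;;
  .ite 31 (.ite 32 (.const 31 1) (.const 31 0)) .skip ;;
  forLoop 33 34 27 (.add 15 0 33 ;; .load 22 15 ;; .ite 22 (.const 31 0) .skip) ;;
  .add 7 7 31

/-- Compute the separation number in the register `8`. -/
def separation : Cmd :=
  .const 6 0 ;; forLoop 27 28 2 (unlessTerminal testCut) ;;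
  .const 7 0 ;; forLoop 27 28 2 (unlessTerminal testLeast) ;;
  .ite 6 (.const 8 1) (.const 8 2 ;; .sub 9 7 8 ;; .add 8 8 9)

theorem runs_unlessTerminal (hσ : S.Regs σ) {v : ℕ} (hv : σ.reg 27 = v) {c : Cmd}
    {Q : State → Prop} {T : ℕ} (hT : 0 < T)
    (h : v ≠ S.s → v ≠ S.t → ∀ σ' : State, σ'.mem = σ.mem →
      (∀ r, r ≠ 29 → r ≠ 30 → σ'.reg r = σ.reg r) → Runs c σ' Q T)
    (h' : v = S.s ∨ v = S.t → ∀ σ' : State, σ'.mem = σ.mem →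
      (∀ r, r ≠ 29 → r ≠ 30 → σ'.reg r = σ.reg r) → Q σ') :
    Runs (unlessTerminal c) σ Q (T + 8) := by
  refine Runs.mono_time (Runs.seq (Runs.sub (Runs.seq (Runs.sub (Runs.seq (Runs.add
    (Runs.ite (T := T + 4) (fun h1 => ?_) (fun h1 => Runs.mono_time (Runs.skip ?_) (by omega)))))))))
    (by omega)
  · refine Runs.mono_time (Runs.seq (Runs.sub (Runs.seq (Runs.sub (Runs.seq (Runs.add
      (Runs.ite (T := T) (fun h2 => ?_) (fun h2 => Runs.mono_time (Runs.skip ?_) (by omega)))))))))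
      (by omega)
    · simp [hv, hσ.s, hσ.t] at h1 h2
      exact h (by omega) (by omega) _ rfl fun r h3 h4 => by simp [h3, h4]
    · simp [hv, hσ.s, hσ.t] at h1 h2
      exact h' (by omega) _ rfl fun r h3 h4 => by simp [h3, h4]
  · simp [hv, hσ.s] at h1
    exact h' (by omega) _ rfl fun r h3 h4 => by simp [h3, h4]

/-- The running time of `search`. -/
def searchTime (n : ℕ) : ℕ := n * (n * (n * 9 + 19) + 9) + n * 6 + 10

theorem runs_testCut (hσ : S.Regs σ) (hlow : S.Low σ) {v : ℕ} (hv : σ.reg 27 = v) :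
    Runs testCut σ (fun σ' => S.Low σ' ∧
      (σ'.reg 6 ≠ 0 ↔ σ.reg 6 ≠ 0 ∨ S.t ∉ S.reach S.s v v)) (searchTime S.n + 10) := by
  refine Runs.mono_time (Runs.seq (Runs.const (Runs.seq (Runs.add (Runs.seq (Runs.const
    (Runs.seq (Runs.add (Runs.seq (Runs.const (Runs.seq (Runs.add (Runs.seq (T₁ := searchTime S.n)
    (T₂ := 4) ?_))))))))))))) (by omega)
  refine Runs.mono (runs_search (S := S) (r := S.s) (x := v) (y := v)
    (hσ.congr fun r hr => ?_) (fun a ha => ?_) ?_ S.s_lt ?_ ?_).frame le_rfl ?_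
  · have h1 : r ≠ 10 := by omega
    have h2 : r ≠ 11 := by omega
    have h3 : r ≠ 12 := by omega
    simp [h1, h2, h3]
  · exact hlow a ha
  · simp [hσ.s]
  · simp [hv]
  · simp [hv]
  rintro σ₁ ⟨⟨hl, hm⟩, hf⟩
  have h0 : σ₁.reg 0 = S.len := by rw [hf 0 (by decide)]; simp [hσ.len]
  have h4 : σ₁.reg 4 = S.t := by rw [hf 4 (by decide)]; simp [hσ.t]
  have h6 : σ₁.reg 6 = σ.reg 6 := by rw [hf 6 (by decide)]; simp
  have hmt := hm S.t S.t_lt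
  refine Runs.seq (T₁ := 1) (T₂ := 3) (Runs.add (Runs.seq (T₁ := 1) (T₂ := 2) (Runs.load
    (Runs.ite (fun h => Runs.skip ⟨fun a ha => hl a ha, ?_⟩)
    (fun h => Runs.const ⟨fun a ha => hl a ha, ?_⟩)))))
  · simp [h0, h4] at h
    simp [h6, hmt.1 h]
  · simp [h0, h4] at h
    have : S.t ∉ S.reach S.s v v := fun h' => hmt.2 h' h
    simp [this]

/-- Being marked tells that `s` or `t` is adjacent to the component. Once this is recorded both
marks are erased, so the scan of smaller vertices needs no exception for them. -/
theorem runs_testLeast (hσ : S.Regs σ) (hlow : S.Low σ) {v : ℕ} (hv : σ.reg 27 = v) (hvn : v < S.n)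
    (hvs : v ≠ S.s) (hvt : v ≠ S.t) :
    Runs testLeast σ (fun σ' => S.Low σ' ∧ (S.IsLeast v → σ'.reg 7 = σ.reg 7 + 1) ∧
      (¬ S.IsLeast v → σ'.reg 7 = σ.reg 7)) (searchTime S.n + S.n * 7 + 21) := by
  classical
  have hle := S.le_len
  refine Runs.mono_time (Runs.seq (Runs.const (Runs.seq (Runs.add (Runs.seq (Runs.const
    (Runs.seq (Runs.add (Runs.seq (Runs.const (Runs.seq (Runs.add (Runs.seq (T₁ := searchTime S.n)
    (T₂ := S.n * 7 + 15) ?_))))))))))))) (by omega)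
  refine Runs.mono (runs_search (S := S) (r := v) (x := S.s) (y := S.t)
    (hσ.congr fun r hr => ?_) (fun a ha => ?_) ?_ hvn ?_ ?_).frame le_rfl ?_
  · have h1 : r ≠ 10 := by omega
    have h2 : r ≠ 11 := by omega
    have h3 : r ≠ 12 := by omega
    simp [h1, h2, h3]
  · exact hlow a ha
  · simp [hv]
  · simp [hσ.s]
  · simp [hσ.t]
  rintro σ₁ ⟨⟨hl, hm⟩, hf⟩
  set R := S.reach v S.s S.t
  have hσ₁ : S.Regs σ₁ := hσ.congr fun r hr => by
    rw [hf r (by revert r; decide)]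
    have h1 : r ≠ 10 := by omega
    have h2 : r ≠ 11 := by omega
    have h3 : r ≠ 12 := by omega
    simp [h1, h2, h3]
  have h7 : σ₁.reg 7 = σ.reg 7 := by rw [hf 7 (by decide)]; simp
  have h27 : σ₁.reg 27 = v := by rw [hf 27 (by decide)]; simp [hv]
  clear hf
  have hms := hm S.s S.s_lt
  have hmt := hm S.t S.t_lt
  -- the loop over the smaller vertices
  have fin : ∀ σ₂ : State, (∀ r, r ∉ [15, 16, 30, 31, 32] → σ₂.reg r = σ₁.reg r) →
      (∀ a, σ₂.mem a = if a = S.len + S.s ∨ a = S.len + S.t then 0 else σ₁.mem a) →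
      (S.s ∈ R ∧ S.t ∈ R → σ₂.reg 31 = 1) → (¬ (S.s ∈ R ∧ S.t ∈ R) → σ₂.reg 31 = 0) →
      Runs (forLoop 33 34 27 (.add 15 0 33 ;; .load 22 15 ;; .ite 22 (.const 31 0) .skip) ;;
        .add 7 7 31) σ₂ (fun σ' => S.Low σ' ∧ (S.IsLeast v → σ'.reg 7 = σ.reg 7 + 1) ∧
      (¬ S.IsLeast v → σ'.reg 7 = σ.reg 7)) (S.n * 7 + 5) := by
    intro σ₂ hreg hmem hflag hflag'
    have hσ₂ : S.Regs σ₂ := hσ₁.congr fun r hr => hreg r (by revert r; decide)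
    have h27' : σ₂.reg 27 = v := by rw [hreg 27 (by decide), h27]
    let I : ℕ → State → Prop := fun j σ' => σ'.mem = σ₂.mem ∧
      ((S.s ∈ R ∧ S.t ∈ R ∧ ∀ u < j, u ≠ S.s → u ≠ S.t → u ∉ R) → σ'.reg 31 = 1) ∧
      (¬ (S.s ∈ R ∧ S.t ∈ R ∧ ∀ u < j, u ≠ S.s → u ≠ S.t → u ∉ R) → σ'.reg 31 = 0)
    have hloop := Runs.forLoop (i := 33) (m := 34) (N := 27) (I := I) (T := 4) (σ := σ₂)
      (c := .add 15 0 33 ;; .load 22 15 ;; .ite 22 (.const 31 0) .skip) (by decide) hσ₂.one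
      ?_ ?_
    · rw [h27'] at hloop
      refine Runs.mono_time (Runs.seq (Runs.mono hloop.frame le_rfl ?_)) (T₁ := v * 7 + 4 + 1)
        (by omega)
      rintro σ₃ ⟨⟨hmem₃, h1, h2⟩, hf₃⟩
      have h7' : σ₃.reg 7 = σ.reg 7 := by rw [hf₃ 7 (by decide), hreg 7 (by decide), h7]
      refine Runs.add ⟨fun a ha => ?_, fun h => ?_, fun h => ?_⟩
      · have : ¬ (a = S.len + S.s ∨ a = S.len + S.t) := by omega
        rw [State.setReg_mem, hmem₃, hmem, if_neg this, hl a ha]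
      · have := h1 ⟨h.2.2.1.1, h.2.2.1.2, h.2.2.2⟩
        simp [this, h7']
      · have := h2 fun h' => h ⟨hvs, hvt, ⟨h'.1, h'.2.1⟩, h'.2.2⟩
        simp [this, h7']
    · rintro σ' ⟨hmem', hreg'⟩
      have h31 := hreg' 31 (by decide) (by decide)
      refine ⟨hmem', fun h => ?_, fun h => ?_⟩
      · rw [h31, hflag ⟨h.1, h.2.1⟩]
      · rw [h31, hflag' fun h' => h ⟨h'.1, h'.2, by simp⟩]
    · rintro j hj σ₃ hf₃ hj₃ ⟨hmem₃, h1, h2⟩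
      rw [h27'] at hj
      have h0 : σ₃.reg 0 = S.len := by rw [hf₃ 0 (by decide), hσ₂.len]
      have hmj : σ₃.mem (S.len + j) ≠ 0 ↔ j ≠ S.s ∧ j ≠ S.t ∧ j ∈ R := by
        rw [hmem₃, hmem]
        by_cases h : j = S.s ∨ j = S.t
        · rw [if_pos (by omega)]
          simp only [ne_eq, not_true_eq_false, false_iff, not_and]
          intro h3 h4
          omega
        · rw [if_neg (by omega), hm j (by omega)]
          rw [not_or] at h
          simp [h.1, h.2]
      refine Runs.seq (T₁ := 1) (T₂ := 3) (Runs.add (Runs.seq (T₁ := 1) (T₂ := 2) (Runs.load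
        (Runs.ite (fun h => Runs.const ?_) (fun h => Runs.skip ?_)))))
      · rintro σ₄ ⟨hmem₄, hreg₄⟩
        have h31 := hreg₄ 31 (by decide) (by decide)
        simp [h0, hj₃] at h h31
        have hmj := hmj.1 h
        refine ⟨by rw [hmem₄]; exact hmem₃, fun h' => ?_, fun _ => h31⟩
        exact absurd hmj.2.2 (h'.2.2 j (by omega) hmj.1 hmj.2.1)
      · rintro σ₄ ⟨hmem₄, hreg₄⟩
        have h31 := hreg₄ 31 (by decide) (by decide)
        simp [h0, hj₃] at h h31
        refine ⟨by rw [hmem₄]; exact hmem₃, fun h' => ?_, fun h' => ?_⟩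
        · rw [h31, h1 ⟨h'.1, h'.2.1, fun u hu => h'.2.2 u (by omega)⟩]
        · rw [h31, h2 fun h3 => h' ⟨h3.1, h3.2.1, fun u hu hus hut hR => ?_⟩]
          rcases Nat.lt_succ_iff_lt_or_eq.1 hu with hu | rfl
          · exact h3.2.2 u hu hus hut hR
          · exact hmj.2 ⟨hus, hut, hR⟩ h
  refine Runs.mono_time (Runs.seq (Runs.add (Runs.seq (Runs.load (Runs.seq (Runs.add
    (Runs.seq (Runs.load (Runs.seq (Runs.const (Runs.seq (Runs.store (Runs.seq (Runs.store
    (Runs.seq (T₁ := 3) (T₂ := S.n * 7 + 5) (Runs.ite (fun h1 => Runs.ite (fun h2 => Runs.const ?_)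
    (fun h2 => Runs.const ?_)) (fun h1 => Runs.mono_time (Runs.skip ?_)
    (by norm_num)))))))))))))))))) (by omega)
  all_goals
    simp [hσ₁.len, hσ₁.s, hσ₁.t] at h1
    try simp [hσ₁.len, hσ₁.s, hσ₁.t] at h2
    refine fin _ ?_ ?_ ?_ ?_
    · intro r hr
      simp only [List.mem_cons, List.not_mem_nil, or_false, not_or] at hr
      simp [hr]
    · intro a
      simp [hσ₁.len, hσ₁.s, hσ₁.t]
      grind
    · simp [hσ₁.len, hσ₁.s, hσ₁.t] <;> grind
    · simp [hσ₁.len, hσ₁.s, hσ₁.t] <;> grind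

end Separation

/-! ### The two programs -/

section MainPrograms

variable {S : Setup} {σ : State}

/-- The running time of `separation`. -/
def separationTime (n : ℕ) : ℕ :=
  n * (searchTime n + 21) + n * (searchTime n + n * 7 + 32) + 14

theorem runs_separation (hσ : S.Regs σ) (hlow : S.Low σ) :
    Runs separation σ (fun σ' => S.Low σ' ∧ σ'.reg 8 = S.value) (separationTime S.n) := by
  classical
  refine Runs.mono_time (T₁ := 1 + ((S.n * (searchTime S.n + 10 + 8 + 3) + 4) + (1 +
    ((S.n * (searchTime S.n + S.n * 7 + 21 + 8 + 3) + 4) + 4)))) ?_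
    (by unfold separationTime; ring_nf; omega)
  refine Runs.seq (Runs.const (Runs.seq ?_))
  have hσ₀ : S.Regs (σ.setReg 6 0) := hσ.congr fun r hr => by simp; omega
  let I₁ : ℕ → State → Prop := fun j σ' => S.Low σ' ∧ (σ'.reg 6 ≠ 0 ↔ ∃ v < j, S.IsCut v)
  have hloop₁ := Runs.forLoop (i := 27) (m := 28) (N := 2) (I := I₁) (T := searchTime S.n + 10 + 8)
    (σ := σ.setReg 6 0) (c := unlessTerminal testCut) (by decide) hσ₀.one
    (by
      rintro σ' ⟨hmem, hreg⟩
      refine ⟨fun a ha => by rw [hmem]; exact hlow a ha, ?_⟩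
      rw [hreg 6 (by decide) (by decide)]
      simp)
    (by
      rintro j hj σ₁ hf hj₁ ⟨hl, hI⟩
      have hσ₁ : S.Regs σ₁ := hσ₀.congr fun r hr => hf r (by revert r; decide)
      refine runs_unlessTerminal hσ₁ hj₁ (by omega) ?_ ?_
      · intro hjs hjt σ₂ hmem hreg
        refine Runs.mono (runs_testCut (hσ₁.congr fun r hr => hreg r (by omega) (by omega))
          (fun a ha => by rw [hmem, hl a ha]) ((hreg 27 (by decide) (by decide)).trans hj₁))
          le_rfl ?_
        rintro σ₃ ⟨h1, h2⟩ σ₄ ⟨hmem₄, hreg₄⟩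
        refine ⟨fun a ha => by rw [hmem₄, h1 a ha], ?_⟩
        rw [hreg₄ 6 (by decide) (by decide), h2, hreg 6 (by decide) (by decide), hI]
        constructor
        · rintro (⟨v, hv, h⟩ | h)
          · exact ⟨v, by omega, h⟩
          · exact ⟨j, by omega, hjs, hjt, h⟩
        · rintro ⟨v, hv, h⟩
          rcases Nat.lt_succ_iff_lt_or_eq.1 hv with hv | rfl
          · exact Or.inl ⟨v, hv, h⟩
          · exact Or.inr h.2.2
      · rintro hj' σ₂ hmem hreg σ₃ ⟨hmem₃, hreg₃⟩
        refine ⟨fun a ha => by rw [hmem₃, hmem, hl a ha], ?_⟩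
        rw [hreg₃ 6 (by decide) (by decide), hreg 6 (by decide) (by decide), hI]
        constructor
        · rintro ⟨v, hv, h⟩
          exact ⟨v, by omega, h⟩
        · rintro ⟨v, hv, h⟩
          rcases Nat.lt_succ_iff_lt_or_eq.1 hv with hv | rfl
          · exact ⟨v, hv, h⟩
          · exact absurd hj' (not_or.2 ⟨h.1, h.2.1⟩))
  rw [hσ₀.n] at hloop₁
  refine Runs.mono hloop₁.frame le_rfl ?_
  rintro σ₁ ⟨⟨hl₁, hI₁⟩, hf₁⟩
  have hσ₁ : S.Regs σ₁ := hσ₀.congr fun r hr => hf₁ r (by revert r; decide)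
  clear hf₁ hloop₁
  refine Runs.seq (Runs.const (Runs.seq ?_))
  have hσ₂ : S.Regs (σ₁.setReg 7 0) := hσ₁.congr fun r hr => by simp; omega
  let I₂ : ℕ → State → Prop := fun j σ' => S.Low σ' ∧
    σ'.reg 7 = ((Finset.range j).filter S.IsLeast).card
  have hloop₂ := Runs.forLoop (i := 27) (m := 28) (N := 2) (I := I₂)
    (T := searchTime S.n + S.n * 7 + 21 + 8)
    (σ := σ₁.setReg 7 0) (c := unlessTerminal testLeast) (by decide) hσ₂.one
    (by
      rintro σ' ⟨hmem, hreg⟩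
      refine ⟨fun a ha => by rw [hmem]; exact hl₁ a ha, ?_⟩
      rw [hreg 7 (by decide) (by decide)]
      simp)
    (by
      rintro j hj σ₃ hf hj₁ ⟨hl, hI⟩
      rw [hσ₂.n] at hj
      have hσ₃ : S.Regs σ₃ := hσ₂.congr fun r hr => hf r (by revert r; decide)
      refine runs_unlessTerminal hσ₃ hj₁ (by omega) ?_ ?_
      · intro hjs hjt σ₄ hmem hreg
        refine Runs.mono (runs_testLeast (hσ₃.congr fun r hr => hreg r (by omega) (by omega))
          (fun a ha => by rw [hmem, hl a ha]) ((hreg 27 (by decide) (by decide)).trans hj₁) hj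
          hjs hjt) le_rfl ?_
        rintro σ₅ ⟨h1, h2, h3⟩ σ₆ ⟨hmem₆, hreg₆⟩
        refine ⟨fun a ha => by rw [hmem₆, h1 a ha], ?_⟩
        rw [hreg₆ 7 (by decide) (by decide), Finset.range_add_one, Finset.filter_insert]
        have h7 : σ₄.reg 7 = ((Finset.range j).filter S.IsLeast).card :=
          (hreg 7 (by decide) (by decide)).trans hI
        by_cases h : S.IsLeast j
        · rw [h2 h, if_pos h, Finset.card_insert_of_notMem (by simp), h7]
        · rw [h3 h, if_neg h, h7]
      · rintro hj' σ₄ hmem hreg σ₅ ⟨hmem₅, hreg₅⟩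
        refine ⟨fun a ha => by rw [hmem₅, hmem, hl a ha], ?_⟩
        rw [hreg₅ 7 (by decide) (by decide), hreg 7 (by decide) (by decide), hI,
          Finset.range_add_one, Finset.filter_insert,
          if_neg fun h => absurd hj' (not_or.2 ⟨h.1, h.2.1⟩)])
  rw [hσ₂.n] at hloop₂
  refine Runs.mono hloop₂.frame le_rfl ?_
  rintro σ₃ ⟨⟨hl₃, hI₃⟩, hf₃⟩
  have h6 : σ₃.reg 6 = σ₁.reg 6 := by rw [hf₃ 6 (by decide)]; simp
  refine Runs.ite (T := 3) (fun h => ?_) fun h => ?_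
  · refine (Runs.const ⟨hl₃, ?_⟩).mono_time (by norm_num)
    rw [h6] at h
    simp [Setup.value, hI₁.1 h]
  -- The maximum of the count and 2 is computed as `2 + (count - 2)` with truncated subtraction.
  · refine Runs.seq (T₁ := 1) (T₂ := 2) (Runs.const (Runs.seq (T₁ := 1) (T₂ := 1)
      (Runs.sub (Runs.add ⟨hl₃, ?_⟩))))
    rw [h6] at h
    have : ¬ ∃ v < S.n, S.IsCut v := fun h' => hI₁.2 h' h
    simp only [Setup.value, this, if_false, State.setReg_reg]
    simp [hI₃]
    omega

/-- Read a number in unary into the register `d`, from the address in the register `19` on. -/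
def readUnary (d : ℕ) : Cmd :=
  .const d 0 ;; .load 24 19 ;; .while 24 (.add d d 1 ;; .add 19 19 1 ;; .load 24 19) ;;
  .add 19 19 1

theorem runs_readUnary {d p m : ℕ} (hd : d ∉ [1, 19, 24]) (h1 : σ.reg 1 = 1) (hp : σ.reg 19 = p)
    (hm : ∀ i < m, σ.mem (p + i) ≠ 0) (hm' : σ.mem (p + m) = 0) :
    Runs (readUnary d) σ (fun σ' => σ'.mem = σ.mem ∧ σ'.reg d = m ∧ σ'.reg 19 = p + m + 1 ∧
      ∀ r, r ∉ [d, 19, 24] → σ'.reg r = σ.reg r) (m * 4 + 4) := by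
  simp only [List.mem_cons, List.not_mem_nil, or_false, not_or] at hd
  have loop : ∀ e j, j + e = m → ∀ σ₁ : State, σ₁.mem = σ.mem → σ₁.reg d = j →
      σ₁.reg 19 = p + j → σ₁.reg 24 = σ.mem (p + j) →
      (∀ r, r ∉ [d, 19, 24] → σ₁.reg r = σ.reg r) →
      Runs (.while 24 (.add d d 1 ;; .add 19 19 1 ;; .load 24 19)) σ₁ (fun σ' =>
        σ'.mem = σ.mem ∧ σ'.reg d = m ∧ σ'.reg 19 = p + m ∧
        ∀ r, r ∉ [d, 19, 24] → σ'.reg r = σ.reg r) (e * 4 + 1) := by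
    intro e
    induction e with
    | zero =>
      rintro j rfl σ₁ hmem hdj h19 h24 hr
      exact (Runs.while_false (h24.trans hm') ⟨hmem, hdj, h19, hr⟩).mono_time (by omega)
    | succ e ih =>
      intro j hj σ₁ hmem hdj h19 h24 hr
      have h1' : σ₁.reg 1 = 1 := by rw [hr 1 (by simp [Ne.symm hd.1]), h1]
      refine Runs.mono_time (Runs.while_true (h24 ▸ hm j (by omega)) (Runs.seq (Runs.add (Runs.seq
        (Runs.add (Runs.load (ih (j + 1) (by omega) _ hmem ?_ ?_ ?_ ?_)))))))
        (show 1 + (1 + 1) + (e * 4 + 1) + 1 ≤ _ by omega)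
      · simp [hd, hdj, h1']
      · simp [Ne.symm hd.2.1, Ne.symm hd.1, h19, h1']
        ring
      · simp [Ne.symm hd.2.1, Ne.symm hd.1, h19, h1', hmem]
        congr 1
      · intro r hr'
        rw [← hr r hr']
        simp only [List.mem_cons, List.not_mem_nil, or_false, not_or] at hr'
        simp [hr']
  refine Runs.mono_time (Runs.seq (Runs.const (Runs.seq (Runs.load (Runs.seq
    (Runs.mono (loop m 0 (by omega) _ rfl ?_ ?_ ?_ ?_) le_rfl ?_)))))) 
    (show 1 + (1 + ((m * 4 + 1) + 1)) ≤ _ by omega)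
  · simp [hd]
  · simp [Ne.symm hd.2.1, hp]
  · simp [Ne.symm hd.2.1, hp]
  · intro r hr'
    simp only [List.mem_cons, List.not_mem_nil, or_false, not_or] at hr'
    simp [hr']
  · rintro σ₁ ⟨hmem, h2, h3, h4⟩
    have h1' : σ₁.reg 1 = 1 := by rw [h4 1 (by simp [Ne.symm hd.1]), h1]
    refine Runs.add ⟨hmem, ?_, ?_, fun r hr => ?_⟩
    · simp [hd, h2]
    · simp [h3, h1']
    · rw [← h4 r hr]
      simp only [List.mem_cons, List.not_mem_nil, or_false, not_or] at hr
      simp [hr]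

/-- Read the parameters of the graph. -/
def readGraph : Cmd :=
  .const 1 1 ;; .const 19 0 ;; readUnary 2 ;; readUnary 3 ;; readUnary 4 ;; .const 5 0 ;; .add 5 5 19

/-- The input starts with the parameters in unary. -/
structure Setup.Header (S : Setup) : Prop where
  n : ∀ i < S.n, S.w i ≠ 0
  n_end : S.w S.n = 0
  s : ∀ i < S.s, S.w (S.n + 1 + i) ≠ 0
  s_end : S.w (S.n + 1 + S.s) = 0
  t : ∀ i < S.t, S.w (S.n + 1 + S.s + 1 + i) ≠ 0
  t_end : S.w (S.n + 1 + S.s + 1 + S.t) = 0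
  base : S.base = S.n + 1 + S.s + 1 + S.t + 1

theorem runs_readGraph (hS : S.Header) (h0 : σ.reg 0 = S.len) (hmem : σ.mem = S.w) :
    Runs readGraph σ (fun σ' => S.Regs σ' ∧ S.Low σ') (S.n * 4 + S.s * 4 + S.t * 4 + 16) := by
  refine Runs.mono_time (Runs.seq (Runs.const (Runs.seq (Runs.const (Runs.seq (Runs.mono
    (runs_readUnary (p := 0) (m := S.n) (by decide) (by simp) (by simp) (fun i hi => ?_) ?_)
    le_rfl ?_)))))) (show 1 + (1 + ((S.n * 4 + 4) + ((S.s * 4 + 4) + ((S.t * 4 + 4) + 2)))) ≤ _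
      by omega)
  · simpa [hmem] using hS.n i hi
  · simpa [hmem] using hS.n_end
  rintro σ₁ ⟨hmem₁, h1, h2, h3⟩
  simp only [State.setReg_mem] at hmem₁
  have h1' : σ₁.reg 1 = 1 := by rw [h3 1 (by decide)]; simp
  have h0' : σ₁.reg 0 = S.len := by rw [h3 0 (by decide)]; simp [h0]
  clear h3
  refine Runs.seq (Runs.mono (runs_readUnary (p := S.n + 1) (m := S.s) (by decide) h1'
    (by rw [h2]; ring) (fun i hi => ?_) ?_) le_rfl ?_)
  · rw [hmem₁, hmem]
    exact hS.s i hi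
  · rw [hmem₁, hmem]
    exact hS.s_end
  rintro σ₂ ⟨hmem₂, h4, h5, h6⟩
  have h1'' : σ₂.reg 1 = 1 := by rw [h6 1 (by decide), h1']
  have h0'' : σ₂.reg 0 = S.len := by rw [h6 0 (by decide), h0']
  have h2'' : σ₂.reg 2 = S.n := by rw [h6 2 (by decide), h1]
  clear h6
  refine Runs.seq (Runs.mono (runs_readUnary (p := S.n + 1 + S.s + 1) (m := S.t) (by decide) h1''
    h5 (fun i hi => ?_) ?_) le_rfl ?_)
  · rw [hmem₂, hmem₁, hmem]
    exact hS.t i hi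
  · rw [hmem₂, hmem₁, hmem]
    exact hS.t_end
  rintro σ₃ ⟨hmem₃, h7, h8, h9⟩
  refine Runs.seq (T₁ := 1) (T₂ := 1) (Runs.const (Runs.add ⟨⟨?_, ?_, ?_, ?_, ?_, ?_⟩, fun a _ => ?_⟩))
  · simp [h9 0 (by decide), h0'']
  · simp [h9 1 (by decide), h1'']
  · simp [h9 2 (by decide), h2'']
  · simp [h9 3 (by decide), h4]
  · simp [h7]
  · simp [h8, hS.base]
  · simp [hmem₃, hmem₂, hmem₁, hmem]

/-- Compute the separation number of the input graph in the register `0`. -/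
def separationProgram : Cmd := readGraph ;; separation ;; .const 0 0 ;; .add 0 0 8

theorem runs_separationProgram (hS : S.Header) (h0 : σ.reg 0 = S.len) (hmem : σ.mem = S.w) :
    Runs separationProgram σ (fun σ' => σ'.reg 0 = S.value)
      (S.n * 4 + S.s * 4 + S.t * 4 + 16 + (separationTime S.n + 2)) := by
  refine Runs.seq (Runs.mono (runs_readGraph hS h0 hmem) le_rfl ?_)
  rintro σ₁ ⟨hσ₁, hl₁⟩
  refine Runs.seq (Runs.mono (runs_separation hσ₁ hl₁) le_rfl ?_)
  rintro σ₂ ⟨-, h⟩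
  exact Runs.seq (T₁ := 1) (T₂ := 1) (Runs.const (Runs.add (by simp [h])))

/-- Read a number in binary, which follows the adjacency matrix, into the register `36`. -/
def readBinary : Cmd :=
  .const 19 0 ;; .add 19 19 5 ;; forLoop 38 39 2 (.add 19 19 2) ;; .sub 37 0 19 ;; .const 35 1 ;;
  .const 36 0 ;; forLoop 38 39 37
    (.load 24 19 ;; .ite 24 (.add 36 36 35) .skip ;; .add 35 35 35 ;; .add 19 19 1)

/-- The end of the matrix is found by `n` additions, and the input length then gives the number of
bits. After `j` bits register 35 holds `2 ^ j` and register 36 holds `k % 2 ^ j`. -/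
theorem runs_readBinary (hσ : S.Regs σ) (hlow : S.Low σ) {k m : ℕ}
    (hlen : S.len = S.base + S.n * S.n + m) (hk : k < 2 ^ m)
    (hw : ∀ i < m, (S.w (S.base + S.n * S.n + i) ≠ 0 ↔ k.testBit i)) :
    Runs readBinary σ (fun σ' => S.Low σ' ∧ σ'.reg 36 = k) (S.n * 4 + m * 8 + 13) := by
  refine Runs.mono_time (Runs.seq (Runs.const (Runs.seq (Runs.add (Runs.seq ?_)))))
    (show 1 + (1 + ((S.n * (1 + 3) + 4) + (1 + (1 + (1 + (m * (5 + 3) + 4)))))) ≤ _ by omega)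
  set σ₀ := (σ.setReg 19 0).setReg 19 ((σ.setReg 19 0).reg 19 + (σ.setReg 19 0).reg 5) with hσ₀
  have hr0 : ∀ r, r ≠ 19 → σ₀.reg r = σ.reg r := fun r hr => by simp [hσ₀, hr]
  have h19 : σ₀.reg 19 = S.base := by simp [hσ₀, hσ.base]
  have hl₀ : S.Low σ₀ := hlow
  clear_value σ₀
  have hσ₀' : S.Regs σ₀ := hσ.congr fun r hr => hr0 r (by omega)
  have hloop := Runs.forLoop (i := 38) (m := 39) (N := 2) (T := 1) (σ := σ₀)
    (I := fun j σ' => σ'.mem = σ₀.mem ∧ σ'.reg 19 = S.base + j * S.n)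
    (c := .add 19 19 2) (by decide) hσ₀'.one
    (by
      rintro σ' ⟨hmem, hreg⟩
      exact ⟨hmem, by rw [hreg 19 (by decide) (by decide), h19]; simp⟩)
    (by
      rintro j hj σ₁ hf hj₁ ⟨hmem, hp⟩
      refine Runs.add ?_
      rintro σ₃ ⟨hmem₃, hreg₃⟩
      refine ⟨by rw [hmem₃]; exact hmem, ?_⟩
      rw [hreg₃ 19 (by decide) (by decide)]
      simp [hp, hf 2 (by decide), hσ₀'.n]
      ring)
  rw [hσ₀'.n] at hloop
  refine Runs.mono hloop.frame le_rfl ?_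
  rintro σ₁ ⟨⟨hmem₁, hp₁⟩, hf₁⟩
  have hσ₁ : S.Regs σ₁ := hσ₀'.congr fun r hr => hf₁ r (by revert r; decide)
  refine Runs.seq (Runs.sub (Runs.seq (Runs.const (Runs.seq (Runs.const ?_)))))
  set σ₂ := ((σ₁.setReg 37 (σ₁.reg 0 - σ₁.reg 19)).setReg 35 1).setReg 36 0 with hσ₂
  have hr2 : ∀ r, r ≠ 35 → r ≠ 36 → r ≠ 37 → σ₂.reg r = σ₁.reg r := fun r h1 h2 h3 => by
    simp [hσ₂, h1, h2, h3]
  have h37 : σ₂.reg 37 = m := by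
    simp [hσ₂, hσ₁.len, hp₁, hlen]
  have h35 : σ₂.reg 35 = 1 := by simp [hσ₂]
  have h36 : σ₂.reg 36 = 0 := by simp [hσ₂]
  have hmem₂ : σ₂.mem = σ₀.mem := by rw [← hmem₁]; rfl
  clear_value σ₂
  have hσ₂' : S.Regs σ₂ := hσ₁.congr fun r hr => hr2 r (by omega) (by omega) (by omega)
  have hloop₂ := Runs.forLoop (i := 38) (m := 39) (N := 37) (T := 5) (σ := σ₂)
    (I := fun j σ' => σ'.mem = σ₀.mem ∧ σ'.reg 19 = S.base + S.n * S.n + j ∧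
      σ'.reg 35 = 2 ^ j ∧ σ'.reg 36 = k % 2 ^ j)
    (c := .load 24 19 ;; .ite 24 (.add 36 36 35) .skip ;; .add 35 35 35 ;; .add 19 19 1)
    (by decide) hσ₂'.one
    (by
      rintro σ' ⟨hmem, hreg⟩
      refine ⟨hmem.trans hmem₂, ?_, ?_, ?_⟩
      · rw [hreg 19 (by decide) (by decide), hr2 19 (by decide) (by decide) (by decide), hp₁]
        rfl
      · rw [hreg 35 (by decide) (by decide), h35, pow_zero]
      · rw [hreg 36 (by decide) (by decide), h36, pow_zero, Nat.mod_one])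
    (by
      rintro j hj σ₃ hf hj₃ ⟨hmem, hp, hpow, hacc⟩
      rw [h37] at hj
      have h1 : σ₃.reg 1 = 1 := by rw [hf 1 (by decide), hσ₂'.one]
      have hbit : σ₃.mem (σ₃.reg 19) ≠ 0 ↔ k / 2 ^ j % 2 = 1 := by
        rw [hp, hmem, hl₀ _ (by omega), hw j hj, Nat.testBit_eq_decide_div_mod_eq, decide_eq_true_iff]
      refine Runs.seq (T₁ := 1) (T₂ := 4) (Runs.load (Runs.seq (T₁ := 2) (T₂ := 2)
        (Runs.ite (fun h => Runs.add ?_) fun h => Runs.skip ?_)))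
      all_goals
        simp only [State.setReg_reg, if_true] at h
        refine Runs.seq (T₁ := 1) (T₂ := 1) (Runs.add (Runs.add ?_))
        rintro σ₄ ⟨hmem₄, hreg₄⟩
        refine ⟨hmem₄.trans hmem, ?_, ?_, ?_⟩
        · rw [hreg₄ 19 (by decide) (by decide)]
          simp [hp, h1]
          ring
        · rw [hreg₄ 35 (by decide) (by decide)]
          simp [hpow]
          ring
        · rw [hreg₄ 36 (by decide) (by decide), Nat.mod_pow_succ]
          first
          | simp [hpow, hacc, hbit.1 h]
          | (have hb : k / 2 ^ j % 2 = 0 := by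
              have := fun h' => hbit.2 h' h
              omega
             simp [hacc, hb]))
  rw [h37] at hloop₂
  refine Runs.mono hloop₂ le_rfl ?_
  rintro σ₃ ⟨hmem₃, -, -, h⟩
  exact ⟨fun a ha => by rw [hmem₃, hl₀ a ha], by rw [h, Nat.mod_eq_of_lt hk]⟩

/-- Decide in the register `0` whether the number in the register `36` is less than the one in the
register `8`, or the two given vertices are equal or adjacent. -/
def compareValue : Cmd :=
  .const 19 0 ;; .add 19 19 5 ;; .add 19 19 4 ;; forLoop 38 39 3 (.add 19 19 2) ;; .load 24 19 ;;
  .sub 22 3 4 ;; .sub 23 4 3 ;; .add 22 22 23 ;;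
  .ite 22 (.ite 24 (.const 0 1) (.sub 23 8 36 ;; .ite 23 (.const 0 1) (.const 0 0))) (.const 0 1)

open Classical in
theorem runs_compareValue (hσ : S.Regs σ) (hlow : S.Low σ) :
    Runs compareValue σ (fun σ' => σ'.reg 0 =
      if S.s = S.t ∨ S.A S.s S.t ∨ σ.reg 36 < σ.reg 8 then 1 else 0) (S.s * 4 + 16) := by
  have hle := S.le_len
  refine Runs.mono_time (Runs.seq (Runs.const (Runs.seq (Runs.add (Runs.seq (Runs.add
    (Runs.seq ?_))))))) (show 1 + (1 + (1 + ((S.s * (1 + 3) + 4) + 9))) ≤ _ by omega)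
  set σ₀ := ((σ.setReg 19 0).setReg 19 ((σ.setReg 19 0).reg 19 + (σ.setReg 19 0).reg 5)).setReg 19
    (((σ.setReg 19 0).setReg 19 ((σ.setReg 19 0).reg 19 + (σ.setReg 19 0).reg 5)).reg 19 +
      ((σ.setReg 19 0).setReg 19 ((σ.setReg 19 0).reg 19 + (σ.setReg 19 0).reg 5)).reg 4) with hσ₀
  have hr0 : ∀ r, r ≠ 19 → σ₀.reg r = σ.reg r := fun r hr => by simp [hσ₀, hr]
  have h19 : σ₀.reg 19 = S.base + S.t := by simp [hσ₀, hσ.base, hσ.t]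
  have hl₀ : S.Low σ₀ := hlow
  clear_value σ₀
  have hσ₀' : S.Regs σ₀ := hσ.congr fun r hr => hr0 r (by omega)
  have hloop := Runs.forLoop (i := 38) (m := 39) (N := 3) (T := 1) (σ := σ₀)
    (I := fun j σ' => σ'.mem = σ₀.mem ∧ σ'.reg 19 = S.base + j * S.n + S.t)
    (c := .add 19 19 2) (by decide) hσ₀'.one
    (by
      rintro σ' ⟨hmem, hreg⟩
      exact ⟨hmem, by rw [hreg 19 (by decide) (by decide), h19]; simp⟩)
    (by
      rintro j hj σ₁ hf hj₁ ⟨hmem, hp⟩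
      refine Runs.add ?_
      rintro σ₃ ⟨hmem₃, hreg₃⟩
      refine ⟨by rw [hmem₃]; exact hmem, ?_⟩
      rw [hreg₃ 19 (by decide) (by decide)]
      simp [hp, hf 2 (by decide), hσ₀'.n]
      ring)
  rw [hσ₀'.s] at hloop
  refine Runs.mono hloop.frame le_rfl ?_
  rintro σ₁ ⟨⟨hmem₁, hp₁⟩, hf₁⟩
  have hs := S.s_lt
  have ht := S.t_lt
  have hrow : S.s * S.n + S.n ≤ S.n * S.n := by
    rw [← Nat.succ_mul]
    exact Nat.mul_le_mul_right _ hs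
  have hA : σ₁.mem (σ₁.reg 19) ≠ 0 ↔ S.A S.s S.t := by
    rw [hp₁, hmem₁, hl₀ _ (by omega)]
    exact S.w_ne_zero _ hs _ ht
  have h3 : σ₁.reg 3 = S.s := by rw [hf₁ 3 (by decide), hσ₀'.s]
  have h4 : σ₁.reg 4 = S.t := by rw [hf₁ 4 (by decide), hσ₀'.t]
  have h8 : σ₁.reg 8 = σ.reg 8 := by rw [hf₁ 8 (by decide), hr0 8 (by decide)]
  have h36 : σ₁.reg 36 = σ.reg 36 := by rw [hf₁ 36 (by decide), hr0 36 (by decide)]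
  refine Runs.seq (T₁ := 1) (T₂ := 8) (Runs.load (Runs.seq (T₁ := 1) (T₂ := 7) (Runs.sub (Runs.seq
    (T₁ := 1) (T₂ := 6) (Runs.sub (Runs.seq (T₁ := 1) (T₂ := 5) (Runs.add (Runs.ite (T := 4)
    (fun h1 => Runs.ite (T := 3) (fun h2 => Runs.mono_time (Runs.const ?_) (by norm_num))
      fun h2 => Runs.seq (T₁ := 1) (T₂ := 2) (Runs.sub (Runs.ite (fun h5 => Runs.const ?_)
        fun h5 => Runs.const ?_)))
    fun h1 => Runs.mono_time (Runs.const ?_) (by norm_num)))))))))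
  all_goals
    simp [h3, h4] at h1
    try simp at h2
    try simp [h3, h4, h8, h36] at h5
    simp only [State.setReg_reg, if_true]
  · rw [if_pos (Or.inr (Or.inl (hA.1 h2)))]
  · rw [if_pos (Or.inr (Or.inr (by omega)))]
  · rw [if_neg]
    rintro (h | h | h)
    · omega
    · exact hA.2 h h2
    · omega
  · rw [if_pos (Or.inl (by omega))]

/-- Decide whether the input number is less than the separation number of the input graph, or the
two given vertices are equal or adjacent. -/
def rendezvousProgram : Cmd := readGraph ;; separation ;; readBinary ;; compareValue

open Classical in
theorem runs_rendezvousProgram (hS : S.Header) (h0 : σ.reg 0 = S.len) (hmem : σ.mem = S.w)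
    {k m : ℕ} (hlen : S.len = S.base + S.n * S.n + m) (hk : k < 2 ^ m)
    (hw : ∀ i < m, (S.w (S.base + S.n * S.n + i) ≠ 0 ↔ k.testBit i)) :
    Runs rendezvousProgram σ (fun σ' => σ'.reg 0 =
      if S.s = S.t ∨ S.A S.s S.t ∨ k < S.value then 1 else 0)
      (S.n * 4 + S.s * 4 + S.t * 4 + 16 + (separationTime S.n +
        (S.n * 4 + m * 8 + 13 + (S.s * 4 + 16)))) := by
  refine Runs.seq (Runs.mono (runs_readGraph hS h0 hmem) le_rfl ?_)
  rintro σ₁ ⟨hσ₁, hl₁⟩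
  refine Runs.seq (Runs.mono (runs_separation hσ₁ hl₁).frame le_rfl ?_)
  rintro σ₂ ⟨⟨hl₂, h8⟩, hf₂⟩
  have hσ₂ : S.Regs σ₂ := hσ₁.congr fun r hr => hf₂ r (by revert r; decide)
  refine Runs.seq (Runs.mono (runs_readBinary hσ₂ hl₂ hlen hk hw).frame le_rfl ?_)
  rintro σ₃ ⟨⟨hl₃, h36⟩, hf₃⟩
  have hσ₃ : S.Regs σ₃ := hσ₂.congr fun r hr => hf₃ r (by revert r; decide)
  have h := runs_compareValue hσ₃ hl₃
  rwa [h36, hf₃ 8 (by decide), h8] at h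

end MainPrograms

/-! ### Encoded graphs -/

section Encoding

theorem getElem?_unary_append_of_lt {m i : ℕ} (h : i < m) (R : List Bool) :
    (unary m ++ R)[i]? = some true := by
  simp [unary, List.getElem?_append, h]

theorem getElem?_unary_append_self (m : ℕ) (R : List Bool) :
    (unary m ++ R)[m]? = some false := by
  simp [unary]

theorem getElem?_unary_append_add (m i : ℕ) (R : List Bool) :
    (unary m ++ R)[m + 1 + i]? = R[i]? := by
  have : m + 1 = (unary m).length := by simp [unary]
  rw [this, List.getElem?_append_right (by omega), Nat.add_sub_cancel_left]

theorem length_flatMap_const {α β : Type*} {f : α → List β} {m : ℕ} (hf : ∀ a, (f a).length = m)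
    (l : List α) : (l.flatMap f).length = l.length * m := by
  simp [List.length_flatMap, hf]

theorem getElem?_flatMap_const {α β : Type*} {f : α → List β} {m : ℕ}
    (hf : ∀ a, (f a).length = m) (l : List α) {u v : ℕ} (hu : u < l.length) (hv : v < m) :
    (l.flatMap f)[u * m + v]? = (f l[u])[v]? := by
  induction l generalizing u with
  | nil => simp at hu
  | cons a l ih =>
    cases u with
    | zero => simp [List.getElem?_append_left, hf, hv]
    | succ u =>
      have h : (u + 1) * m + v = (f a).length + (u * m + v) := by rw [hf]; ring
      rw [List.flatMap_cons, h, List.getElem?_append_right (by omega), Nat.add_sub_cancel_left]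
      simpa using ih (by simpa using hu)

variable (I : GraphPair) (R : List Bool)

open Classical in
/-- The entries of the adjacency matrix, row by row. -/
noncomputable def GraphPair.matrix : List Bool :=
  (List.finRange I.n).flatMap fun u => (List.finRange I.n).map fun v => decide (I.graph.Adj u v)

theorem GraphPair.length_matrix : I.matrix.length = I.n * I.n := by
  simp [matrix, length_flatMap_const (m := I.n)]

theorem GraphPair.getElem?_matrix (u v : Fin I.n) :
    I.matrix[u * I.n + v]? = some true ↔ I.graph.Adj u v := by
  rw [matrix, getElem?_flatMap_const (by simp) _ (by simp) v.2]
  simp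

theorem encodeGraphPair_append : encodeGraphPair I ++ R =
    unary I.n ++ (unary I.s ++ (unary I.t ++ (I.matrix ++ R))) := by
  simp [encodeGraphPair, GraphPair.matrix]

theorem getElem?_encodeGraphPair_append (i : ℕ) :
    (encodeGraphPair I ++ R)[I.n + 1 + I.s + 1 + I.t + 1 + i]? = (I.matrix ++ R)[i]? := by
  have h : I.n + 1 + I.s + 1 + I.t + 1 + i = I.n + 1 + (I.s + 1 + (I.t + 1 + i)) := by ring
  rw [encodeGraphPair_append, h, getElem?_unary_append_add, getElem?_unary_append_add,
    getElem?_unary_append_add]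

theorem length_encodeGraphPair_append : (encodeGraphPair I ++ R).length =
    I.n + 1 + I.s + 1 + I.t + 1 + I.n * I.n + R.length := by
  rw [encodeGraphPair_append]
  simp [unary, GraphPair.length_matrix]
  ring

theorem getElem?_encodeGraphPair_append_tail (i : ℕ) :
    (encodeGraphPair I ++ R)[I.n + 1 + I.s + 1 + I.t + 1 + I.n * I.n + i]? = R[i]? := by
  rw [add_assoc, getElem?_encodeGraphPair_append, ← I.length_matrix,
    List.getElem?_append_right (by omega), Nat.add_sub_cancel_left]

/-- The data of the search for the encoded graph, followed by a list `R`. -/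
noncomputable def GraphPair.setup : Setup where
  n := I.n
  s := I.s
  t := I.t
  base := I.n + 1 + I.s + 1 + I.t + 1
  len := (encodeGraphPair I ++ R).length
  A u v := ∃ (hu : u < I.n) (hv : v < I.n), I.graph.Adj ⟨u, hu⟩ ⟨v, hv⟩
  w := (initState (encodeGraphPair I ++ R)).mem
  le_len := by rw [length_encodeGraphPair_append]; omega
  lt_of_A := fun u v ⟨hu, hv, _⟩ => ⟨hu, hv⟩
  w_ne_zero := fun u hu v hv => by
    have h := I.getElem?_matrix ⟨u, hu⟩ ⟨v, hv⟩
    have hlt : u * I.n + v < I.matrix.length := by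
      rw [I.length_matrix]
      calc u * I.n + v < (u + 1) * I.n := by rw [add_mul]; omega
        _ ≤ I.n * I.n := Nat.mul_le_mul_right _ hu
    rw [add_assoc _ (u * I.n)]
    simp only [initState, getElem?_encodeGraphPair_append, List.getElem?_append_left hlt]
    simp [h, hu, hv]
  s_lt := I.s.2
  t_lt := I.t.2

theorem GraphPair.setup_header : (I.setup R).Header where
  n i hi := by
    have hi : i < I.n := hi
    simp [setup, initState, encodeGraphPair_append, getElem?_unary_append_of_lt hi]
  n_end := by
    simp [setup, initState, encodeGraphPair_append, getElem?_unary_append_self]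
  s i hi := by
    have hi : i < I.s := hi
    simp [setup, initState, encodeGraphPair_append, getElem?_unary_append_add,
      getElem?_unary_append_of_lt hi]
  s_end := by
    simp [setup, initState, encodeGraphPair_append, getElem?_unary_append_add,
      getElem?_unary_append_self]
  t i hi := by
    have hi : i < I.t := hi
    have h : I.n + 1 + I.s + 1 + i = I.n + 1 + (I.s + 1 + i) := by ring
    simp [setup, initState, encodeGraphPair_append, h, getElem?_unary_append_add,
      getElem?_unary_append_of_lt hi]
  t_end := by
    have h : I.n + 1 + I.s + 1 + I.t = I.n + 1 + (I.s + 1 + I.t) := by ring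
    simp [setup, initState, encodeGraphPair_append, h, getElem?_unary_append_add,
      getElem?_unary_append_self]
  base := rfl

/-! ### The search in terms of walks in the graph -/

variable {I R}

theorem GraphPair.setup_A {u v : Fin I.n} : (I.setup R).A u v ↔ I.graph.Adj u v :=
  ⟨fun ⟨_, _, h⟩ => h, fun h => ⟨u.2, v.2, h⟩⟩

theorem mem_reach_of_avoid {r u x y : Fin I.n} (h : Avoid I.graph {x, y} r u) :
    (u : ℕ) ∈ (I.setup R).reach r x y := by
  obtain ⟨p, hp⟩ := h
  induction p with
  | nil => exact Relation.ReflTransGen.refl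
  | @cons a b c hab p ih =>
    have ha : a ∉ ({x, y} : Set (Fin I.n)) := hp a (by simp)
    refine Relation.ReflTransGen.head ⟨?_, GraphPair.setup_A.2 hab⟩
      (ih fun z hz => hp z (by simp [hz]))
    simpa [Fin.ext_iff] using ha

/-- The search may enter `x` and `y` but not leave them, so only the last vertex of its walk can be
one of them. One search thus finds a component together with its attachments. -/
theorem mem_reach_iff {r x y z : Fin I.n} (hr : r ∉ ({x, y} : Set (Fin I.n))) :
    (z : ℕ) ∈ (I.setup R).reach r x y ↔
      z = r ∨ ∃ u, Avoid I.graph {x, y} r u ∧ I.graph.Adj u z := by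
  constructor
  · intro h
    suffices ∀ b : ℕ, b ∈ (I.setup R).reach r x y → ∃ hb : b < I.n, (⟨b, hb⟩ : Fin I.n) = r ∨
        ∃ u, Avoid I.graph {x, y} r u ∧ I.graph.Adj u ⟨b, hb⟩ from (this z h).2
    intro b hb
    induction hb with
    | refl => exact ⟨r.2, Or.inl rfl⟩
    | @tail b c _ hbc ih =>
      obtain ⟨⟨hx, hy⟩, hb, hc, hadj⟩ := hbc
      have hbxy : (⟨b, hb⟩ : Fin I.n) ∉ ({x, y} : Set (Fin I.n)) := by
        simpa [Fin.ext_iff] using ⟨hx, hy⟩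
      obtain ⟨_, rfl | ⟨u, hu, hub⟩⟩ := ih
      · exact ⟨hc, Or.inr ⟨_, Avoid.refl hr, hadj⟩⟩
      · exact ⟨hc, Or.inr ⟨_, hu.trans (Avoid.of_adj hub hu.right hbxy), hadj⟩⟩
  · rintro (rfl | ⟨u, hu, huz⟩)
    · exact Relation.ReflTransGen.refl
    · refine Relation.ReflTransGen.tail (mem_reach_of_avoid hu) ⟨?_, GraphPair.setup_A.2 huz⟩
      simpa [Fin.ext_iff] using hu.right

theorem mem_reach_iff_avoid {r x y z : Fin I.n} (hr : r ∉ ({x, y} : Set (Fin I.n)))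
    (hz : z ∉ ({x, y} : Set (Fin I.n))) :
    (z : ℕ) ∈ (I.setup R).reach r x y ↔ Avoid I.graph {x, y} r z := by
  refine ⟨fun h => ?_, mem_reach_of_avoid⟩
  obtain rfl | ⟨u, hu, huz⟩ := (mem_reach_iff hr).1 h
  · exact Avoid.refl hr
  · exact hu.trans (Avoid.of_adj huz hu.right hz)

theorem GraphPair.isCut_iff {v : Fin I.n} : (I.setup R).IsCut v ↔
    v ≠ I.s ∧ v ≠ I.t ∧ ¬ Avoid I.graph {v} I.s I.t := by
  simp only [Setup.IsCut, GraphPair.setup, ne_eq, Fin.val_inj]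
  refine and_congr_right fun hs => and_congr_right fun ht => not_congr ?_
  have h := mem_reach_iff_avoid (R := R) (r := I.s) (x := v) (y := v) (z := I.t)
    (by simpa using Ne.symm hs) (by simpa using Ne.symm ht)
  rwa [Set.pair_eq_singleton] at h

theorem GraphPair.isLeast_iff {v : Fin I.n} : (I.setup R).IsLeast v ↔
    v ∉ ({I.s, I.t} : Set (Fin I.n)) ∧ IsFull I.graph I.s I.t v ∧
      ∀ u < v, ¬ Avoid I.graph {I.s, I.t} v u := by
  rw [Setup.IsLeast, Set.mem_insert_iff, Set.mem_singleton_iff, not_or, and_assoc (a := ¬ v = I.s)]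
  refine Iff.trans (and_congr (not_congr Fin.val_inj) (and_congr (not_congr Fin.val_inj) Iff.rfl))
    (and_congr_right fun hs => and_congr_right fun ht => ?_)
  have hv : v ∉ ({I.s, I.t} : Set (Fin I.n)) := by simp [hs, ht]
  refine and_congr (and_congr ?_ ?_) ⟨fun h u hu hvu => ?_, fun h u hu hus hut hvu => ?_⟩
  · exact (mem_reach_iff hv).trans (or_iff_right (Ne.symm hs))
  · exact (mem_reach_iff hv).trans (or_iff_right (Ne.symm ht))
  · have hu' := hvu.right
    rw [Set.mem_insert_iff, Set.mem_singleton_iff, not_or] at hu'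
    exact h u hu (fun h => hu'.1 (Fin.ext h)) (fun h => hu'.2 (Fin.ext h)) (mem_reach_of_avoid hvu)
  · have hun : u < I.n := hu.trans v.2
    refine h ⟨u, hun⟩ hu ((mem_reach_iff_avoid (z := ⟨u, hun⟩) hv ?_).1 hvu)
    rw [Set.mem_insert_iff, Set.mem_singleton_iff, not_or]
    exact ⟨fun h => hus (congrArg Fin.val h), fun h => hut (congrArg Fin.val h)⟩

theorem avoid_iff_of_avoid {V : Type*} {G : SimpleGraph V} {B : Set V} {u v : V}
    (h : Avoid G B u v) (x : V) : Avoid G B u x ↔ Avoid G B v x :=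
  ⟨h.symm.trans, h.trans⟩

-- Taking the least vertex of each attached component is a bijection, so counting least vertices
-- counts components.
open Classical in
theorem GraphPair.card_isLeast : ((Finset.range I.n).filter (I.setup R).IsLeast).card =
    (fullComponents I.graph I.s I.t).ncard := by
  rw [← Set.ncard_coe_finset]
  have hlt : ∀ v ∈ ((Finset.range I.n).filter (I.setup R).IsLeast : Set ℕ), v < I.n :=
    fun v hv => by simpa using (Finset.mem_filter.1 hv).1
  have hmem : ∀ (v : ℕ) (hv : v ∈ ((Finset.range I.n).filter (I.setup R).IsLeast : Set ℕ)),
      _ := fun v hv =>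
    (GraphPair.isLeast_iff (R := R) (v := ⟨v, hlt v hv⟩)).1 (Finset.mem_filter.1 hv).2
  refine Set.ncard_congr (fun v hv => {u | Avoid I.graph {I.s, I.t} ⟨v, hlt v hv⟩ u})
    (fun v hv => ⟨_, (hmem v hv).2.1, rfl⟩) (fun u v hu hv huv => ?_) ?_
  · have h1 : Avoid I.graph {I.s, I.t} ⟨u, hlt u hu⟩ ⟨v, hlt v hv⟩ := by
      have h : (⟨v, hlt v hv⟩ : Fin I.n) ∈ {x | Avoid I.graph {I.s, I.t} ⟨v, hlt v hv⟩ x} :=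
        Avoid.refl (hmem v hv).1
      exact huv.symm.subset h
    rcases lt_trichotomy u v with h | h | h
    · exact ((hmem v hv).2.2 _ h h1.symm).elim
    · exact h
    · exact ((hmem u hu).2.2 _ h h1).elim
  · rintro _ ⟨v, hv, rfl⟩
    obtain ⟨u, hu, hmin⟩ := WellFounded.has_min (wellFounded_lt (α := Fin I.n))
      {u | Avoid I.graph {I.s, I.t} v u} ⟨v, Avoid.refl hv.1.choose_spec.1.left⟩
    have hu : Avoid I.graph {I.s, I.t} v u := hu
    refine ⟨u, ?_, Set.ext fun x => (avoid_iff_of_avoid hu x).symm⟩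
    rw [Finset.coe_filter, Set.mem_ofPred_eq, Finset.mem_range]
    refine ⟨u.2, GraphPair.isLeast_iff.2 ⟨hu.right, ?_, fun x hx hux => hmin x (hu.trans hux) hx⟩⟩
    simpa only [IsFull, avoid_iff_of_avoid hu] using hv

theorem GraphPair.value_setup : (I.setup R).value = sepValue I.graph I.s I.t := by
  classical
  have h : (∃ v < I.n, (I.setup R).IsCut v) ↔ HasCut I.graph I.s I.t :=
    ⟨fun ⟨v, hv, h⟩ => ⟨⟨v, hv⟩, GraphPair.isCut_iff.1 h⟩,
      fun ⟨v, h⟩ => ⟨v, v.2, GraphPair.isCut_iff.2 h⟩⟩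
  rw [Setup.value, sepValue, ← GraphPair.card_isLeast (R := R)]
  exact if_congr h rfl (by congr)

end Encoding

/-! ### Polynomial time -/

section PolynomialTime

/-- A polynomial bounding the running time of `separation`. -/
noncomputable def separationPolynomial : Polynomial ℕ :=
  let X := Polynomial.X
  let q : Polynomial ℕ := X * (X * (X * 9 + 19) + 9) + X * 6 + 10
  X * (q + 21) + X * (q + X * 7 + 32) + 14

theorem eval_separationPolynomial (n : ℕ) :
    separationPolynomial.eval n = separationTime n := by
  simp [separationPolynomial, separationTime, searchTime]

theorem separationTime_mono {m n : ℕ} (h : m ≤ n) : separationTime m ≤ separationTime n := by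
  unfold separationTime searchTime
  gcongr

/-- The class of graphs enters only through the criterion `h`; the program is the same for all
classes. Its time bound is monotone, and `n`, `s`, `t` and the number of bits are at most the input
length. -/
theorem polyTimeDecidableOn_isYes {C : Instance → Prop}
    (h : ∀ I : Instance, C I → (I.IsYes ↔
      I.s = I.t ∨ I.graph.Adj I.s I.t ∨ I.k < sepValue I.graph I.s I.t)) :
    PolyTimeDecidableOn encodeInstance C Instance.IsYes := by
  classical
  let X : Polynomial ℕ := Polynomial.X
  refine ⟨rendezvousProgram, X * 4 + X * 4 + X * 4 + 16 + (separationPolynomial +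
    (X * 4 + X * 8 + 13 + (X * 4 + 16))), fun I hI => ?_⟩
  have hlen := length_encodeGraphPair_append I.toGraphPair (Nat.bits I.k)
  have hk : I.k < 2 ^ (Nat.bits I.k).length := by
    rw [Nat.size_eq_bits_len]
    exact Nat.lt_size_self _
  obtain ⟨σ, T, hex, hT, h0⟩ := runs_rendezvousProgram (σ := initState (encodeInstance I))
    (I.toGraphPair.setup_header (Nat.bits I.k)) rfl rfl hlen hk (fun i hi => by
      simp only [GraphPair.setup, initState, getElem?_encodeGraphPair_append_tail]
      rw [Nat.testBit_eq_inth, List.getI_eq_getElem _ hi, List.getElem?_eq_getElem hi]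
      simp)
  refine ⟨σ, T, hex, hT.trans ?_, ?_⟩
  · have hn : I.n ≤ (encodeInstance I).length := by rw [encodeInstance, hlen]; omega
    have hs : (I.s : ℕ) ≤ (encodeInstance I).length := I.s.2.le.trans hn
    have ht : (I.t : ℕ) ≤ (encodeInstance I).length := I.t.2.le.trans hn
    have hm : (Nat.bits I.k).length ≤ (encodeInstance I).length := by simp [encodeInstance]
    have hsep := separationTime_mono hn
    simp only [Polynomial.eval_add, Polynomial.eval_mul, eval_separationPolynomial, X,
      Polynomial.eval_X, Polynomial.eval_ofNat]
    simp only [GraphPair.setup]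
    omega
  · rw [h0, GraphPair.value_setup]
    have hiff : ((I.toGraphPair.setup (Nat.bits I.k)).s = (I.toGraphPair.setup (Nat.bits I.k)).t ∨
        (I.toGraphPair.setup (Nat.bits I.k)).A (I.toGraphPair.setup (Nat.bits I.k)).s
          (I.toGraphPair.setup (Nat.bits I.k)).t ∨ I.k < sepValue I.graph I.s I.t) ↔ I.IsYes :=
      (or_congr Fin.val_inj (or_congr GraphPair.setup_A Iff.rfl)).trans (h I hI).symm
    simp only
    by_cases hyes : I.IsYes
    · rw [if_pos hyes, if_pos (hiff.2 hyes), Nat.cast_one]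
    · rw [if_neg hyes, if_neg (fun h' => hyes (hiff.1 h')), Nat.cast_zero]

theorem polyTimeComputableOn_of_eq_sepValue {C : GraphPair → Prop} {f : GraphPair → ℕ∞}
    (h : ∀ I, C I → f I = sepValue I.graph I.s I.t) :
    PolyTimeComputableOn encodeGraphPair C f := by
  let X : Polynomial ℕ := Polynomial.X
  refine ⟨separationProgram, X * 4 + X * 4 + X * 4 + 16 + (separationPolynomial + 2),
    fun I hI => ?_⟩
  obtain ⟨σ, T, hex, hT, h0⟩ := runs_separationProgram (I.setup_header []) (σ :=
    initState (encodeGraphPair I ++ [])) rfl rfl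
  rw [List.append_nil] at hex
  refine ⟨σ, T, hex, hT.trans ?_, by rw [h0, GraphPair.value_setup, h I hI]⟩
  have hlen := length_encodeGraphPair_append I []
  rw [List.append_nil] at hlen
  have hn : I.n ≤ (encodeGraphPair I).length := by omega
  have hs : (I.s : ℕ) ≤ (encodeGraphPair I).length := I.s.2.le.trans hn
  have ht : (I.t : ℕ) ≤ (encodeGraphPair I).length := I.t.2.le.trans hn
  have hsep := separationTime_mono hn
  simp only [Polynomial.eval_add, Polynomial.eval_mul, eval_separationPolynomial, X,
    Polynomial.eval_X, Polynomial.eval_ofNat]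
  simp only [GraphPair.setup]
  omega

end PolynomialTime

end Rendezvous

theorem theorem4 :
    -- Rendezvous is solvable in polynomial time on connected graphs of treewidth at most two
    (Rendezvous.PolyTimeDecidableOn Rendezvous.encodeInstance
      (fun I => I.graph.Connected ∧ Rendezvous.treewidth I.graph ≤ 2)
      Rendezvous.Instance.IsYes) ∧
    -- Rendezvous is solvable in polynomial time on grids
    (Rendezvous.PolyTimeDecidableOn Rendezvous.encodeInstance
      (fun I => Rendezvous.IsGrid I.graph)
      Rendezvous.Instance.IsYes) ∧
    -- on connected graphs of treewidth at most two, `d_G(s,t) = λ_G(s,t)` for all `s`, `t`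
    (∀ (V : Type*) [Finite V] (G : SimpleGraph V), G.Connected → Rendezvous.treewidth G ≤ 2 →
      ∀ s t : V, Rendezvous.dynSep G s t = Rendezvous.statSep G s t) ∧
    -- and this number is computable in polynomial time for distinct non-adjacent `s`, `t`
    (Rendezvous.PolyTimeComputableOn Rendezvous.encodeGraphPair
      (fun I => I.graph.Connected ∧ Rendezvous.treewidth I.graph ≤ 2 ∧
        I.s ≠ I.t ∧ ¬ I.graph.Adj I.s I.t)
      (fun I => Rendezvous.statSep I.graph I.s I.t)) ∧
    -- on grids, `d_G(s,t) = 2` for all distinct non-adjacent `s`, `t`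
    (∀ M N : ℕ, 2 ≤ M → 2 ≤ N → ∀ s t : Fin M × Fin N, s ≠ t →
      ¬ (Rendezvous.grid M N).Adj s t → Rendezvous.dynSep (Rendezvous.grid M N) s t = 2) := by
  refine ⟨Rendezvous.polyTimeDecidableOn_isYes fun I hI =>
      Rendezvous.facilitatorWins_iff_of_treewidth hI.1 hI.2 I.k_pos,
    Rendezvous.polyTimeDecidableOn_isYes fun I hI =>
      Rendezvous.facilitatorWins_iff_of_isGrid hI I.k_pos,
    fun V _ G hG htw s t => Rendezvous.dynSep_eq_statSep hG htw s t,
    Rendezvous.polyTimeComputableOn_of_eq_sepValue fun I hI =>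
      Rendezvous.statSep_eq_sepValue hI.1 hI.2.1 hI.2.2.1 hI.2.2.2,
    fun M N hM hN s t hst hadj => Rendezvous.dynSep_grid hM hN hst hadj⟩
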